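/- Let $k$ be a field of characteristic zero. A differential graded (dg) Lie algebra over $k$ is a chain complex $(\mathfrak g_*,d)$ of $k$-vector spaces indexed by $\mathbb Z$, with $d:\mathfrak g_i\to\mathfrak g_{i-1}$, together with bilinear brackets $[-,-]:\mathfrak g_p\times\mathfrak g_q\to\mathfrak g_{p+q}$ such that, for $x\in\mathfrak g_p$, $y\in\mathfrak g_q$, $z\in\mathfrak g_r$, $$[x,y]+(-1)^{pq}[y,x]=0,$$ $$(-1)^{pr}[x,[y,z]]+(-1)^{pq}[y,[z,x]]+(-1)^{qr}[z,[x,y]]=0,$$ $$d[x,y]=[dx,y]+(-1)^p[x,dy].$$ Morphisms of dg Lie algebras are the chain maps that respect the brackets; they form a category $\mathrm{Lie}^{dg}_k$. Let $\mathrm{Free}$ be the left adjoint of the forgetful functor from $\mathrm{Lie}^{dg}_k$ to chain complexes of $k$-vector spaces. For $n\in\mathbb Z$ let $E(n)$ be the complex that is $k$ in degrees $n$ and $n-1$, with the identity of $k$ as differential, and zero in all other degrees, and let $\partial E(n)\subset E(n)$ be the subcomplex that consists of the part of degree $n-1$. Then $\mathrm{Lie}^{dg}_k$ carries a model structure such that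 1. the weak equivalences are the quasi-isomorphisms, i.e. the morphisms whose underlying chain map induces an isomorphism on homology; 2. the fibrations are the morphisms $f:\mathfrak g_*\to\mathfrak g'_*$ for which $f_n:\mathfrak g_n\to\mathfrak g'_n$ is surjective for every $n\in\mathbb Z$; 3. the cofibrations are generated by the set of morphisms $\mathrm{Free}(\partial E(n))\to\mathrm{Free}(E(n))$, $n\in\mathbb Z$: they are exactly the retracts of transfinite compositions of pushouts of (small) coproducts of these morphisms; 4. the model category is combinatorial: the category is locally presentable, it has all small limits and colimits, and the cofibrations, as well as the trivial cofibrations, are generated (in the sense of 3) by a small set of morphisms; 5. the model category is left proper: every pushout of a weak equivalence along a cofibration is a weak equivalence. -/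

import Mathlib

open CategoryTheory CategoryTheory.Limits HomotopicalAlgebra

universe w v u

/-- A differential graded Lie algebra over a field `k`, used in characteristic zero:
a chain complex of `k`-vector spaces indexed by `ℤ`, with differential of degree `-1`, and a
bilinear bracket `g_p × g_q → g_n` for `p + q = n` which is graded antisymmetric, satisfies the
graded Jacobi identity, and for which the differential is a graded derivation. (The target degree
`n` of the bracket is a separate argument so that no transport along `p + q = q + p` occurs.) -/
structure DGLieAlgebra (k : Type u) [Field k] where
  /-- the underlying chain complex -/
  complex : ChainComplex (ModuleCat.{u} k) ℤ
  /-- the bracket -/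
  bracket (p q n : ℤ) (h : p + q = n) : complex.X p →ₗ[k] complex.X q →ₗ[k] complex.X n
  antisymm (p q n : ℤ) (h : p + q = n) (x : complex.X p) (y : complex.X q) :
    bracket p q n h x y + (-1 : k) ^ (p * q) • bracket q p n (by lia) y x = 0
  jacobi (p q r n : ℤ) (h : p + q + r = n)
      (x : complex.X p) (y : complex.X q) (z : complex.X r) :
    (-1 : k) ^ (p * r) • bracket p (q + r) n (by lia) x (bracket q r (q + r) rfl y z) +
      (-1 : k) ^ (p * q) • bracket q (r + p) n (by lia) y (bracket r p (r + p) rfl z x) +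
      (-1 : k) ^ (q * r) • bracket r (p + q) n (by lia) z (bracket p q (p + q) rfl x y) = 0
  leibniz (p q n : ℤ) (h : p + q = n) (x : complex.X p) (y : complex.X q) :
    (complex.d n (n - 1)).hom (bracket p q n h x y) =
      bracket (p - 1) q (n - 1) (by lia) ((complex.d p (p - 1)).hom x) y +
        (-1 : k) ^ p • bracket p (q - 1) (n - 1) (by lia) x ((complex.d q (q - 1)).hom y)

namespace DGLieAlgebra

variable {k : Type u} [Field k]

/-- A morphism of dg Lie algebras: a morphism of chain complexes which respects the bracket. -/
@[ext]
structure Hom (L M : DGLieAlgebra k) where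
  /-- the underlying morphism of chain complexes -/
  hom : L.complex ⟶ M.complex
  map_bracket (p q n : ℤ) (h : p + q = n) (x : L.complex.X p) (y : L.complex.X q) :
    (hom.f n).hom (L.bracket p q n h x y) =
      M.bracket p q n h ((hom.f p).hom x) ((hom.f q).hom y)

/-- The category of dg Lie algebras over `k`. -/
instance : Category.{u} (DGLieAlgebra k) where
  Hom L M := Hom L M
  id L := { hom := 𝟙 _, map_bracket := by intros; simp }
  comp f g :=
    { hom := f.hom ≫ g.hom
      map_bracket := by intros; simp [f.map_bracket, g.map_bracket] }

@[ext]
lemma hom_ext {L M : DGLieAlgebra k} {f g : L ⟶ M} (h : f.hom = g.hom) : f = g :=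
  Hom.ext h

@[simp] lemma id_hom (L : DGLieAlgebra k) : Hom.hom (𝟙 L) = 𝟙 L.complex := rfl

@[simp] lemma comp_hom {L M N : DGLieAlgebra k} (f : L ⟶ M) (g : M ⟶ N) :
    (f ≫ g).hom = f.hom ≫ g.hom := rfl

variable (k) in
/-- The forgetful functor from dg Lie algebras to chain complexes. -/
def forgetToComplex : DGLieAlgebra k ⥤ ChainComplex (ModuleCat.{u} k) ℤ where
  obj L := L.complex
  map f := f.hom

variable (k) in
/-- The class of quasi-isomorphisms of dg Lie algebras. -/
def quasiIsos : MorphismProperty (DGLieAlgebra k) := fun _ _ f ↦ QuasiIso f.hom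

variable (k) in
/-- The class of degreewise surjective morphisms of dg Lie algebras. -/
def degreewiseSurjections : MorphismProperty (DGLieAlgebra k) :=
  fun _ _ f ↦ ∀ n : ℤ, Function.Surjective (f.hom.f n).hom

section Free

variable (V : ChainComplex (ModuleCat.{u} k) ℤ)

/-- Homogeneous formal expressions in the elements of `V`, built with the operations of a
dg Lie algebra. -/
inductive FreeTerm : ℤ → Type u
  | of {n : ℤ} (x : V.X n) : FreeTerm n
  | zero {n : ℤ} : FreeTerm n
  | add {n : ℤ} (a b : FreeTerm n) : FreeTerm n
  | smul {n : ℤ} (c : k) (a : FreeTerm n) : FreeTerm n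
  | d (p q : ℤ) (a : FreeTerm p) : FreeTerm q
  | br (p q n : ℤ) (h : p + q = n) (a : FreeTerm p) (b : FreeTerm q) : FreeTerm n

open FreeTerm

/-- The congruence on formal expressions generated by the axioms of dg Lie algebras and by the
requirement that `V → FreeTerm V` becomes a morphism of chain complexes. -/
inductive FreeRel : ∀ {n : ℤ}, FreeTerm V n → FreeTerm V n → Prop
  -- equivalence relation
  | refl {n : ℤ} (a : FreeTerm V n) : FreeRel a a
  | symm {n : ℤ} {a b : FreeTerm V n} : FreeRel a b → FreeRel b a
  | trans {n : ℤ} {a b c : FreeTerm V n} : FreeRel a b → FreeRel b c → FreeRel a c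
  -- compatibility with the operations
  | add_congr {n : ℤ} {a a' b b' : FreeTerm V n} :
      FreeRel a a' → FreeRel b b' → FreeRel (add a b) (add a' b')
  | smul_congr {n : ℤ} (c : k) {a a' : FreeTerm V n} :
      FreeRel a a' → FreeRel (smul c a) (smul c a')
  | d_congr (p q : ℤ) {a a' : FreeTerm V p} : FreeRel a a' → FreeRel (d p q a) (d p q a')
  | bracket_congr (p q n : ℤ) (h : p + q = n) {a a' : FreeTerm V p} {b b' : FreeTerm V q} :
      FreeRel a a' → FreeRel b b' → FreeRel (br p q n h a b) (br p q n h a' b')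
  -- vector space axioms
  | add_assoc {n : ℤ} (a b c : FreeTerm V n) : FreeRel (add (add a b) c) (add a (add b c))
  | add_comm {n : ℤ} (a b : FreeTerm V n) : FreeRel (add a b) (add b a)
  | zero_add {n : ℤ} (a : FreeTerm V n) : FreeRel (add zero a) a
  | smul_add {n : ℤ} (c : k) (a b : FreeTerm V n) :
      FreeRel (smul c (add a b)) (add (smul c a) (smul c b))
  | add_smul {n : ℤ} (c c' : k) (a : FreeTerm V n) :
      FreeRel (smul (c + c') a) (add (smul c a) (smul c' a))
  | mul_smul {n : ℤ} (c c' : k) (a : FreeTerm V n) :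
      FreeRel (smul (c * c') a) (smul c (smul c' a))
  | one_smul {n : ℤ} (a : FreeTerm V n) : FreeRel (smul 1 a) a
  | zero_smul {n : ℤ} (a : FreeTerm V n) : FreeRel (smul 0 a) zero
  -- the differential is linear, has degree `-1` and square zero
  | d_add (p q : ℤ) (a b : FreeTerm V p) : FreeRel (d p q (add a b)) (add (d p q a) (d p q b))
  | d_smul (p q : ℤ) (c : k) (a : FreeTerm V p) : FreeRel (d p q (smul c a)) (smul c (d p q a))
  | d_shape (p q : ℤ) (h : q + 1 ≠ p) (a : FreeTerm V p) : FreeRel (d p q a) zero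
  | d_d (p q r : ℤ) (a : FreeTerm V p) : FreeRel (d q r (d p q a)) zero
  -- the bracket is bilinear
  | add_bracket (p q n : ℤ) (h : p + q = n) (a a' : FreeTerm V p) (b : FreeTerm V q) :
      FreeRel (br p q n h (add a a') b) (add (br p q n h a b) (br p q n h a' b))
  | smul_bracket (p q n : ℤ) (h : p + q = n) (c : k) (a : FreeTerm V p) (b : FreeTerm V q) :
      FreeRel (br p q n h (smul c a) b) (smul c (br p q n h a b))
  | bracket_add (p q n : ℤ) (h : p + q = n) (a : FreeTerm V p) (b b' : FreeTerm V q) :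
      FreeRel (br p q n h a (add b b')) (add (br p q n h a b) (br p q n h a b'))
  | bracket_smul (p q n : ℤ) (h : p + q = n) (c : k) (a : FreeTerm V p) (b : FreeTerm V q) :
      FreeRel (br p q n h a (smul c b)) (smul c (br p q n h a b))
  -- axioms of dg Lie algebras
  | antisymm (p q n : ℤ) (h : p + q = n) (a : FreeTerm V p) (b : FreeTerm V q) :
      FreeRel (add (br p q n h a b)
        (smul ((-1 : k) ^ (p * q)) (br q p n (by lia) b a))) zero
  | jacobi (p q r n : ℤ) (h : p + q + r = n)
      (a : FreeTerm V p) (b : FreeTerm V q) (c : FreeTerm V r) :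
      FreeRel (add (add
        (smul ((-1 : k) ^ (p * r))
          (br p (q + r) n (by lia) a (br q r (q + r) rfl b c)))
        (smul ((-1 : k) ^ (p * q))
          (br q (r + p) n (by lia) b (br r p (r + p) rfl c a))))
        (smul ((-1 : k) ^ (q * r))
          (br r (p + q) n (by lia) c (br p q (p + q) rfl a b)))) zero
  | leibniz (p q n : ℤ) (h : p + q = n) (a : FreeTerm V p) (b : FreeTerm V q) :
      FreeRel (d n (n - 1) (br p q n h a b))
        (add (br (p - 1) q (n - 1) (by lia) (d p (p - 1) a) b)
          (smul ((-1 : k) ^ p) (br p (q - 1) (n - 1) (by lia) a (d q (q - 1) b))))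
  -- the inclusion of `V` is a morphism of chain complexes
  | of_add {n : ℤ} (x y : V.X n) : FreeRel (of (x + y)) (add (of x) (of y))
  | of_smul {n : ℤ} (c : k) (x : V.X n) : FreeRel (of (c • x)) (smul c (of x))
  | of_d (p q : ℤ) (x : V.X p) : FreeRel (of ((V.d p q).hom x)) (d p q (of x))

/-- The congruence `FreeRel`, as a setoid. -/
def freeSetoid (n : ℤ) : Setoid (FreeTerm V n) where
  r := FreeRel V
  iseqv := ⟨FreeRel.refl, FreeRel.symm, FreeRel.trans⟩

/-- The degree `n` part of the free dg Lie algebra on `V`. -/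
def FreeX (n : ℤ) : Type u := Quotient (freeSetoid V n)

namespace FreeX

variable {V}

/-- The class of a formal expression. -/
def mk {n : ℤ} (a : FreeTerm V n) : FreeX V n := Quotient.mk (freeSetoid V n) a

lemma sound {n : ℤ} {a b : FreeTerm V n} (h : FreeRel V a b) : mk a = mk b :=
  Quotient.sound (s := freeSetoid V n) h

@[elab_as_elim]
lemma ind {n : ℤ} {P : FreeX V n → Prop} (h : ∀ a, P (mk a)) (x : FreeX V n) : P x :=
  Quotient.ind (s := freeSetoid V n) h x

instance (n : ℤ) : Zero (FreeX V n) := ⟨mk zero⟩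

instance (n : ℤ) : Add (FreeX V n) :=
  ⟨Quotient.map₂ add fun _ _ h _ _ h' ↦ FreeRel.add_congr h h'⟩

instance (n : ℤ) : SMul k (FreeX V n) :=
  ⟨fun c ↦ Quotient.map (smul c) fun _ _ h ↦ FreeRel.smul_congr c h⟩

instance (n : ℤ) : Neg (FreeX V n) := ⟨fun x ↦ (-1 : k) • x⟩

lemma mk_zero {n : ℤ} : mk (zero : FreeTerm V n) = 0 := rfl

lemma mk_add {n : ℤ} (a b : FreeTerm V n) : mk (add a b) = mk a + mk b := rfl

lemma mk_smul {n : ℤ} (c : k) (a : FreeTerm V n) : mk (smul c a) = c • mk a := rfl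

lemma zero_smul' {n : ℤ} (x : FreeX V n) : (0 : k) • x = 0 := by
  induction x using ind with | h a => exact sound (.zero_smul a)

lemma one_smul' {n : ℤ} (x : FreeX V n) : (1 : k) • x = x := by
  induction x using ind with | h a => exact sound (.one_smul a)

lemma mul_smul' {n : ℤ} (c c' : k) (x : FreeX V n) : (c * c') • x = c • c' • x := by
  induction x using ind with | h a => exact sound (.mul_smul c c' a)

lemma add_smul' {n : ℤ} (c c' : k) (x : FreeX V n) : (c + c') • x = c • x + c' • x := by
  induction x using ind with | h a => exact sound (.add_smul c c' a)

lemma zero_add' {n : ℤ} (x : FreeX V n) : 0 + x = x := by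
  induction x using ind with | h a => exact sound (.zero_add a)

lemma add_comm' {n : ℤ} (x y : FreeX V n) : x + y = y + x := by
  induction x using ind with | h a =>
  induction y using ind with | h b => exact sound (.add_comm a b)

instance (n : ℤ) : AddCommGroup (FreeX V n) where
  add_assoc x y z := by
    induction x using ind with | h a =>
    induction y using ind with | h b =>
    induction z using ind with | h c => exact sound (.add_assoc a b c)
  zero_add := zero_add'
  add_zero x := by rw [add_comm', zero_add']
  add_comm := add_comm'
  neg_add_cancel x := by
    change (-1 : k) • x + x = 0
    nth_rw 2 [← one_smul' x]
    rw [← add_smul', neg_add_cancel, zero_smul']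
  nsmul := nsmulRec
  zsmul := zsmulRec

instance (n : ℤ) : Module k (FreeX V n) where
  one_smul := one_smul'
  mul_smul := mul_smul'
  add_smul := add_smul'
  zero_smul := zero_smul'
  smul_zero c := by
    rw [← zero_smul' (0 : FreeX V n), ← mul_smul', mul_zero]
  smul_add c x y := by
    induction x using ind with | h a =>
    induction y using ind with | h b => exact sound (.smul_add c a b)

/-- The inclusion of `V`. -/
def ofₗ (n : ℤ) : V.X n →ₗ[k] FreeX V n where
  toFun x := mk (of x)
  map_add' x y := sound (.of_add x y)
  map_smul' c x := sound (.of_smul c x)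

/-- The differential. -/
def dₗ (p q : ℤ) : FreeX V p →ₗ[k] FreeX V q where
  toFun := Quotient.map (d p q) fun _ _ h ↦ FreeRel.d_congr p q h
  map_add' x y := by
    induction x using ind with | h a =>
    induction y using ind with | h b => exact sound (.d_add p q a b)
  map_smul' c x := by
    induction x using ind with | h a => exact sound (.d_smul p q c a)

/-- The bracket. -/
def bracketₗ (p q n : ℤ) (h : p + q = n) : FreeX V p →ₗ[k] FreeX V q →ₗ[k] FreeX V n :=
  LinearMap.mk₂ k
    (Quotient.map₂ (br p q n h) fun _ _ h₁ _ _ h₂ ↦ FreeRel.bracket_congr p q n h h₁ h₂)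
    (by
      intro x x' y
      induction x using ind with | h a =>
      induction x' using ind with | h a' =>
      induction y using ind with | h b => exact sound (.add_bracket p q n h a a' b))
    (by
      intro c x y
      induction x using ind with | h a =>
      induction y using ind with | h b => exact sound (.smul_bracket p q n h c a b))
    (by
      intro x y y'
      induction x using ind with | h a =>
      induction y using ind with | h b =>
      induction y' using ind with | h b' => exact sound (.bracket_add p q n h a b b'))
    (by
      intro c x y
      induction x using ind with | h a =>
      induction y using ind with | h b => exact sound (.bracket_smul p q n h c a b))

end FreeX

/-- The free dg Lie algebra on a chain complex `V`. -/
def freeObj : DGLieAlgebra k where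
  complex :=
    { X n := ModuleCat.of k (FreeX V n)
      d p q := ModuleCat.ofHom (FreeX.dₗ p q)
      shape p q h := by
        ext x
        induction x using FreeX.ind with | h a =>
        exact FreeX.sound (.d_shape p q (by simpa using h) a)
      d_comp_d' p q r _ _ := by
        ext x
        induction x using FreeX.ind with | h a => exact FreeX.sound (.d_d p q r a) }
  bracket p q n h := FreeX.bracketₗ p q n h
  antisymm p q n h x y := by
    induction x using FreeX.ind with | h a =>
    induction y using FreeX.ind with | h b => exact FreeX.sound (.antisymm p q n h a b)
  jacobi p q r n h x y z := by
    induction x using FreeX.ind with | h a =>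
    induction y using FreeX.ind with | h b =>
    induction z using FreeX.ind with | h c => exact FreeX.sound (.jacobi p q r n h a b c)
  leibniz p q n h x y := by
    induction x using FreeX.ind with | h a =>
    induction y using FreeX.ind with | h b => exact FreeX.sound (.leibniz p q n h a b)

/-- The canonical morphism from `V` to the free dg Lie algebra on `V`. -/
def freeUnit : V ⟶ (freeObj V).complex where
  f n := ModuleCat.ofHom (FreeX.ofₗ n)
  comm' p q _ := by
    ext x
    exact (FreeX.sound (.of_d p q x)).symm

variable {V} {L : DGLieAlgebra k} (f : V ⟶ L.complex)

/-- The evaluation of formal expressions in a dg Lie algebra. -/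
def interp : ∀ {n : ℤ}, FreeTerm V n → L.complex.X n
  | n, .of x => (f.f n).hom x
  | _, .zero => 0
  | _, .add a b => interp a + interp b
  | _, .smul c a => c • interp a
  | _, .d p q a => (L.complex.d p q).hom (interp a)
  | _, .br p q n h a b => L.bracket p q n h (interp a) (interp b)

lemma interp_eq {n : ℤ} {a b : FreeTerm V n} (h : FreeRel V a b) :
    interp f a = interp f b := by
  induction h with
  | refl => rfl
  | symm _ ih => exact ih.symm
  | trans _ _ ih ih' => exact ih.trans ih'
  | add_congr _ _ ih ih' => simp only [interp, ih, ih']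
  | smul_congr _ _ ih => simp only [interp, ih]
  | d_congr _ _ _ ih => simp only [interp, ih]
  | bracket_congr _ _ _ _ _ _ ih ih' => simp only [interp, ih, ih']
  | add_assoc => exact add_assoc _ _ _
  | add_comm => exact add_comm _ _
  | zero_add => exact zero_add _
  | smul_add => exact smul_add _ _ _
  | add_smul => exact add_smul _ _ _
  | mul_smul => exact mul_smul _ _ _
  | one_smul => exact one_smul _ _
  | zero_smul => exact zero_smul _ _
  | d_add => exact map_add _ _ _
  | d_smul => exact map_smul _ _ _
  | d_shape p q h => simp [interp, L.complex.shape p q (by simpa using h)]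
  | d_d p q r a =>
    simp only [interp]
    rw [← ModuleCat.comp_apply, L.complex.d_comp_d]
    rfl
  | add_bracket => simp [interp]
  | smul_bracket => simp [interp]
  | bracket_add => simp [interp]
  | bracket_smul => simp [interp]
  | antisymm p q n h a b => exact L.antisymm p q n h _ _
  | jacobi p q r n h a b c => exact L.jacobi p q r n h _ _ _
  | leibniz p q n h a b => exact L.leibniz p q n h _ _
  | of_add => exact map_add _ _ _
  | of_smul => exact map_smul _ _ _
  | of_d p q x => exact congr($(f.comm p q) x).symm

/-- The morphism of dg Lie algebras out of a free one which extends a morphism of complexes. -/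
def freeDesc : freeObj V ⟶ L where
  hom :=
    { f n := ModuleCat.ofHom
        { toFun := Quotient.lift (interp f) fun _ _ h ↦ interp_eq f h
          map_add' x y := by
            induction x using FreeX.ind with | h a =>
            induction y using FreeX.ind with | h b => rfl
          map_smul' c x := by
            induction x using FreeX.ind with | h a => rfl }
      comm' p q _ := by
        ext x
        induction x using FreeX.ind with | h a => rfl }
  map_bracket p q n h x y := by
    induction x using FreeX.ind with | h a =>
    induction y using FreeX.ind with | h b => rfl

lemma freeDesc_mk {n : ℤ} (a : FreeTerm V n) :
    ((freeDesc f).hom.f n).hom (FreeX.mk a) = interp f a := rfl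

lemma apply_mk (g : freeObj V ⟶ L) {n : ℤ} (a : FreeTerm V n) :
    (g.hom.f n).hom (FreeX.mk a) = interp (freeUnit V ≫ g.hom) a := by
  induction a with
  | of x => rfl
  | zero => exact map_zero _
  | add a b iha ihb => exact (map_add _ _ _).trans congr($iha + $ihb)
  | smul c a ih => exact (map_smul _ _ _).trans congr(c • $ih)
  | d p q a ih =>
    simp only [interp, ← ih]
    exact congr($(g.hom.comm p q) (FreeX.mk a)).symm
  | br p q n h a b iha ihb =>
    simp only [interp, ← iha, ← ihb]
    exact g.map_bracket p q n h (FreeX.mk a) (FreeX.mk b)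

variable (V L) in
/-- The universal property of the free dg Lie algebra. -/
def freeHomEquiv : (freeObj V ⟶ L) ≃ (V ⟶ (forgetToComplex k).obj L) where
  toFun g := freeUnit V ≫ g.hom
  invFun f := freeDesc f
  left_inv g := by
    ext n x
    induction x using FreeX.ind with | h a => exact (apply_mk g a).symm
  right_inv f := by
    ext n x
    rfl

variable (k) in
/-- The free dg Lie algebra functor. -/
def free : ChainComplex (ModuleCat.{u} k) ℤ ⥤ DGLieAlgebra k :=
  Adjunction.leftAdjointOfEquiv (G := forgetToComplex k) freeHomEquiv (fun _ _ _ _ _ ↦ rfl)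

variable (k) in
/-- The free dg Lie algebra functor is left adjoint to the forgetful functor. -/
def freeAdjunction : free k ⊣ forgetToComplex k :=
  Adjunction.adjunctionOfEquivLeft (G := forgetToComplex k) freeHomEquiv (fun _ _ _ _ _ ↦ rfl)

end Free

variable (k)

/-- The acyclic complex `E(n)`: it is `k` in degrees `n` and `n - 1` with the identity as
differential, and zero in all other degrees. -/
noncomputable def E (n : ℤ) : ChainComplex (ModuleCat.{u} k) ℤ :=
  HomologicalComplex.double (c := ComplexShape.down ℤ) (i₀ := n) (i₁ := n - 1)
    (𝟙 (ModuleCat.of k k)) (by simp)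

/-- The complex `∂E(n)`: it is `k` in degree `n - 1` and zero in all other degrees. -/
noncomputable def boundaryE (n : ℤ) : ChainComplex (ModuleCat.{u} k) ℤ :=
  (HomologicalComplex.single (ModuleCat.{u} k) (ComplexShape.down ℤ) (n - 1)).obj
    (ModuleCat.of k k)

/-- The inclusion of `∂E(n)` into `E(n)` as the part of degree `n - 1`. -/
noncomputable def boundaryEInclusion (n : ℤ) : boundaryE k n ⟶ E k n :=
  HomologicalComplex.mkHomFromSingle
    (HomologicalComplex.doubleXIso₁ (c := ComplexShape.down ℤ) (i₀ := n) (i₁ := n - 1)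
      (𝟙 (ModuleCat.of k k)) (by simp) (by lia)).inv
    (fun j hj ↦ by
      exact (congrArg _ (HomologicalComplex.double_d_eq_zero₀ _ _ _ _ (by lia))).trans comp_zero)

/-- The set of morphisms `Free(∂E(n)) → Free(E(n))`, for `n : ℤ`. -/
noncomputable def generatingCofibrations : MorphismProperty (DGLieAlgebra k) :=
  MorphismProperty.ofHoms fun n : ℤ ↦ (free k).map (boundaryEInclusion k n)

end DGLieAlgebra

section ModelCategories

variable {C : Type u} [Category.{v} C]

/-- A class of morphisms `W` is generated by `I` if `W` consists of the retracts of transfinite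
compositions of pushouts of (`w`-small) coproducts of morphisms in `I`. -/
def IsGeneratedBy (W I : MorphismProperty C) : Prop :=
  W = (MorphismProperty.transfiniteCompositions.{w}
    (MorphismProperty.coproducts.{w} I).pushouts).retracts

variable (C) [ModelCategory C]

/-- A model category is combinatorial if the underlying category is locally presentable (in
particular it has small colimits), it has small limits, and both its cofibrations and its trivial
cofibrations are generated by a (small) set of morphisms. -/
structure IsCombinatorialModelCategory : Prop where
  isLocallyPresentable : IsLocallyPresentable.{w} C
  hasLimits : HasLimitsOfSize.{w, w} C
  hasColimits : HasColimitsOfSize.{w, w} C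
  cofibrations_generated : ∃ I : MorphismProperty C,
    MorphismProperty.IsSmall.{w} I ∧ IsGeneratedBy.{w} (cofibrations C) I
  trivialCofibrations_generated : ∃ J : MorphismProperty C,
    MorphismProperty.IsSmall.{w} J ∧ IsGeneratedBy.{w} (trivialCofibrations C) J

/-- A model category is left proper if weak equivalences are stable under pushouts along
cofibrations. -/
def IsLeftProperModelCategory : Prop :=
  ∀ ⦃A B X Y : C⦄ (f : A ⟶ X) (i : A ⟶ B) (j : X ⟶ Y) (h : B ⟶ Y), IsPushout f i j h →
    Cofibration i → WeakEquivalence f → WeakEquivalence h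

end ModelCategories

/-!
The category of dg Lie algebras is locally presentable: filtered colimits are computed on the
underlying complexes, general colimits are quotients of free dg Lie algebras, and the
objects `Free(E(n))`, which corepresent the components, form a strong generator of finitely
presentable objects. The morphisms `Free(∂E(n)) → Free(E(n))` detect surjective quasi-isomorphisms
by the right lifting property (`DGLieAlgebra.generatingCofibrations_rlp`), and the morphisms
`0 → Free(E(n))` detect surjections (`DGLieAlgebra.generatingTrivialCofibrations_rlp`). The small
object argument then gives both factorizations, and it remains to see that a morphism with the left
lifting property with respect to surjections is a quasi-isomorphism. As quasi-isomorphisms are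
stable under retracts and filtered colimits, this follows from
`DGLieAlgebra.IsDiskAttachment.quasiIsos`: on the free product of `A` with a free dg Lie algebra on
an acyclic complex `V`, the derivation extending a contraction of `V` is a homotopy between zero and
the derivation which multiplies an iterated bracket by the number of its letters in `V`. This number
is invertible in characteristic zero, except on `A`.

For left properness, a quasi-isomorphism is factored into a trivial cofibration, which is preserved
by all pushouts, and a surjection with acyclic kernel. By transfinite induction
(`DGLieAlgebra.flatMorphisms_of_transfiniteComposition`) it suffices to consider the pushout
`F : B → Y` of a surjection `f : A → X` with acyclic kernel along an attachment of cells `A → B`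
(`DGLieAlgebra.IsCellAttachment.hasAcyclicKernel`). As a graded Lie algebra, `B` is the free product
of `A` and a free Lie algebra on the cells. The number of cells in an iterated bracket, its weight,
defines a filtration of `B`; on the associated graded, the differential becomes the derivation `δ`
which extends the differential of `A` and vanishes on the cells. An induction on the weight
(`GrLieAlgebra.IsFree.acyclic_of_weight`) reduces the claim to the `δ`-acyclicity of the kernel of
`F` in positive weights.

This is deduced from a representation of `B` on the tensor algebra `T` on `A` and the cells. The
theorem of Poincaré, Birkhoff and Witt identifies the enveloping algebra of `B` with a space of
words in which the words in `A` are symmetric tensors; the lemma `GrLieAlgebra.symm_swap` provides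
the part of it which is needed, a natural symmetrization of words which satisfies the relations of
the enveloping algebra of `A`, by an explicit recursion over the length of words. With it, `A` acts
on `T` by multiplication followed by symmetrization of the initial letters in `A`, and the cells act
by multiplication. All this is natural in `A` and compatible with differentials. Conversely, words
are evaluated as iterated brackets in `B`, and the evaluation of `x • 1` is the product of `x` with
its weight (`GrLieAlgebra.Words.eval_representation`). Since a contraction of the kernel of `f`
induces a contraction of the kernel of the map induced by `f` on tensor algebras, a `δ`-cycle `x` in
the kernel of `F` gives a primitive of `x • 1`, whose evaluation is a primitive of the product of
`x` with its weight (`GrLieAlgebra.IsFree.exists_primitive`).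
-/

/-! ### Koszul signs -/

section Sign

variable (k : Type u) [Field k]

/-- The Koszul sign `(-1) ^ (p * q)`. -/
def koszul (p q : ℤ) : k := (-1) ^ (p * q)

variable {k}

lemma koszul_eq_one_or (p q : ℤ) : koszul k p q = 1 ∨ koszul k p q = -1 := by
  rcases Int.even_or_odd (p * q) with h | h
  · exact Or.inl h.neg_one_zpow
  · exact Or.inr h.neg_one_zpow

lemma koszul_add_left (p p' q : ℤ) : koszul k (p + p') q = koszul k p q * koszul k p' q := by
  simp only [koszul, add_mul]
  exact zpow_add₀ (by simp) _ _

lemma koszul_comm (p q : ℤ) : koszul k p q = koszul k q p := by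
  simp only [koszul, mul_comm]

lemma koszul_add_right (p q q' : ℤ) : koszul k p (q + q') = koszul k p q * koszul k p q' := by
  rw [koszul_comm, koszul_add_left, koszul_comm q, koszul_comm q']

@[simp] lemma koszul_zero_left (q : ℤ) : koszul k 0 q = 1 := by simp [koszul]

@[simp] lemma koszul_zero_right (q : ℤ) : koszul k q 0 = 1 := by simp [koszul]

@[simp] lemma koszul_mul_self (p q : ℤ) : koszul k p q * koszul k p q = 1 := by
  rcases koszul_eq_one_or (k := k) p q with h | h <;> simp [h]

@[simp] lemma koszul_neg_left (p q : ℤ) : koszul k (-p) q = koszul k p q := by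
  have h := koszul_add_left (k := k) p (-p) q
  rw [add_neg_cancel, koszul_zero_left] at h
  rcases koszul_eq_one_or (k := k) p q with h' | h' <;> rw [h'] at h ⊢
  · simpa using h.symm
  · linear_combination h

lemma koszul_sub_left (p p' q : ℤ) : koszul k (p - p') q = koszul k p q * koszul k p' q := by
  rw [sub_eq_add_neg, koszul_add_left, koszul_neg_left]

lemma koszul_sub_right (p q q' : ℤ) : koszul k p (q - q') = koszul k p q * koszul k p q' := by
  rw [koszul_comm, koszul_sub_left, koszul_comm q, koszul_comm q']

lemma koszul_one_left (p : ℤ) : koszul k 1 p = (-1) ^ p := by simp [koszul]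

@[simp] lemma koszul_one_one : koszul k 1 1 = -1 := by simp [koszul]

end Sign

/-! ### Graded Lie algebras -/

/-- A graded Lie algebra over `k`: the structure which remains of a dg Lie algebra when one forgets
its differential. The Jacobi identity is stated in its Leibniz form, with arbitrary names for
the intermediate degrees. -/
structure GrLieAlgebra (k : Type u) [Field k] where
  /-- the homogeneous components -/
  X : ℤ → Type u
  [addCommGroup (n : ℤ) : AddCommGroup (X n)]
  [module (n : ℤ) : Module k (X n)]
  /-- the bracket -/
  bracket (p q n : ℤ) (h : p + q = n) : X p →ₗ[k] X q →ₗ[k] X n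
  antisymm (p q n : ℤ) (h : p + q = n) (x : X p) (y : X q) :
    bracket p q n h x y = -koszul k p q • bracket q p n (by lia) y x
  leibniz (p q r pq pr qr n : ℤ) (hpq : p + q = pq) (hpr : p + r = pr) (hqr : q + r = qr)
      (h : p + qr = n) (x : X p) (y : X q) (z : X r) :
    bracket p qr n h x (bracket q r qr hqr y z) =
      bracket pq r n (by lia) (bracket p q pq hpq x y) z +
        koszul k p q • bracket q pr n (by lia) y (bracket p r pr hpr x z)

attribute [instance] GrLieAlgebra.addCommGroup GrLieAlgebra.module

/-- The graded Lie algebra which underlies a dg Lie algebra. -/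
abbrev DGLieAlgebra.toGraded {k : Type u} [Field k] (L : DGLieAlgebra k) : GrLieAlgebra k where
  X p := L.complex.X p
  bracket := L.bracket
  antisymm p q n h x y := eq_neg_of_add_eq_zero_left (L.antisymm p q n h x y) |>.trans
    (neg_smul _ _).symm
  leibniz := by
    rintro p q r pq pr qr n rfl rfl rfl h x y z
    have H := L.jacobi p q r n (by lia) x y z
    have h1 : L.bracket r p (r + p) rfl z x =
        -koszul k p r • L.bracket p r (r + p) (by lia) x z := by
      rw [eq_neg_of_add_eq_zero_left (L.antisymm r p (r + p) rfl z x), neg_smul, koszul_comm]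
      rfl
    have h2 : L.bracket r (p + q) n (by lia) z (L.bracket p q (p + q) rfl x y) =
        -(koszul k p r * koszul k q r) •
          L.bracket (p + q) r n (by lia) (L.bracket p q (p + q) rfl x y) z := by
      rw [eq_neg_of_add_eq_zero_left (L.antisymm r (p + q) n (by lia) z _), neg_smul,
        ← koszul_add_left, koszul_comm]
      rfl
    have h3 : L.bracket q (r + p) n (by lia) y (L.bracket p r (r + p) (by lia) x z) =
        L.bracket q (p + r) n (by lia) y (L.bracket p r (p + r) rfl x z) := by
      have : ∀ m (h : p + r = m), L.bracket q m n (by lia) y (L.bracket p r m h x z) =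
        L.bracket q (p + r) n (by lia) y (L.bracket p r (p + r) rfl x z) := by
        rintro m rfl; rfl
      exact this _ _
    rw [h1, h2, map_smul, h3] at H
    change koszul k p r • _ + koszul k p q • _ + koszul k q r • _ = _ at H
    rcases koszul_eq_one_or (k := k) p q with e1 | e1 <;>
    rcases koszul_eq_one_or (k := k) p r with e2 | e2 <;>
    rcases koszul_eq_one_or (k := k) q r with e3 | e3 <;>
    simp only [e1, e2, e3] at H ⊢ <;>
    first
    | linear_combination (norm := module) H
    | linear_combination (norm := module) -H

namespace GrLieAlgebra

variable {k : Type u} [Field k]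

/-- A morphism of graded Lie algebras. -/
@[ext]
structure Hom (G G' : GrLieAlgebra k) where
  /-- the underlying linear maps -/
  map (p : ℤ) : G.X p →ₗ[k] G'.X p
  map_bracket (p q n : ℤ) (h : p + q = n) (x : G.X p) (y : G.X q) :
    map n (G.bracket p q n h x y) = G'.bracket p q n h (map p x) (map q y)

/-- The composition of morphisms of graded Lie algebras. -/
abbrev Hom.comp {G G' G'' : GrLieAlgebra k} (f : Hom G' G'') (g : Hom G G') : Hom G G'' where
  map p := (f.map p).comp (g.map p)
  map_bracket p q n h x y := by simp [f.map_bracket, g.map_bracket]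

/-- The identity of a graded Lie algebra. -/
abbrev Hom.id (G : GrLieAlgebra k) : Hom G G where
  map p := LinearMap.id
  map_bracket p q n h x y := rfl

/-- A family of submodules which is stable under the bracket is a graded Lie algebra. -/
abbrev ofSubmodule (G : GrLieAlgebra k) (S : ∀ p, Submodule k (G.X p))
    (hS : ∀ p q n h, ∀ x ∈ S p, ∀ y ∈ S q, G.bracket p q n h x y ∈ S n) :
    GrLieAlgebra k where
  X p := S p
  bracket p q n h := LinearMap.mk₂ k (fun x y ↦ ⟨G.bracket p q n h x y, hS p q n h _ x.2 _ y.2⟩)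
    (by intros; ext; simp) (by intros; ext; simp) (by intros; ext; simp) (by intros; ext; simp)
  antisymm p q n h x y := Subtype.ext (G.antisymm p q n h _ _)
  leibniz p q r pq pr qr n hpq hpr hqr h x y z :=
    Subtype.ext (G.leibniz p q r pq pr qr n hpq hpr hqr h _ _ _)

/-- The square-zero extension `G ⊕ ε G` with `ε` of degree `-r`, `ε² = 0`; the degree `n + r` of
the coefficients of `ε` in degree `n` is named `s n`. Its sections are the derivations of
degree `r`. -/
abbrev squareZero (G : GrLieAlgebra k) (r : ℤ) (s : ℤ → ℤ) (hs : ∀ n, s n = n + r) :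
    GrLieAlgebra k where
  X n := G.X n × G.X (s n)
  bracket p q n h := LinearMap.mk₂ k
    (fun x y ↦ (G.bracket p q n h x.1 y.1,
      G.bracket (s p) q (s n) (by simp only [hs]; lia) x.2 y.1 +
        koszul k r p • G.bracket p (s q) (s n) (by simp only [hs]; lia) x.1 y.2))
    (by intros; ext <;> simp; abel) (by intros; ext <;> simp [smul_smul, mul_comm])
    (by intros; ext <;> simp; abel) (by intros; ext <;> simp [smul_smul, mul_comm])
  antisymm p q n h x y := by
    ext
    · exact G.antisymm p q n h _ _
    · simp only [LinearMap.mk₂_apply, Prod.smul_mk]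
      rw [G.antisymm (s p) q (s n), G.antisymm p (s q) (s n)]
      simp only [hs, koszul_add_left, koszul_add_right, koszul_comm p r]
      rcases koszul_eq_one_or (k := k) p q with e1 | e1 <;>
      rcases koszul_eq_one_or (k := k) r p with e2 | e2 <;>
      rcases koszul_eq_one_or (k := k) r q with e3 | e3 <;>
      simp only [e1, e2, e3] <;> module
  leibniz p q t pq pt qt n hpq hpt hqt h x y z := by
    ext
    · exact G.leibniz p q t pq pt qt n hpq hpt hqt h _ _ _
    · have e1 := G.leibniz (s p) q t (s pq) (s pt) qt (s n) (by simp only [hs]; lia)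
        (by simp only [hs]; lia) hqt (by simp only [hs]; lia) x.2 y.1 z.1
      have e2 := G.leibniz p (s q) t (s pq) pt (s qt) (s n) (by simp only [hs]; lia)
        hpt (by simp only [hs]; lia) (by simp only [hs]; lia) x.1 y.2 z.1
      have e3 := G.leibniz p q (s t) pq (s pt) (s qt) (s n) hpq
        (by simp only [hs]; lia) (by simp only [hs]; lia) (by simp only [hs]; lia) x.1 y.1 z.2
      subst hpq hpt hqt
      simp only [LinearMap.mk₂_apply, Prod.smul_mk, Prod.snd_add, map_add, map_smul,
        LinearMap.add_apply, LinearMap.smul_apply, e1, e2, e3]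
      simp only [hs, koszul_add_left, koszul_add_right, koszul_comm p r]
      rcases koszul_eq_one_or (k := k) p q with e1 | e1 <;>
      rcases koszul_eq_one_or (k := k) r p with e2 | e2 <;>
      rcases koszul_eq_one_or (k := k) r q with e3 | e3 <;>
      simp only [e1, e2, e3] <;> module

/-- The graded Lie algebra of endomorphisms of a module `T`: as no grading of `T` is involved,
all its components are equal to `Module.End k T`, and the degree only enters in the sign of the
graded commutator. -/
abbrev endomorphisms (T : Type u) [AddCommGroup T] [Module k T] : GrLieAlgebra k where
  X _ := Module.End k T
  bracket p q n h := LinearMap.mk₂ k (fun f g ↦ f * g - koszul k p q • (g * f))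
    (by intros; simp only [add_mul, mul_add]; module)
    (by intros; simp only [smul_mul_assoc, mul_smul_comm]; module)
    (by intros; simp only [add_mul, mul_add]; module)
    (by intros; simp only [smul_mul_assoc, mul_smul_comm]; module)
  antisymm p q n h f g := by
    simp only [LinearMap.mk₂_apply, koszul_comm q p]
    rcases koszul_eq_one_or (k := k) p q with e1 | e1 <;> simp only [e1] <;> module
  leibniz := by
    rintro p q r _ _ _ n rfl rfl rfl h x y z
    simp only [LinearMap.mk₂_apply, koszul_add_left, koszul_add_right, koszul_comm q p,
      mul_sub, sub_mul, mul_smul_comm, smul_mul_assoc, mul_assoc]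
    rcases koszul_eq_one_or (k := k) p q with e1 | e1 <;>
    rcases koszul_eq_one_or (k := k) p r with e2 | e2 <;>
    rcases koszul_eq_one_or (k := k) q r with e3 | e3 <;>
    simp only [e1, e2, e3] <;> module

end GrLieAlgebra

namespace GrLieAlgebra

variable {k : Type u} [Field k]

/-! ### Free extensions and derivations -/

/-- The inclusion of a bracket-stable family of submodules. -/
def ofSubmoduleι (G : GrLieAlgebra k) (S : ∀ p, Submodule k (G.X p))
    (hS : ∀ p q n h, ∀ x ∈ S p, ∀ y ∈ S q, G.bracket p q n h x y ∈ S n) :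
    Hom (G.ofSubmodule S hS) G where
  map p := (S p).subtype
  map_bracket _ _ _ _ _ _ := rfl

/-- The identification of two components of a graded Lie algebra whose degrees are equal. -/
def castₗ (G : GrLieAlgebra k) {p q : ℤ} (h : p = q) : G.X p →ₗ[k] G.X q :=
  h ▸ LinearMap.id

@[simp] lemma castₗ_rfl (G : GrLieAlgebra k) {p : ℤ} (h : p = p) (x : G.X p) :
    G.castₗ h x = x := rfl

/-- Derivations of degree `r` of a graded Lie algebra. -/
structure Der (G : GrLieAlgebra k) (r : ℤ) where
  /-- the underlying linear maps -/
  map (p q : ℤ) (h : p + r = q) : G.X p →ₗ[k] G.X q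
  map_bracket (p q n p' q' n' : ℤ) (h : p + q = n) (hp : p + r = p') (hq : q + r = q')
    (hn : n + r = n') (x : G.X p) (y : G.X q) :
    map n n' hn (G.bracket p q n h x y) = G.bracket p' q n' (by lia) (map p p' hp x) y +
      koszul k r p • G.bracket p q' n' (by lia) x (map q q' hq y)

/-- `B` is the free product of `A` and of the free graded Lie algebra on the elements `v j`. -/
structure IsFree {A B : GrLieAlgebra k} (i : Hom A B) {J : Type u} (deg : J → ℤ)
    (v : ∀ j, B.X (deg j)) : Prop where
  exists_desc (G : GrLieAlgebra k) (φ : Hom A G) (g : ∀ j, G.X (deg j)) :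
    ∃ ψ : Hom B G, ψ.comp i = φ ∧ ∀ j, ψ.map _ (v j) = g j
  hom_ext (G : GrLieAlgebra k) (ψ ψ' : Hom B G) (h : ψ.comp i = ψ'.comp i)
    (h' : ∀ j, ψ.map _ (v j) = ψ'.map _ (v j)) : ψ = ψ'

namespace IsFree

variable {A B : GrLieAlgebra k} {i : Hom A B} {J : Type u} {deg : J → ℤ}
  {v : ∀ j, B.X (deg j)} (hB : IsFree i deg v)

include hB

/-- A free extension of `A` is generated by `A` and the elements `v j` under the bracket. -/
lemma mem_of_bracket_mem (S : ∀ p, Submodule k (B.X p))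
    (hS : ∀ p q n h, ∀ x ∈ S p, ∀ y ∈ S q, B.bracket p q n h x y ∈ S n)
    (hi : ∀ p a, i.map p a ∈ S p) (hv : ∀ j, v j ∈ S (deg j)) (p : ℤ) (x : B.X p) : x ∈ S p := by
  obtain ⟨ψ, h₁, h₂⟩ := hB.exists_desc (B.ofSubmodule S hS)
    { map p := (i.map p).codRestrict (S p) (hi p)
      map_bracket p q n h x y := Subtype.ext (i.map_bracket p q n h x y) } (fun j ↦ ⟨v j, hv j⟩)
  have := hB.hom_ext B ((B.ofSubmoduleι S hS).comp ψ) (Hom.id B)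
    (by
      ext p x
      exact congr_arg Subtype.val (DFunLike.congr_fun (congr_fun (congr_arg Hom.map h₁) p) x))
    (fun j ↦ congr_arg Subtype.val (h₂ j))
  rw [show x = (ψ.map p x).1 from
    (DFunLike.congr_fun (congr_fun (congr_arg Hom.map this) p) x).symm]
  exact (ψ.map p x).2

/-- There is a derivation which vanishes on `A` and takes prescribed values on the generators. -/
lemma exists_der (r : ℤ) (e : J → ℤ) (he : ∀ j, deg j + r = e j) (g : ∀ j, B.X (e j)) :
    ∃ P : Der B r, (∀ p q h a, P.map p q h (i.map p a) = 0) ∧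
      ∀ j, P.map (deg j) (e j) (he j) (v j) = g j := by
  obtain rfl : e = fun j ↦ deg j + r := funext fun j ↦ (he j).symm
  let S := B.squareZero r (· + r) (fun _ ↦ rfl)
  let inl : Hom B S :=
    { map p := LinearMap.inl k _ _
      map_bracket p q n h x y := by
        refine Prod.ext rfl ?_
        simp [S] }
  let fst : Hom S B :=
    { map p := LinearMap.fst k _ _
      map_bracket p q n h x y := rfl }
  obtain ⟨ψ, h₁, h₂⟩ := hB.exists_desc S (inl.comp i) (fun j ↦ (v j, g j))
  have hfst : fst.comp ψ = Hom.id B := hB.hom_ext B _ _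
    (by ext p x; exact congr_arg Prod.fst
          (DFunLike.congr_fun (congr_fun (congr_arg Hom.map h₁) p) x))
    (fun j ↦ congr_arg Prod.fst (h₂ j))
  have hfst' (p : ℤ) (x : B.X p) : (ψ.map p x).1 = x :=
    DFunLike.congr_fun (congr_fun (congr_arg Hom.map hfst) p) x
  refine ⟨{ map := fun p q h ↦ (B.castₗ h).comp ((LinearMap.snd k _ _).comp (ψ.map p))
            map_bracket := ?_ }, ?_, ?_⟩
  · rintro p q n _ _ _ h rfl rfl rfl x y
    have := congr_arg Prod.snd (ψ.map_bracket p q n h x y)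
    simp only [S, LinearMap.mk₂_apply, hfst'] at this
    exact this
  · rintro p _ rfl a
    exact congr_arg Prod.snd (DFunLike.congr_fun (congr_fun (congr_arg Hom.map h₁) p) a)
  · intro j
    exact congr_arg Prod.snd (h₂ j)

end IsFree

/-- The dg Lie algebra given by a graded Lie algebra and a differential on it. -/
abbrev toDG (G : GrLieAlgebra k) (d : ∀ p q, G.X p →ₗ[k] G.X q)
    (shape : ∀ p q, q + 1 ≠ p → d p q = 0)
    (d_d : ∀ p q r x, d q r (d p q x) = 0)
    (leibniz : ∀ p q n h x y, d n (n - 1) (G.bracket p q n h x y) =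
      G.bracket (p - 1) q (n - 1) (by lia) (d p (p - 1) x) y +
        (-1 : k) ^ p • G.bracket p (q - 1) (n - 1) (by lia) x (d q (q - 1) y)) :
    DGLieAlgebra k where
  complex :=
    { X n := ModuleCat.of k (G.X n)
      d p q := ModuleCat.ofHom (d p q)
      shape p q h := by rw [shape p q h]; rfl
      d_comp_d' p q r hpq hqr := ModuleCat.hom_ext (LinearMap.ext fun x ↦ d_d p q r x) }
  bracket := G.bracket
  antisymm p q n h x y := by
    rw [G.antisymm, neg_smul]
    exact neg_add_cancel _
  jacobi p q r n h x y z := by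
    have H := G.leibniz p q r (p + q) (r + p) (q + r) n rfl (add_comm _ _) rfl (by lia) x y z
    have h1 := G.antisymm r p (r + p) rfl z x
    have h2 := G.antisymm r (p + q) n (by lia) z (G.bracket p q (p + q) rfl x y)
    rw [h1, h2, H, map_smul]
    change koszul k p r • _ + koszul k p q • _ + koszul k q r • _ = _
    simp only [koszul_comm r p, koszul_add_right, koszul_comm r q]
    rcases koszul_eq_one_or (k := k) p q with e1 | e1 <;>
    rcases koszul_eq_one_or (k := k) p r with e2 | e2 <;>
    rcases koszul_eq_one_or (k := k) q r with e3 | e3 <;>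
    simp only [e1, e2, e3] <;> module
  leibniz := leibniz

/-- The dg Lie algebra `G ⊗ k[ε]` with `ε` of degree `1` and `dε = 1`. It is coinduced: morphisms of
dg Lie algebras `L ⟶ G ⊗ k[ε]` are morphisms of graded Lie algebras from `L` to `G`. -/
abbrev coinduced (G : GrLieAlgebra k) : DGLieAlgebra k :=
  (G.squareZero (-1) (· - 1) (fun _ ↦ rfl)).toDG
    (fun p q ↦ if h : q + 1 = p then (LinearMap.inl k _ _).comp
          ((G.castₗ (by lia : p - 1 = q)).comp (LinearMap.snd k _ _)) else 0)
    (fun p q h ↦ dif_neg h)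
    (fun p q r x ↦ by
      split_ifs <;> simp)
    (fun p q n h x y ↦ by
      simp only [sub_add_cancel, dif_pos]
      refine Prod.ext ?_ ?_
      · simp [← koszul_one_left]
      · simp [← koszul_one_left, koszul_sub_right])

end GrLieAlgebra

lemma DGLieAlgebra.hom_ext_apply {k : Type u} [Field k] {L M : DGLieAlgebra k} {f g : L ⟶ M}
    (h : ∀ n x, (f.hom.f n).hom x = (g.hom.f n).hom x) : f = g :=
  DGLieAlgebra.hom_ext (HomologicalComplex.hom_ext _ _
    fun n ↦ ModuleCat.hom_ext (LinearMap.ext (h n)))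

namespace GrLieAlgebra

variable {k : Type u} [Field k]

/-- The morphism `x ↦ φ x + ε φ (d x)` which corresponds to a morphism `φ` of graded Lie algebras.
-/
def toCoinduced {L : DGLieAlgebra k} {G : GrLieAlgebra k} (φ : Hom L.toGraded G) :
    L ⟶ G.coinduced where
  hom :=
    { f n := ModuleCat.ofHom ((φ.map n).prod ((φ.map (n - 1)).comp (L.complex.d n (n - 1)).hom))
      comm' p q h := by
        obtain rfl : q = p - 1 := by simp at h; lia
        ext x
        · simp
        · simp [← ModuleCat.comp_apply] }
  map_bracket p q n h x y := by
    refine Prod.ext (φ.map_bracket p q n h x y) ?_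
    simp [L.leibniz, φ.map_bracket, ← koszul_one_left]

lemma toCoinduced_apply {L : DGLieAlgebra k} {G : GrLieAlgebra k} (φ : Hom L.toGraded G) {n : ℤ}
    (x : L.complex.X n) : ((toCoinduced φ).hom.f n).hom x =
      (φ.map n x, φ.map (n - 1) ((L.complex.d n (n - 1)).hom x)) := rfl

/-- The morphism of graded Lie algebras which underlies a morphism to a coinduced dg Lie algebra. -/
def ofCoinduced {L : DGLieAlgebra k} {G : GrLieAlgebra k} (f : L ⟶ G.coinduced) :
    Hom L.toGraded G where
  map n := (LinearMap.fst k _ _).comp (f.hom.f n).hom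
  map_bracket p q n h x y := congr_arg Prod.fst (f.map_bracket p q n h x y)

end GrLieAlgebra

namespace DGLieAlgebra

variable {k : Type u} [Field k]

/-- The morphism of graded Lie algebras which underlies a morphism of dg Lie algebras. -/
abbrev Hom.toGraded {L M : DGLieAlgebra k} (f : L ⟶ M) :
    GrLieAlgebra.Hom L.toGraded M.toGraded where
  map p := (f.hom.f p).hom
  map_bracket := f.map_bracket

/-- `B` is obtained from `A` by attaching cells along the cycles `a j`: it is the universal
dg Lie algebra under `A` with elements `v j` such that `d (v j) = a j`. -/
structure IsCellAttachment {A B : DGLieAlgebra k} (i : A ⟶ B) {J : Type u} (deg : J → ℤ)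
    (a : ∀ j, A.complex.X (deg j - 1)) (v : ∀ j, B.complex.X (deg j)) : Prop where
  d_a (j : J) : (A.complex.d (deg j - 1) (deg j - 1 - 1)).hom (a j) = 0
  d_v (j : J) : (B.complex.d (deg j) (deg j - 1)).hom (v j) = (i.hom.f _).hom (a j)
  exists_desc (Z : DGLieAlgebra k) (g : A ⟶ Z) (z : ∀ j, Z.complex.X (deg j))
    (hz : ∀ j, (Z.complex.d (deg j) (deg j - 1)).hom (z j) = (g.hom.f _).hom (a j)) :
    ∃ f : B ⟶ Z, i ≫ f = g ∧ ∀ j, (f.hom.f _).hom (v j) = z j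
  hom_ext (Z : DGLieAlgebra k) (f f' : B ⟶ Z) (h : i ≫ f = i ≫ f')
    (h' : ∀ j, (f.hom.f _).hom (v j) = (f'.hom.f _).hom (v j)) : f = f'

/-- A dg Lie algebra obtained by attaching cells is free over `A` as a graded Lie algebra: its
universal property is applied to coinduced dg Lie algebras. -/
lemma IsCellAttachment.isFree {A B : DGLieAlgebra k} {i : A ⟶ B} {J : Type u} {deg : J → ℤ}
    {a : ∀ j, A.complex.X (deg j - 1)} {v : ∀ j, B.complex.X (deg j)}
    (h : IsCellAttachment i deg a v) : GrLieAlgebra.IsFree (Hom.toGraded i) deg v where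
  exists_desc G φ g := by
    obtain ⟨f, h₁, h₂⟩ := h.exists_desc G.coinduced (GrLieAlgebra.toCoinduced φ)
      (fun j ↦ (g j, φ.map _ (a j))) (fun j ↦ by
        rw [GrLieAlgebra.toCoinduced_apply, h.d_a]
        simp)
    refine ⟨GrLieAlgebra.ofCoinduced f, ?_, fun j ↦ congr_arg Prod.fst (h₂ j)⟩
    ext p x
    exact congr_arg Prod.fst (congr($(h₁).hom.f p x))
  hom_ext G ψ ψ' h₁ h₂ := by
    have hψ (p : ℤ) (x : A.complex.X p) : ψ.map p ((i.hom.f p).hom x) =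
      ψ'.map p ((i.hom.f p).hom x) := congr($(h₁).map p x)
    have hd (p : ℤ) (x : A.complex.X p) : (B.complex.d p (p - 1)).hom ((i.hom.f p).hom x) =
      (i.hom.f (p - 1)).hom ((A.complex.d p (p - 1)).hom x) :=
        congr($(i.hom.comm p (p - 1)) x)
    have := h.hom_ext _ (GrLieAlgebra.toCoinduced ψ) (GrLieAlgebra.toCoinduced ψ')
      (by
        refine hom_ext_apply fun p x ↦ Prod.ext (hψ p x) ?_
        change ψ.map (p - 1) _ = ψ'.map (p - 1) _
        erw [hd, hψ])
      (fun j ↦ by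
        rw [GrLieAlgebra.toCoinduced_apply, GrLieAlgebra.toCoinduced_apply, h₂, h.d_v, hψ])
    ext p x
    exact congr_arg Prod.fst congr($(this).hom.f p x)

end DGLieAlgebra

/-! ### Symmetrization of words in a graded Lie algebra -/

namespace GrLieAlgebra

variable {k : Type u} [Field k]

/-- The homogeneous elements of a graded Lie algebra, used as letters of words. -/
abbrev Letter (A : GrLieAlgebra k) : Type u := Σ p : ℤ, A.X p

namespace Letter

variable {A : GrLieAlgebra k}

/-- The bracket of two letters. -/
def br (a b : A.Letter) : A.Letter := ⟨a.1 + b.1, A.bracket a.1 b.1 _ rfl a.2 b.2⟩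

/-- The degree of a word. -/
def deg : List A.Letter → ℤ
  | [] => 0
  | a :: w => a.1 + deg w

lemma deg_append (u w : List A.Letter) : deg (u ++ w) = deg u + deg w := by
  induction u with
  | nil => simp [deg]
  | cons a u ih => simp [deg, ih, add_assoc]

lemma mk_bracket {p q n : ℤ} (h : p + q = n) (x : A.X p) (y : A.X q) :
    (⟨n, A.bracket p q n h x y⟩ : A.Letter) = br ⟨p, x⟩ ⟨q, y⟩ := by
  subst h; rfl

end Letter

open Letter

variable {A : GrLieAlgebra k} {Z : Type*} [AddCommGroup Z] [Module k Z]
  {Z' : Type*} [AddCommGroup Z'] [Module k Z']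

/-- A function of words which is linear in each letter. -/
def IsMultilinear (f : List A.Letter → Z) : Prop :=
  ∀ u p v, IsLinearMap k (fun x : A.X p ↦ f (u ++ ⟨p, x⟩ :: v))

lemma IsMultilinear.cons {f : List A.Letter → Z} (hf : IsMultilinear f) (y : A.Letter) :
    IsMultilinear (fun w ↦ f (y :: w)) := fun u p v ↦ hf (y :: u) p v

lemma IsMultilinear.append {f : List A.Letter → Z} (hf : IsMultilinear f) (u : List A.Letter) :
    IsMultilinear (fun w ↦ f (u ++ w)) := fun u' p v ↦ by
  simpa using hf (u ++ u') p v

lemma IsMultilinear.br_swap {f : List A.Letter → Z} (hf : IsMultilinear f) (u v : List A.Letter)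
    (a b : A.Letter) : f (u ++ br b a :: v) = -koszul k a.1 b.1 • f (u ++ br a b :: v) := by
  obtain ⟨p, a⟩ := a
  obtain ⟨q, b⟩ := b
  rw [← mk_bracket (add_comm p q : p + q = q + p), br]
  simp only
  rw [A.antisymm q p (q + p) rfl, (hf u (q + p) v).map_smul, koszul_comm]

lemma IsMultilinear.br_br {f : List A.Letter → Z} (hf : IsMultilinear f) (u v : List A.Letter)
    (a b c : A.Letter) : f (u ++ br a (br b c) :: v) =
      f (u ++ br (br a b) c :: v) + koszul k a.1 b.1 • f (u ++ br b (br a c) :: v) := by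
  obtain ⟨p, a⟩ := a
  obtain ⟨q, b⟩ := b
  obtain ⟨r, c⟩ := c
  have h := A.leibniz p q r _ _ _ (p + (q + r)) rfl rfl rfl rfl a b c
  rw [show br (br ⟨p, a⟩ ⟨q, b⟩) ⟨r, c⟩ = (⟨p + (q + r), _⟩ : A.Letter) from
      (mk_bracket (by lia) (A.bracket p q _ rfl a b) c).symm,
    show br ⟨q, b⟩ (br ⟨p, a⟩ ⟨r, c⟩) = (⟨p + (q + r), _⟩ : A.Letter) from
      (mk_bracket (by lia) b (A.bracket p r _ rfl a c)).symm,
    show br ⟨p, a⟩ (br ⟨q, b⟩ ⟨r, c⟩) = (⟨p + (q + r), A.bracket p (q + r) _ rfl a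
      (A.bracket q r (q + r) rfl b c)⟩ : A.Letter) from rfl, h, (hf u _ v).map_add,
    (hf u _ v).map_smul]

/-- The sum over the letters `x` of a word of `F x w'`, where `w'` is the rest of the word, with the
Koszul sign for moving `x` to the front. -/
def extract : (A.Letter → List A.Letter → Z) → List A.Letter → Z
  | _, [] => 0
  | F, y :: w => F y w + extract (fun x w' ↦ koszul k x.1 y.1 • F x (y :: w')) w

/-- The sum of `f w'` over the words `w'` obtained by moving a letter `x` of a word to the left
until it is next to some letter `y`, and by replacing these two letters by their bracket
`[y, x]`. -/
def contract : (List A.Letter → Z) → List A.Letter → Z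
  | _, [] => 0
  | f, y :: w => contract (fun w' ↦ f (y :: w')) w + extract (fun x w' ↦ f (br y x :: w')) w

lemma extract_congr {F G : A.Letter → List A.Letter → Z} (w : List A.Letter)
    (h : ∀ x w', w'.length + 1 = w.length → F x w' = G x w') : extract F w = extract G w := by
  induction w generalizing F G with
  | nil => rfl
  | cons y w ih =>
    rw [extract, extract, h y w rfl, ih (fun x w' hw ↦ by rw [h x (y :: w') (by simp [hw])])]

lemma extract_add (F G : A.Letter → List A.Letter → Z) (w : List A.Letter) :
    extract (fun x w' ↦ F x w' + G x w') w = extract F w + extract G w := by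
  induction w generalizing F G with
  | nil => simp [extract]
  | cons y w ih => simp only [extract, smul_add, ih]; abel

lemma extract_smul (c : k) (F : A.Letter → List A.Letter → Z) (w : List A.Letter) :
    extract (fun x w' ↦ c • F x w') w = c • extract F w := by
  induction w generalizing F with
  | nil => simp [extract]
  | cons y w ih =>
    simp only [extract, smul_add, ← ih]
    congr 2
    ext x w'
    rw [smul_comm]

lemma extract_zero (w : List A.Letter) :
    extract (fun (_ : A.Letter) (_ : List A.Letter) ↦ (0 : Z)) w = 0 := by
  simpa using extract_smul (0 : k) (fun (_ : A.Letter) (_ : List A.Letter) ↦ (0 : Z)) w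

lemma map_extract (L : Z →ₗ[k] Z') (F : A.Letter → List A.Letter → Z) (w : List A.Letter) :
    L (extract F w) = extract (fun x w' ↦ L (F x w')) w := by
  induction w generalizing F with
  | nil => simp [extract]
  | cons y w ih => simp [extract, ih]

lemma contract_congr {f g : List A.Letter → Z} (w : List A.Letter)
    (h : ∀ w', w'.length + 1 = w.length → f w' = g w') : contract f w = contract g w := by
  induction w generalizing f g with
  | nil => rfl
  | cons y w ih =>
    rw [contract, contract, ih (fun w' hw ↦ h _ (by simp [hw])),
      extract_congr w (fun x w' hw ↦ h _ (by simp [hw]))]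

lemma contract_add (f g : List A.Letter → Z) (w : List A.Letter) :
    contract (fun w' ↦ f w' + g w') w = contract f w + contract g w := by
  induction w generalizing f g with
  | nil => simp [contract]
  | cons y w ih => simp only [contract, ih, extract_add]; abel

lemma contract_smul (c : k) (f : List A.Letter → Z) (w : List A.Letter) :
    contract (fun w' ↦ c • f w') w = c • contract f w := by
  induction w generalizing f with
  | nil => simp [contract]
  | cons y w ih => simp only [contract, ih, extract_smul, smul_add]

lemma map_contract (L : Z →ₗ[k] Z') (f : List A.Letter → Z) (w : List A.Letter) :
    L (contract f w) = contract (fun w' ↦ L (f w')) w := by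
  induction w generalizing f with
  | nil => simp [contract]
  | cons y w ih => simp [contract, ih, map_extract]

/-- For words of length `n`, exchanging two neighbouring letters `a`, `b` changes `f` by the value
of `f'` on the word in which `a`, `b` are replaced by `[a, b]`. -/
def HasCommutator (n : ℕ) (f f' : List A.Letter → Z) : Prop :=
  ∀ u a b v, u.length + v.length + 2 = n →
    f (u ++ a :: b :: v) = koszul k a.1 b.1 • f (u ++ b :: a :: v) + f' (u ++ br a b :: v)

lemma HasCommutator.cons {n : ℕ} {f f' : List A.Letter → Z} (h : HasCommutator (n + 1) f f')
    (y : A.Letter) : HasCommutator n (fun w ↦ f (y :: w)) (fun w ↦ f' (y :: w)) :=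
  fun u a b v huv ↦ h (y :: u) a b v (by simp; lia)

lemma HasCommutator.append {n : ℕ} {f f' : List A.Letter → Z} (u : List A.Letter)
    (h : HasCommutator (u.length + n) f f') :
    HasCommutator n (fun w ↦ f (u ++ w)) (fun w ↦ f' (u ++ w)) :=
  fun u' a b v huv ↦ by simpa using h (u ++ u') a b v (by simp; lia)

/-- The effect on `extract F` of exchanging two neighbouring letters, when each `F x` has a
commutator. The term `F' (br a b) (u ++ v)`, in which the bracket is the extracted letter, is the
only one of `extract F'` which does not occur. -/
lemma extract_swap (n : ℕ) {F F' : A.Letter → List A.Letter → Z}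
    (hF : ∀ x, HasCommutator n (F x) (F' x)) (u : List A.Letter) (a b : A.Letter)
    (v : List A.Letter) (huv : u.length + v.length + 1 = n) :
    extract F (u ++ a :: b :: v) = koszul k a.1 b.1 • extract F (u ++ b :: a :: v) +
      (extract F' (u ++ br a b :: v) -
        koszul k (br a b).1 (deg u) • F' (br a b) (u ++ v)) := by
  induction u generalizing F F' n with
  | nil =>
    simp only [List.nil_append, extract, deg, koszul_zero_right, one_smul]
    have h : extract (fun x w' ↦ koszul k x.1 b.1 • koszul k x.1 a.1 • F x (a :: b :: w')) v =
        koszul k a.1 b.1 •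
          extract (fun x w' ↦ koszul k x.1 a.1 • koszul k x.1 b.1 • F x (b :: a :: w')) v +
        extract (fun x w' ↦ koszul k x.1 (br a b).1 • F' x (br a b :: w')) v := by
      rw [← extract_smul, ← extract_add]
      refine extract_congr v (fun x w' hw ↦ ?_)
      rw [show F x (a :: b :: w') = _ from hF x [] a b w' (by simp at huv ⊢; lia)]
      simp only [List.nil_append, br, koszul_add_right]
      module
    rw [h]
    rw [koszul_comm b.1]
    rcases koszul_eq_one_or (k := k) a.1 b.1 with e | e <;> simp only [e] <;> module
  | cons y u ih =>
    obtain _ | n := n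
    · simp at huv
    simp only [List.cons_append, extract, deg, koszul_add_right]
    rw [hF y u a b v (by simp at huv ⊢; lia),
      ih n (F := fun x w' ↦ koszul k x.1 y.1 • F x (y :: w'))
        (F' := fun x w' ↦ koszul k x.1 y.1 • F' x (y :: w'))
        (fun x u a b v h ↦ by
          have e := (hF x).cons y u a b v h
          beta_reduce at e ⊢
          rw [e]
          module) (by simp at huv ⊢; lia)]
    module

/-- The effect on `contract f` of exchanging two neighbouring letters, when `f` has a commutator.
The antisymmetry accounts for the terms which contain the bracket of these letters, and the Jacobi
identity for those with the brackets of both letters and a third one. -/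
lemma contract_swap (n : ℕ) {f f' : List A.Letter → Z} (hf : IsMultilinear f)
    (hf' : IsMultilinear f') (h : HasCommutator n f f') (u : List A.Letter) (a b : A.Letter)
    (v : List A.Letter) (huv : u.length + v.length + 1 = n) :
    contract f (u ++ a :: b :: v) = koszul k a.1 b.1 • contract f (u ++ b :: a :: v) +
      (contract f' (u ++ br a b :: v) + f (u ++ br a b :: v) +
        koszul k (br a b).1 (deg u) • f (br a b :: (u ++ v))) := by
  induction u generalizing f f' n with
  | nil =>
    simp only [List.nil_append, contract, extract, deg, koszul_zero_right, one_smul]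
    have h1 : contract (fun w' ↦ f (a :: b :: w')) v =
        koszul k a.1 b.1 • contract (fun w' ↦ f (b :: a :: w')) v +
          contract (fun w' ↦ f' (br a b :: w')) v := by
      rw [← contract_smul, ← contract_add]
      exact contract_congr v (fun w' hw ↦ h [] a b w' (by simp at huv ⊢; lia))
    have h2 : extract (fun x w' ↦ f (a :: br b x :: w')) v +
        extract (fun x w' ↦ koszul k x.1 b.1 • f (br a x :: b :: w')) v =
        koszul k a.1 b.1 • (extract (fun x w' ↦ f (b :: br a x :: w')) v +
          extract (fun x w' ↦ koszul k x.1 a.1 • f (br b x :: a :: w')) v) +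
        extract (fun x w' ↦ f' (br (br a b) x :: w')) v := by
      rw [← extract_add, ← extract_add, ← extract_smul, ← extract_add]
      refine extract_congr v (fun x w' hw ↦ ?_)
      have e1 := h [] a (br b x) w' (by simp at huv ⊢; lia)
      have e2 := h [] (br a x) b w' (by simp at huv ⊢; lia)
      have e3 := hf'.br_br [] w' a b x
      have e4 := hf'.br_swap [] w' b (br a x)
      simp only [List.nil_append] at e1 e2 e3 e4
      rw [e1, e2, e3, e4]
      simp only [br, koszul_add_left, koszul_add_right, koszul_comm x.1, koszul_comm b.1 a.1]
      rcases koszul_eq_one_or (k := k) a.1 b.1 with e1 | e1 <;>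
      rcases koszul_eq_one_or (k := k) a.1 x.1 with e2 | e2 <;>
      rcases koszul_eq_one_or (k := k) b.1 x.1 with e3 | e3 <;>
      simp only [e1, e2, e3] <;> module
    have h3 := hf.br_swap [] v a b
    simp only [List.nil_append] at h3
    have h4 : f (br a b :: v) = koszul k a.1 b.1 • (koszul k a.1 b.1 • f (br a b :: v)) := by
      rw [smul_smul, koszul_mul_self, one_smul]
    rw [h1, h3]
    linear_combination (norm := module) h2 - h4
  | cons y u ih =>
    obtain _ | n := n
    · simp at huv
    simp only [List.cons_append, contract, deg, koszul_add_right]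
    have h1 := extract_swap n (F := fun x w' ↦ f (br y x :: w'))
      (F' := fun x w' ↦ f' (br y x :: w')) (fun x ↦ h.cons _) u a b v (by simp at huv ⊢; lia)
    have h2 := ih n (hf.cons y) (hf'.cons y) (h.cons y) (by simp at huv ⊢; lia)
    have h3 := h [] y (br a b) (u ++ v) (by simp at huv ⊢; lia)
    simp only [List.nil_append] at h3
    rw [h1, h2, h3, koszul_comm y.1]
    have h4 := koszul_mul_self (k := k) (br a b).1 y.1
    rcases koszul_eq_one_or (k := k) (br a b).1 y.1 with e | e <;> simp only [e] <;> module

/-- The sum of the relations which move each letter of a word to the front. -/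
lemma length_smul_eq (n : ℕ) {f f' : List A.Letter → Z} (h : HasCommutator n f f')
    (w : List A.Letter) (hw : w.length = n) :
    (n : k) • f w = extract (fun x w' ↦ f (x :: w')) w + contract f' w := by
  induction w generalizing f f' n with
  | nil => simp at hw; simp [← hw, extract, contract]
  | cons y w ih =>
    obtain _ | n := n
    · simp at hw
    have h1 : extract (fun x w' ↦ koszul k x.1 y.1 • f (x :: y :: w')) w +
        extract (fun x w' ↦ f' (br y x :: w')) w = extract (fun x w' ↦ f (y :: x :: w')) w := by
      rw [← extract_add]
      refine extract_congr w (fun x w' hw' ↦ ?_)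
      have := h [] y x w' (by simp at hw ⊢; lia)
      simp only [List.nil_append] at this
      rw [this, koszul_comm]
    have h2 := ih n (h.cons y) (by simpa using hw)
    simp only [extract, contract, Nat.cast_add, Nat.cast_one]
    linear_combination (norm := module) h2 - h1

lemma isLinearMap_extract {E : Type*} [AddCommGroup E] [Module k E]
    {G : E → A.Letter → List A.Letter → Z}
    (hG : ∀ x w, IsLinearMap k (fun e ↦ G e x w)) (w : List A.Letter) :
    IsLinearMap k (fun e ↦ extract (G e) w) where
  map_add e e' := by
    rw [← extract_add]
    exact extract_congr w (fun x w' _ ↦ (hG x w').map_add e e')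
  map_smul c e := by
    rw [← extract_smul]
    exact extract_congr w (fun x w' _ ↦ (hG x w').map_smul c e)

lemma isLinearMap_contract {E : Type*} [AddCommGroup E] [Module k E]
    {g : E → List A.Letter → Z}
    (hg : ∀ w, IsLinearMap k (fun e ↦ g e w)) (w : List A.Letter) :
    IsLinearMap k (fun e ↦ contract (g e) w) where
  map_add e e' := by
    rw [← contract_add]
    exact contract_congr w (fun w' _ ↦ (hg w').map_add e e')
  map_smul c e := by
    rw [← contract_smul]
    exact contract_congr w (fun w' _ ↦ (hg w').map_smul c e)

lemma isLinearMap_add {E : Type*} [AddCommGroup E] [Module k E] {f g : E → Z}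
    (hf : IsLinearMap k f) (hg : IsLinearMap k g) : IsLinearMap k (fun e ↦ f e + g e) :=
  ⟨fun x y ↦ by rw [hf.map_add, hg.map_add]; abel,
    fun c x ↦ by rw [hf.map_smul, hg.map_smul, smul_add]⟩

lemma isLinearMap_smul {E : Type*} [AddCommGroup E] [Module k E] {f : E → Z} (c : k)
    (hf : IsLinearMap k f) : IsLinearMap k (fun e ↦ c • f e) :=
  ⟨fun x y ↦ by rw [hf.map_add, smul_add], fun c' x ↦ by rw [hf.map_smul, smul_comm]⟩

lemma IsMultilinear.extract {F : A.Letter → List A.Letter → Z} (hF : ∀ x, IsMultilinear (F x))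
    (hF' : ∀ p w, IsLinearMap k (fun x : A.X p ↦ F ⟨p, x⟩ w)) : IsMultilinear (extract F) := by
  intro u p v
  induction u generalizing F with
  | nil =>
    exact isLinearMap_add (hF' p v) (isLinearMap_extract
      (fun x w ↦ isLinearMap_smul (koszul k x.1 p) (hF x [] p w)) v)
  | cons y u ih =>
    exact isLinearMap_add (hF y u p v) (ih
      (fun x u p v ↦ isLinearMap_smul (koszul k x.1 y.1) (hF x (y :: u) p v))
      (fun p w ↦ isLinearMap_smul (koszul k p y.1) (hF' p (y :: w))))

lemma IsMultilinear.contract {f : List A.Letter → Z} (hf : IsMultilinear f) :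
    IsMultilinear (contract f) := by
  intro u p v
  induction u generalizing f with
  | nil =>
    refine isLinearMap_add (isLinearMap_contract (fun w ↦ hf [] p w) v)
      (isLinearMap_extract (fun x w ↦ ?_) v)
    constructor
    · intro a b
      have := (hf [] (p + x.1) w).map_add (A.bracket p x.1 _ rfl a x.2)
        (A.bracket p x.1 _ rfl b x.2)
      simpa [br] using this
    · intro c a
      have := (hf [] (p + x.1) w).map_smul c (A.bracket p x.1 _ rfl a x.2)
      simpa [br] using this
  | cons y u ih =>
    refine isLinearMap_add (ih (hf.cons y)) ?_
    refine IsMultilinear.extract (fun x ↦ hf.cons (br y x)) (fun p w ↦ ?_) u p v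
    constructor
    · intro a b
      have := (hf [] (y.1 + p) w).map_add (A.bracket y.1 p _ rfl y.2 a)
        (A.bracket y.1 p _ rfl y.2 b)
      simpa [br] using this
    · intro c a
      have := (hf [] (y.1 + p) w).map_smul c (A.bracket y.1 p _ rfl y.2 a)
      simpa [br] using this

end GrLieAlgebra

namespace GrLieAlgebra

open Letter

variable {k : Type u} [Field k] {A : GrLieAlgebra k} {Z : Type*} [AddCommGroup Z] [Module k Z]
  {Z' : Type*} [AddCommGroup Z'] [Module k Z']

/-- One step of the symmetrization of words: the letters of the second word are moved, in all
possible orders, to the end of the first word, and one takes the average over these orders of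
the value of `base` on the result; each time two letters are exchanged, the value of `g` on the
word which contains their bracket is added. The natural number is the length of the second word. -/
def symmStep (base g : List A.Letter → Z) : ℕ → List A.Letter → List A.Letter → Z
  | 0, u, w => base (u ++ w)
  | m + 1, u, w => (m + 1 : k)⁻¹ •
      (extract (fun x w' ↦ symmStep base g m (u ++ [x]) w') w + contract (fun w' ↦ g (u ++ w')) w)

/-- The symmetrization of words of length `n`. -/
def symmAux (base : List A.Letter → Z) : ℕ → List A.Letter → Z
  | 0 => base
  | n + 1 => symmStep base (symmAux base n) (n + 1) []

/-- The symmetrization of words: the function of words which satisfies the relations of the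
universal enveloping algebra and agrees with `base` on the words which are symmetrized. -/
def symm (base : List A.Letter → Z) (w : List A.Letter) : Z := symmAux base w.length w

lemma isLinearMap_symmStep {base g : List A.Letter → Z} (hbase : IsMultilinear base)
    (hg : IsMultilinear g) (m : ℕ) (u u' : List A.Letter) (p : ℤ) (w : List A.Letter) :
    IsLinearMap k (fun x : A.X p ↦ symmStep base g m (u ++ ⟨p, x⟩ :: u') w) := by
  induction m generalizing u u' w with
  | zero => simpa [symmStep] using hbase u p (u' ++ w)
  | succ m ih =>
    simp only [symmStep]
    refine isLinearMap_smul _ (isLinearMap_add (isLinearMap_extract (fun x w' ↦ ?_) w)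
      (isLinearMap_contract (fun w' ↦ ?_) w))
    · simpa using ih u (u' ++ [x]) w'
    · simpa using hg u p (u' ++ w')

lemma isMultilinear_symmStep {base g : List A.Letter → Z} (hbase : IsMultilinear base)
    (hg : IsMultilinear g) (m : ℕ) (u : List A.Letter) :
    IsMultilinear (symmStep base g m u) := by
  induction m generalizing u with
  | zero => exact hbase.append u
  | succ m ih =>
    intro u' p v
    exact isLinearMap_smul _ (isLinearMap_add
      (IsMultilinear.extract (fun x ↦ ih (u ++ [x]))
        (fun p w ↦ isLinearMap_symmStep hbase hg m u [] p w) u' p v)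
      ((hg.append u).contract u' p v))

lemma isMultilinear_symmAux {base : List A.Letter → Z} (hbase : IsMultilinear base) (n : ℕ) :
    IsMultilinear (symmAux base n) := by
  induction n with
  | zero => exact hbase
  | succ n ih => exact isMultilinear_symmStep hbase ih _ _

lemma IsMultilinear.symm {base : List A.Letter → Z} (hbase : IsMultilinear base) :
    IsMultilinear (symm base) := by
  intro u p v
  simpa [GrLieAlgebra.symm] using isMultilinear_symmAux hbase (u.length + (v.length + 1)) u p v

section CharZero

variable [CharZero k]

/-- The error terms of `extract_swap` and `contract_swap` cancel each other, and those which remain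
add up, by `length_smul_eq`, to the value of `g` on the word with the bracket. -/
lemma symmStep_swap {base g g' : List A.Letter → Z} (n : ℕ) (hg : IsMultilinear g)
    (hg' : IsMultilinear g') (h : HasCommutator n g g') (m : ℕ) (u₀ : List A.Letter)
    (hm : u₀.length + m = n + 1) :
    HasCommutator m (symmStep base g m u₀) (fun w ↦ g (u₀ ++ w)) := by
  induction m generalizing u₀ with
  | zero => intro u a b v huv; simp at huv
  | succ m ih =>
    intro u a b v huv
    have hF (x : A.Letter) : HasCommutator m (symmStep base g m (u₀ ++ [x]))
        (fun w ↦ g (u₀ ++ x :: w)) := by simpa using ih (u₀ ++ [x]) (by simp; lia)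
    have hf : HasCommutator m (fun w ↦ g (u₀ ++ w)) (fun w ↦ g' (u₀ ++ w)) :=
      HasCommutator.append u₀ (by rwa [show u₀.length + m = n by lia])
    have h1 := extract_swap m hF u a b v (by lia)
    have h2 := contract_swap m (hg.append u₀) (hg'.append u₀) hf u a b v (by lia)
    have h3 := length_smul_eq m hf (u ++ br a b :: v) (by simp; lia)
    have hm0 : (m + 1 : k) ≠ 0 := by exact_mod_cast (Nat.succ_ne_zero m)
    have h4 : g (u₀ ++ (u ++ br a b :: v)) =
      (m + 1 : k)⁻¹ • ((m + 1 : k) • g (u₀ ++ (u ++ br a b :: v))) := by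
        rw [smul_smul, inv_mul_cancel₀ hm0, one_smul]
    simp only [symmStep]
    rw [h1, h2]
    linear_combination (norm := module) -h4 - ((m + 1 : k)⁻¹ • h3)

lemma symmAux_swap {base : List A.Letter → Z} (hbase : IsMultilinear base) (n : ℕ) :
    HasCommutator (n + 1) (symmAux base (n + 1)) (symmAux base n) := by
  induction n with
  | zero => intro u a b v huv; simp at huv
  | succ n ih =>
    exact symmStep_swap (n + 1) (isMultilinear_symmAux hbase _) (isMultilinear_symmAux hbase _)
      ih (n + 2) [] (by simp)

/-- The symmetrization satisfies the defining relations of the universal enveloping algebra. This is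
the substance of the theorem of Poincaré, Birkhoff and Witt in characteristic zero. -/
lemma symm_swap {base : List A.Letter → Z} (hbase : IsMultilinear base) (u : List A.Letter)
    (a b : A.Letter) (v : List A.Letter) :
    symm base (u ++ a :: b :: v) = koszul k a.1 b.1 • symm base (u ++ b :: a :: v) +
      symm base (u ++ br a b :: v) := by
  have := symmAux_swap hbase (u.length + v.length + 1) u a b v (by lia)
  simpa [symm, show u.length + (v.length + 1 + 1) = u.length + v.length + 1 + 1 by lia,
    show u.length + (v.length + 1) = u.length + v.length + 1 by lia] using this

/-- Modulo the relations of the universal enveloping algebra, a word is equal to its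
symmetrization. -/
lemma map_symm {base : List A.Letter → Z} {θ : List A.Letter → Z'} (L : Z →ₗ[k] Z')
    (hL : ∀ w, L (base w) = θ w) (hθ : ∀ n, HasCommutator n θ θ) (w : List A.Letter) :
    L (symm base w) = θ w := by
  have aux (g : List A.Letter → Z) (n : ℕ) (hg : ∀ w, w.length = n → L (g w) = θ w) (m : ℕ)
      (u w : List A.Letter) (hw : w.length = m) (hn : u.length + m = n + 1) :
      L (symmStep base g m u w) = θ (u ++ w) := by
    induction m generalizing u w with
    | zero => simp [symmStep, hL]
    | succ m ih =>
      have h1 := length_smul_eq (m + 1) (f := fun w ↦ θ (u ++ w)) (f' := fun w ↦ θ (u ++ w))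
        (HasCommutator.append u (hθ _)) w hw
      have hm0 : (m + 1 : k) ≠ 0 := by exact_mod_cast (Nat.succ_ne_zero m)
      rw [symmStep, map_smul, map_add, map_extract, map_contract, inv_smul_eq_iff₀ hm0]
      push_cast at h1
      rw [h1]
      congr 1
      · refine extract_congr w (fun x w' hw' ↦ ?_)
        rw [ih (u ++ [x]) w' (by lia) (by simp; lia)]
        simp
      · exact contract_congr w (fun w' hw' ↦ hg _ (by simp; lia))
  have aux' (n : ℕ) : ∀ w, w.length = n → L (symmAux base n w) = θ w := by
    induction n with
    | zero => intro w hw; exact hL w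
    | succ n ih =>
      intro w hw
      exact aux _ n ih (n + 1) [] w hw (by simp)
  exact aux' _ w rfl

end CharZero

/-- The symmetrization is natural with respect to morphisms of graded Lie algebras. -/
lemma map_symm_of_hom {A' : GrLieAlgebra k} (m : Hom A A') {base : List A.Letter → Z}
    {base' : List A'.Letter → Z'} (L : Z →ₗ[k] Z')
    (hL : ∀ w, L (base w) = base' (w.map (fun x ↦ ⟨x.1, m.map x.1 x.2⟩))) (w : List A.Letter) :
    L (symm base w) = symm base' (w.map (fun x ↦ ⟨x.1, m.map x.1 x.2⟩)) := by
  let μ : A.Letter → A'.Letter := fun x ↦ ⟨x.1, m.map x.1 x.2⟩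
  have hμ (x y : A.Letter) : μ (br x y) = br (μ x) (μ y) := by
    simp [μ, br, m.map_bracket]
  have ext (F : A.Letter → List A.Letter → Z) (F' : A'.Letter → List A'.Letter → Z')
      (w : List A.Letter) (h : ∀ x w, L (F x w) = F' (μ x) (w.map μ)) :
      L (extract F w) = extract F' (w.map μ) := by
    induction w generalizing F F' with
    | nil => simp [extract]
    | cons y w ih =>
      simp only [extract, List.map_cons, map_add, h]
      rw [ih _ (fun x w' ↦ koszul k x.1 (μ y).1 • F' x (μ y :: w')) (fun x w ↦ by simp [h, μ])]
  have con (f : List A.Letter → Z) (f' : List A'.Letter → Z')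
      (w : List A.Letter) (h : ∀ w, L (f w) = f' (w.map μ)) :
      L (contract f w) = contract f' (w.map μ) := by
    induction w generalizing f f' with
    | nil => simp [contract]
    | cons y w ih =>
      simp only [contract, List.map_cons, map_add]
      rw [ih _ (fun w' ↦ f' (μ y :: w')) (fun w ↦ by simp [h]),
        ext _ (fun x w' ↦ f' (br (μ y) x :: w')) w (fun x w ↦ by simp [h, hμ])]
  have step (g : List A.Letter → Z) (g' : List A'.Letter → Z')
      (hg : ∀ w, L (g w) = g' (w.map μ)) (n : ℕ) (u w : List A.Letter) :
      L (symmStep base g n u w) = symmStep base' g' n (u.map μ) (w.map μ) := by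
    induction n generalizing u w with
    | zero => simp only [symmStep, hL, List.map_append]; rfl
    | succ n ih =>
      simp only [symmStep, map_smul, map_add]
      rw [ext _ (fun x w' ↦ symmStep base' g' n (u.map μ ++ [x]) w') w (fun x w ↦ by simp [ih]),
        con _ (fun w' ↦ g' (u.map μ ++ w')) w (fun w ↦ by simp [hg])]
  have aux (n : ℕ) : ∀ w, L (symmAux base n w) = symmAux base' n (w.map μ) := by
    induction n with
    | zero => exact hL
    | succ n ih => exact fun w ↦ by simpa using! step _ _ ih (n + 1) [] w
  simpa [symm] using! aux w.length w

section Differential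

variable (d : ∀ p, A.X p →ₗ[k] A.X (p - 1))

/-- The differential of a letter. -/
def Letter.diff (x : A.Letter) : A.Letter := ⟨x.1 - 1, d x.1 x.2⟩

/-- The sum, with signs, of the values of a function on the words obtained by applying the
differential to one letter of a word. -/
def diffSum : (List A.Letter → Z) → List A.Letter → Z
  | _, [] => 0
  | f, y :: w => f (y.diff d :: w) + koszul k 1 y.1 • diffSum (fun w' ↦ f (y :: w')) w

lemma diffSum_congr {f g : List A.Letter → Z} (w : List A.Letter)
    (h : ∀ w', w'.length = w.length → f w' = g w') : diffSum d f w = diffSum d g w := by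
  induction w generalizing f g with
  | nil => rfl
  | cons y w ih =>
    rw [diffSum, diffSum, ih (fun w' hw ↦ h _ (by simp [hw])), h _ (by simp)]

lemma diffSum_add (f g : List A.Letter → Z) (w : List A.Letter) :
    diffSum d (fun w ↦ f w + g w) w = diffSum d f w + diffSum d g w := by
  induction w generalizing f g with
  | nil => simp [diffSum]
  | cons y w ih => simp only [diffSum, ih]; module

lemma diffSum_smul (c : k) (f : List A.Letter → Z) (w : List A.Letter) :
    diffSum d (fun w ↦ c • f w) w = c • diffSum d f w := by
  induction w generalizing f with
  | nil => simp [diffSum]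
  | cons y w ih => simp only [diffSum, ih]; module

lemma map_diffSum (L : Z →ₗ[k] Z') (f : List A.Letter → Z) (w : List A.Letter) :
    L (diffSum d f w) = diffSum d (fun w ↦ L (f w)) w := by
  induction w generalizing f with
  | nil => simp [diffSum]
  | cons y w ih => simp [diffSum, ih]

lemma diffSum_append (f : List A.Letter → Z) (u w : List A.Letter) :
    diffSum d f (u ++ w) = diffSum d (fun u' ↦ f (u' ++ w)) u +
      koszul k 1 (deg u) • diffSum d (fun w' ↦ f (u ++ w')) w := by
  induction u generalizing f with
  | nil => simp [diffSum, deg]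
  | cons y u ih => simp only [List.cons_append, diffSum, ih, deg, koszul_add_right]; module

lemma extract_diffSum (H : List A.Letter → A.Letter → List A.Letter → Z) (u w : List A.Letter) :
    extract (fun x w' ↦ diffSum d (fun u' ↦ H u' x w') u) w =
      diffSum d (fun u' ↦ extract (H u') w) u := by
  induction u generalizing H with
  | nil => simp only [diffSum, extract_zero]
  | cons y u ih => simp only [diffSum, extract_add, extract_smul, ih]

lemma contract_diffSum (H : List A.Letter → List A.Letter → Z) (u w : List A.Letter) :
    contract (fun w' ↦ diffSum d (fun u' ↦ H u' w') u) w =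
      diffSum d (fun u' ↦ contract (H u') w) u := by
  induction u generalizing H with
  | nil => simpa [diffSum] using contract_smul (0 : k) (fun _ ↦ (0 : Z)) w
  | cons y u ih => simp only [diffSum, contract_add, contract_smul, ih]

lemma diffSum_extract (F : A.Letter → List A.Letter → Z) (w : List A.Letter) :
    diffSum d (extract F) w =
      extract (fun x w' ↦ F (x.diff d) w' + koszul k 1 x.1 • diffSum d (F x) w') w := by
  induction w generalizing F with
  | nil => simp [diffSum, extract]
  | cons y w ih =>
    simp only [diffSum, extract, diffSum_add, ih, diffSum_smul, smul_add, extract_add]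
    have h1 : extract (fun x w' ↦ koszul k x.1 (y.diff d).1 • F x (y.diff d :: w')) w =
        extract (fun x w' ↦ koszul k x.1 y.1 • koszul k 1 x.1 • F x (y.diff d :: w')) w := by
      refine extract_congr w (fun x w' _ ↦ ?_)
      rw [smul_smul, show (y.diff d).1 = y.1 - 1 from rfl, koszul_sub_right, koszul_comm x.1 1]
    have h2 : extract (fun x w' ↦ koszul k (x.diff d).1 y.1 • F (x.diff d) (y :: w')) w =
        koszul k 1 y.1 • extract (fun x w' ↦ koszul k x.1 y.1 • F (x.diff d) (y :: w')) w := by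
      rw [← extract_smul]
      refine extract_congr w (fun x w' _ ↦ ?_)
      rw [smul_smul, show (x.diff d).1 = x.1 - 1 from rfl, koszul_sub_left, mul_comm]
    have h3 : extract (fun x w' ↦ koszul k 1 x.1 • koszul k x.1 y.1 •
          diffSum d (fun w' ↦ F x (y :: w')) w') w =
        koszul k 1 y.1 • extract (fun x w' ↦ koszul k x.1 y.1 • koszul k 1 x.1 • koszul k 1 y.1 •
          diffSum d (fun w' ↦ F x (y :: w')) w') w := by
      rw [← extract_smul]
      refine extract_congr w (fun x w' _ ↦ ?_)
      rcases koszul_eq_one_or (k := k) 1 y.1 with e | e <;> simp only [e] <;> module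
    rw [h1, h2, h3]
    have e := koszul_mul_self (k := k) 1 y.1
    rcases koszul_eq_one_or (k := k) 1 y.1 with e | e <;> simp only [e] <;> module

variable (hd : ∀ p q n h x y, d n (A.bracket p q n h x y) =
  A.bracket (p - 1) q (n - 1) (by lia) (d p x) y +
    koszul k 1 p • A.bracket p (q - 1) (n - 1) (by lia) x (d q y))

include hd

lemma IsMultilinear.br_diff {f : List A.Letter → Z} (hf : IsMultilinear f) (x y : A.Letter)
    (w : List A.Letter) : f ((br x y).diff d :: w) =
      f (br (x.diff d) y :: w) + koszul k 1 x.1 • f (br x (y.diff d) :: w) := by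
  obtain ⟨p, x⟩ := x
  obtain ⟨q, y⟩ := y
  have h1 : br (Letter.diff d ⟨p, x⟩) ⟨q, y⟩ = (⟨p + q - 1, _⟩ : A.Letter) :=
    (mk_bracket (by lia) (d p x) y).symm
  have h2 : br ⟨p, x⟩ (Letter.diff d ⟨q, y⟩) = (⟨p + q - 1, _⟩ : A.Letter) :=
    (mk_bracket (by lia) x (d q y)).symm
  have h3 : (br ⟨p, x⟩ ⟨q, y⟩ : A.Letter).diff d = ⟨p + q - 1, _⟩ :=
    congr_arg (Sigma.mk (p + q - 1)) (hd p q (p + q) rfl x y)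
  have h4 := hf [] (p + q - 1) w
  simp only [List.nil_append] at h4
  rw [h1, h2, h3, h4.map_add, h4.map_smul]

lemma diffSum_contract {f : List A.Letter → Z} (hf : IsMultilinear f) (w : List A.Letter) :
    diffSum d (contract f) w = contract (fun w' ↦ diffSum d f w') w := by
  induction w generalizing f with
  | nil => simp [diffSum, contract]
  | cons y w ih =>
    simp only [diffSum, contract, diffSum_add, contract_add, ih (hf.cons y), contract_smul]
    have h1 : extract (fun x w' ↦ f ((br y x).diff d :: w')) w =
        extract (fun x w' ↦ f (br (y.diff d) x :: w')) w +
          koszul k 1 y.1 • extract (fun x w' ↦ f (br y (x.diff d) :: w')) w := by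
      rw [← extract_smul, ← extract_add]
      exact extract_congr w (fun x w' _ ↦ hf.br_diff d hd y x w')
    have h2 : extract (fun x w' ↦ koszul k 1 (br y x).1 •
          diffSum d (fun w'' ↦ f (br y x :: w'')) w') w =
        koszul k 1 y.1 • extract (fun x w' ↦ koszul k 1 x.1 •
          diffSum d (fun w'' ↦ f (br y x :: w'')) w') w := by
      rw [← extract_smul]
      refine extract_congr w (fun x w' _ ↦ ?_)
      rw [smul_smul, show (br y x).1 = y.1 + x.1 from rfl, koszul_add_right]
    rw [extract_add, h1, h2, diffSum_extract, extract_add]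
    module

/-- The symmetrization is compatible with differentials. -/
lemma map_symm_diff (L : Z →ₗ[k] Z) {base : List A.Letter → Z} (hbase : IsMultilinear base)
    (hL : ∀ w, L (base w) = diffSum d base w) (w : List A.Letter) :
    L (symm base w) = diffSum d (symm base) w := by
  have step (g : List A.Letter → Z) (hg : IsMultilinear g) (hgL : ∀ w, L (g w) = diffSum d g w)
      (m : ℕ) (u w : List A.Letter) :
      L (symmStep base g m u w) = diffSum d (fun u' ↦ symmStep base g m u' w) u +
        koszul k 1 (deg u) • diffSum d (symmStep base g m u) w := by
    induction m generalizing u w with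
    | zero =>
      rw [symmStep, hL, diffSum_append]
      rfl
    | succ m ih =>
      simp only [symmStep, map_smul, map_add, map_extract, map_contract, hgL, ih, diffSum_append,
        diffSum_smul, diffSum_add, contract_add, contract_smul, extract_add,
        deg_append, koszul_add_right, diffSum_contract d hd (hg.append u)]
      have h1 := extract_diffSum d (fun u' x w' ↦ symmStep base g m (u' ++ [x]) w') u w
      have h2 := contract_diffSum d (fun u' w' ↦ g (u' ++ w')) u w
      have h3 := diffSum_extract d (fun x w' ↦ symmStep base g m (u ++ [x]) w') w
      have h4 : extract (fun x w' ↦ koszul k 1 (deg u) • diffSum d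
          (fun u' ↦ symmStep base g m (u ++ u') w') [x]) w =
          koszul k 1 (deg u) • extract (fun x w' ↦ symmStep base g m (u ++ [x.diff d]) w') w := by
        rw [← extract_smul]
        refine extract_congr w (fun x w' _ ↦ ?_)
        simp [diffSum]
      have h5 : extract (fun x w' ↦ (koszul k 1 (deg u) * koszul k 1 (deg [x])) •
          diffSum d (symmStep base g m (u ++ [x])) w') w =
          koszul k 1 (deg u) • extract (fun x w' ↦ koszul k 1 x.1 •
            diffSum d (symmStep base g m (u ++ [x])) w') w := by
        rw [← extract_smul]
        refine extract_congr w (fun x w' _ ↦ ?_)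
        simp [deg, smul_smul]
      rw [extract_add] at h3
      rw [h1, h2, h3, h4, h5]
      module
  have aux (n : ℕ) : ∀ w, L (symmAux base n w) = diffSum d (symmAux base n) w := by
    induction n with
    | zero => exact hL
    | succ n ih =>
      intro w
      simpa [diffSum, deg] using! step _ (isMultilinear_symmAux hbase n) ih (n + 1) [] w
  refine (aux w.length w).trans (diffSum_congr d w (fun w' hw' ↦ ?_))
  rw [symm, hw']

end Differential

end GrLieAlgebra

/-! ### Words in the elements of a graded Lie algebra and in free generators -/

namespace TensorAlgebra

variable {k M P : Type*} [Field k] [AddCommGroup M] [Module k M] [AddCommGroup P] [Module k P]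

/-- Induction over tensors built by multiplication with vectors from the left. -/
lemma left_induction {p : TensorAlgebra k M → Prop} (one : p 1)
    (add : ∀ s t, p s → p t → p (s + t)) (smul : ∀ (c : k) t, p t → p (c • t))
    (ι_mul : ∀ x t, p t → p (ι k x * t)) (t : TensorAlgebra k M) : p t := by
  have h (s : TensorAlgebra k M) : ∀ t, p t → p (s * t) := by
    induction s using TensorAlgebra.induction with
    | algebraMap c => intro t ht; rw [← Algebra.smul_def]; exact smul c t ht
    | ι x => exact ι_mul x
    | mul a b ha hb => intro t ht; rw [mul_assoc]; exact ha _ (hb t ht)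
    | add a b ha hb => intro t ht; rw [add_mul]; exact add _ _ (ha t ht) (hb t ht)
  simpa using h t 1 one

/-- Linear maps out of a tensor algebra, defined by primitive recursion: the value at `x * t` is
`a x` applied to the value at `t`, plus `b x t`. -/
noncomputable def primRec (a : M →ₗ[k] Module.End k P)
    (b : M →ₗ[k] TensorAlgebra k M →ₗ[k] P) (p₀ : P) : TensorAlgebra k M →ₗ[k] P :=
  (LinearMap.snd k (TensorAlgebra k M) P).comp ((LinearMap.applyₗ (R := k) (1, p₀)).comp
    (lift k (A := Module.End k (TensorAlgebra k M × P))
      { toFun x := ((LinearMap.mulLeft k (ι k x)).comp (LinearMap.fst k _ _)).prod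
          ((a x).comp (LinearMap.snd k _ _) + (b x).comp (LinearMap.fst k _ _))
        map_add' x y := by ext <;> simp [add_mul]
        map_smul' c x := by ext <;> simp }).toLinearMap)

section

variable (a : M →ₗ[k] Module.End k P) (b : M →ₗ[k] TensorAlgebra k M →ₗ[k] P) (p₀ : P)

@[simp] lemma primRec_one : primRec a b p₀ 1 = p₀ := by simp [primRec]

@[simp] lemma primRec_ι_mul (x : M) (t : TensorAlgebra k M) :
    primRec a b p₀ (ι k x * t) = a x (primRec a b p₀ t) + b x t := by
  have h (t : TensorAlgebra k M) : (lift k (A := Module.End k (TensorAlgebra k M × P))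
      { toFun x := ((LinearMap.mulLeft k (ι k x)).comp (LinearMap.fst k _ _)).prod
          ((a x).comp (LinearMap.snd k _ _) + (b x).comp (LinearMap.fst k _ _))
        map_add' x y := by ext <;> simp [add_mul]
        map_smul' c x := by ext <;> simp } t (1, p₀)).1 = t := by
    induction t using left_induction with
    | one => simp
    | add s t hs ht => simp [hs, ht]
    | smul c t ht => simp [ht]
    | ι_mul x t ht => simp [ht]
  simp [primRec, h]

end

end TensorAlgebra

namespace GrLieAlgebra

open Letter

variable {k : Type u} [Field k]

/-- The tensor algebra on the total space of `A` and on generators indexed by `J`. It is spanned by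
the words whose letters are homogeneous elements of `A` and elements of `J`. -/
abbrev Words (A : GrLieAlgebra k) (J : Type u) : Type u :=
  TensorAlgebra k ((DirectSum ℤ A.X) × (J →₀ k))

namespace Words

variable {A : GrLieAlgebra k} {J : Type u} {P : Type u} [AddCommGroup P] [Module k P]

variable (J) in
/-- The word with one letter, a homogeneous element of `A`. -/
noncomputable def letter (p : ℤ) : A.X p →ₗ[k] Words A J :=
  (TensorAlgebra.ι k).comp ((LinearMap.inl k _ _).comp (DirectSum.lof k ℤ A.X p))

lemma letter_castₗ {p q : ℤ} (h : p = q) (x : A.X p) :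
    letter J q (A.castₗ h x) = letter J p x := by
  subst h; rfl

variable (A) in
/-- The word with one letter, an element of `J`. -/
noncomputable def gen (j : J) : Words A J :=
  TensorAlgebra.ι k (LinearMap.inr k _ _ (Finsupp.single j 1))

lemma induction {p : Words A J → Prop} (one : p 1)
    (add : ∀ s t, p s → p t → p (s + t)) (smul : ∀ (c : k) t, p t → p (c • t))
    (letter_mul : ∀ n (x : A.X n) t, p t → p (letter J n x * t))
    (gen_mul : ∀ j t, p t → p (gen A j * t)) (t : Words A J) : p t := by
  induction t using TensorAlgebra.left_induction with
  | one => exact one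
  | add s t hs ht => exact add s t hs ht
  | smul c t ht => exact smul c t ht
  | ι_mul x t ht =>
    obtain ⟨x, y⟩ := x
    have h0 : p 0 := by simpa using smul 0 t ht
    rw [show (x, y) = LinearMap.inl k _ _ x + LinearMap.inr k _ _ y by simp, map_add, add_mul]
    refine add _ _ ?_ ?_
    · induction x using DirectSum.induction_on with
      | zero => rwa [map_zero, map_zero, zero_mul]
      | of n x => exact letter_mul n x t ht
      | add x y hx hy => rw [map_add, map_add, add_mul]; exact add _ _ hx hy
    · induction y using Finsupp.induction_linear with
      | zero => rwa [map_zero, map_zero, zero_mul]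
      | single j c =>
        rw [show Finsupp.single j c = c • Finsupp.single j (1 : k) by simp, map_smul, map_smul,
          smul_mul_assoc]
        exact smul _ _ (gen_mul j t ht)
      | add x y hx hy => rw [map_add, map_add, add_mul]; exact add _ _ hx hy

lemma linearMap_ext {L L' : Words A J →ₗ[k] P} (one : L 1 = L' 1)
    (letter_mul : ∀ n (x : A.X n) t, L t = L' t → L (letter J n x * t) = L' (letter J n x * t))
    (gen_mul : ∀ j t, L t = L' t → L (gen A j * t) = L' (gen A j * t)) : L = L' := by
  ext t : 1
  induction t using induction with
  | one => exact one
  | add s t hs ht => rw [map_add, map_add, hs, ht]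
  | smul c t ht => rw [map_smul, map_smul, ht]
  | letter_mul n x t ht => exact letter_mul n x t ht
  | gen_mul j t ht => exact gen_mul j t ht

section Recursion

variable (a : ∀ p, A.X p →ₗ[k] Module.End k P) (a' : J → Module.End k P)
  (b : ∀ p, A.X p →ₗ[k] Words A J →ₗ[k] P) (b' : J → Words A J →ₗ[k] P) (p₀ : P)

/-- Linear functions of words, defined by primitive recursion. -/
noncomputable def primRec : Words A J →ₗ[k] P :=
  TensorAlgebra.primRec
    ((DirectSum.toModule k ℤ _ a).coprod (Finsupp.linearCombination k a'))
    ((DirectSum.toModule k ℤ _ b).coprod (Finsupp.linearCombination k b')) p₀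

@[simp] lemma primRec_one : primRec a a' b b' p₀ 1 = p₀ := TensorAlgebra.primRec_one _ _ _

@[simp] lemma primRec_letter_mul (n : ℤ) (x : A.X n) (t : Words A J) :
    primRec a a' b b' p₀ (letter J n x * t) = a n x (primRec a a' b b' p₀ t) + b n x t := by
  refine (TensorAlgebra.primRec_ι_mul _ _ _ _ t).trans ?_
  simp [primRec]

@[simp] lemma primRec_gen_mul (j : J) (t : Words A J) :
    primRec a a' b b' p₀ (gen A j * t) = a' j (primRec a a' b b' p₀ t) + b' j t := by
  refine (TensorAlgebra.primRec_ι_mul _ _ _ _ t).trans ?_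
  simp [primRec]

end Recursion

variable {A' : GrLieAlgebra k}

/-- The action on words of a map of letters which preserves the degree. -/
noncomputable def map (f : ∀ p, A.X p →ₗ[k] A'.X p) : Words A J →ₗ[k] Words A' J :=
  primRec (fun p ↦ (LinearMap.mul k (Words A' J)).comp ((letter J p).comp (f p)))
    (fun j ↦ LinearMap.mulLeft k (gen A' j)) (fun _ ↦ 0) (fun _ ↦ 0) 1

section

variable (f : ∀ p, A.X p →ₗ[k] A'.X p)

@[simp] lemma map_one : map f (1 : Words A J) = 1 := by simp [map]

@[simp] lemma map_letter_mul (n : ℤ) (x : A.X n) (t : Words A J) :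
    map f (letter J n x * t) = letter J n (f n x) * map f t := by simp [map]

@[simp] lemma map_gen_mul (j : J) (t : Words A J) :
    map f (gen A j * t) = gen A' j * map f t := by simp [map]

lemma map_mul (s t : Words A J) : map f (s * t) = map f s * map f t := by
  induction s using induction with
  | one => simp
  | add s t hs ht => simp [add_mul, hs, ht]
  | smul c t ht => simp [ht]
  | letter_mul n x t ht => simp [mul_assoc, ht]
  | gen_mul j t ht => simp [mul_assoc, ht]

end

variable (deg : J → ℤ)

/-- The sign automorphism on words. -/
noncomputable def sgn : Words A J →ₗ[k] Words A J :=
  primRec (fun p ↦ koszul k 1 p • (LinearMap.mul k (Words A J)).comp (letter J p))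
    (fun j ↦ koszul k 1 (deg j) • LinearMap.mulLeft k (gen A j)) (fun _ ↦ 0) (fun _ ↦ 0) 1

@[simp] lemma sgn_one : sgn deg (1 : Words A J) = 1 := by simp [sgn]

@[simp] lemma sgn_letter_mul (n : ℤ) (x : A.X n) (t : Words A J) :
    sgn deg (letter J n x * t) = koszul k 1 n • (letter J n x * sgn deg t) := by simp [sgn]

@[simp] lemma sgn_gen_mul (j : J) (t : Words A J) :
    sgn deg (gen A j * t) = koszul k 1 (deg j) • (gen A j * sgn deg t) := by simp [sgn]

/-- The action on words of a map `δ` of odd degree which vanishes on `J`, as a derivation twisted by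
a map `q` which preserves the degree. -/
noncomputable def twistedDer (q : ∀ p, A.X p →ₗ[k] A.X p) {e : ℤ → ℤ}
    (δ : ∀ p, A.X p →ₗ[k] A.X (e p)) : Words A J →ₗ[k] Words A J :=
  primRec (fun p ↦ koszul k 1 p • (LinearMap.mul k (Words A J)).comp ((letter J p).comp (q p)))
    (fun j ↦ koszul k 1 (deg j) • LinearMap.mulLeft k (gen A j))
    (fun p ↦ (LinearMap.mul k (Words A J)).comp ((letter J (e p)).comp (δ p))) (fun _ ↦ 0) 0

section

variable (q : ∀ p, A.X p →ₗ[k] A.X p) {e : ℤ → ℤ} (δ : ∀ p, A.X p →ₗ[k] A.X (e p))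

@[simp] lemma twistedDer_one : twistedDer deg q δ (1 : Words A J) = 0 := by simp [twistedDer]

@[simp] lemma twistedDer_letter_mul (n : ℤ) (x : A.X n) (t : Words A J) :
    twistedDer deg q δ (letter J n x * t) =
      koszul k 1 n • (letter J n (q n x) * twistedDer deg q δ t) + letter J (e n) (δ n x) * t := by
  simp [twistedDer]

@[simp] lemma twistedDer_gen_mul (j : J) (t : Words A J) :
    twistedDer deg q δ (gen A j * t) = koszul k 1 (deg j) • (gen A j * twistedDer deg q δ t) := by
  simp [twistedDer]

/-- The derivation of words which extends a map of odd degree. -/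
noncomputable abbrev diff (d : ∀ p, A.X p →ₗ[k] A.X (e p)) : Words A J →ₗ[k] Words A J :=
  twistedDer deg (fun _ ↦ LinearMap.id) d

lemma diff_mul (s t : Words A J) :
    diff deg δ (s * t) = diff deg δ s * t + sgn deg s * diff deg δ t := by
  induction s using induction with
  | one => simp
  | add s t hs ht => simp only [add_mul, map_add, hs, ht]; abel
  | smul c t ht => simp [ht]
  | letter_mul n x t ht => simp [mul_assoc, ht, mul_add, add_mul]; abel
  | gen_mul j t ht => simp [mul_assoc, ht, mul_add]

/-- A homotopy between the identity and `q` on letters induces such a homotopy on words. -/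
lemma diff_homotopy (d : ∀ p, A.X p →ₗ[k] A.X (p - 1)) (h : ∀ p, A.X p →ₗ[k] A.X (p + 1))
    (hdq : ∀ p x, d p (q p x) = q (p - 1) (d p x))
    (hdh : ∀ (p : ℤ) (x : A.X p), A.castₗ (by lia : p + 1 - 1 = p) (d (p + 1) (h p x)) +
      A.castₗ (by lia : p - 1 + 1 = p) (h (p - 1) (d p x)) + q p x = x)
    (t : Words A J) :
    diff deg d (twistedDer deg q h t) + twistedDer deg q h (diff deg d t) + map q t = t := by
  have key : (diff deg d).comp (twistedDer deg q h) + (twistedDer deg q h).comp (diff deg d) +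
      map q = LinearMap.id (M := Words A J) := by
    refine linearMap_ext (by simp) (fun n x t ht ↦ ?_) (fun j t ht ↦ ?_)
    · simp only [LinearMap.add_apply, LinearMap.comp_apply, LinearMap.id_apply] at ht ⊢
      have hn := congr_arg (fun y ↦ letter J n y * t) (hdh n x)
      have ht' := congr_arg (letter J n (q n x) * ·) ht
      simp only [_root_.map_add, letter_castₗ, add_mul, mul_add] at hn ht'
      simp only [twistedDer_letter_mul, _root_.map_add, _root_.map_smul, map_letter_mul,
        LinearMap.id_apply, hdq]
      rw [koszul_add_right, koszul_sub_right, koszul_one_one]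
      simp only [smul_add, smul_smul]
      rcases koszul_eq_one_or (k := k) 1 n with e | e <;> simp only [e] <;>
        linear_combination (norm := module) hn + ht'
    · simp only [LinearMap.add_apply, LinearMap.comp_apply, LinearMap.id_apply] at ht ⊢
      simp only [twistedDer_gen_mul, _root_.map_smul, map_gen_mul, smul_smul, koszul_mul_self,
        one_smul]
      rw [← mul_add, ← mul_add, ht]
  exact DFunLike.congr_fun key t

/-- A map of letters which kills `h` and is unchanged by `q` kills the homotopy on words. -/
lemma map_twistedDer_eq_zero (f : ∀ p, A.X p →ₗ[k] A'.X p) (hδ : ∀ p x, f (e p) (δ p x) = 0)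
    (t : Words A J) : map f (twistedDer deg q δ t) = 0 := by
  have key : (map f).comp (twistedDer deg q δ) = (0 : Words A J →ₗ[k] _) := by
    refine linearMap_ext (by simp) (fun n x t ht ↦ ?_) (fun j t ht ↦ ?_)
    · simp at ht; simp [ht, hδ]
    · simp at ht; simp [ht]
  exact DFunLike.congr_fun key t

end

/-- The augmentation, which vanishes on non-empty words. -/
noncomputable def aug : Words A J →ₗ[k] k :=
  primRec (fun _ ↦ 0) (fun _ ↦ 0) (fun _ ↦ 0) (fun _ ↦ 0) 1

@[simp] lemma aug_one : aug (1 : Words A J) = 1 := by simp [aug]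

@[simp] lemma aug_letter_mul (n : ℤ) (x : A.X n) (t : Words A J) :
    aug (letter J n x * t) = 0 := by simp [aug]

@[simp] lemma aug_gen_mul (j : J) (t : Words A J) : aug (gen A j * t) = 0 := by simp [aug]

lemma aug_mul (s t : Words A J) : aug (s * t) = aug s * aug t := by
  induction s using induction with
  | one => simp
  | add s t hs ht => simp [add_mul, hs, ht]
  | smul c t ht => simp [ht, mul_assoc]
  | letter_mul n x t ht => simp [mul_assoc]
  | gen_mul j t ht => simp [mul_assoc]

lemma aug_map (f : ∀ p, A.X p →ₗ[k] A'.X p) (t : Words A J) : aug (map f t) = aug t := by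
  induction t using induction with
  | one => simp
  | add s t hs ht => simp [hs, ht]
  | smul c t ht => simp [ht]
  | letter_mul n x t ht => simp
  | gen_mul j t ht => simp

lemma aug_twistedDer (q : ∀ p, A.X p →ₗ[k] A.X p) {e : ℤ → ℤ} (δ : ∀ p, A.X p →ₗ[k] A.X (e p))
    (t : Words A J) : aug (twistedDer deg q δ t) = 0 := by
  induction t using induction with
  | one => simp
  | add s t hs ht => simp [hs, ht]
  | smul c t ht => simp [ht]
  | letter_mul n x t ht => simp
  | gen_mul j t ht => simp

/-! ### The action of `A` on words by symmetrization -/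

variable (J) in
/-- The element of the tensor algebra given by a word in the letters of `A`. -/
noncomputable def word : List A.Letter → Words A J
  | [] => 1
  | x :: w => letter J x.1 x.2 * word w

lemma word_append (u w : List A.Letter) : word J (u ++ w) = word J u * word J w := by
  induction u with
  | nil => simp [word]
  | cons x u ih => simp [word, ih, mul_assoc]

lemma isMultilinear_word : IsMultilinear (A := A) (word J) := by
  intro u p v
  constructor
  · intro x y; simp [word_append, word, add_mul, mul_add]
  · intro c x; simp [word_append, word]

variable (A J) in
/-- The symmetrized word. -/
noncomputable abbrev symmWord : List A.Letter → Words A J := symm (word J)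

lemma sgn_word (w : List A.Letter) : sgn deg (word J w) = koszul k 1 (Letter.deg w) • word J w := by
  induction w with
  | nil => simp [word, Letter.deg]
  | cons x w ih => simp [word, Letter.deg, ih, koszul_add_right, smul_smul]

end Words

end GrLieAlgebra

namespace GrLieAlgebra

open Letter

variable {k : Type u} [Field k]

/-- Multiplying each letter by the sign of its degree is an automorphism. -/
def signHom (A : GrLieAlgebra k) : Hom A A where
  map p := koszul k 1 p • LinearMap.id
  map_bracket p q n h x y := by
    subst h
    simp [koszul_add_right, smul_smul, mul_comm]

lemma IsMultilinear.map_signHom {A : GrLieAlgebra k} {Z : Type*} [AddCommGroup Z] [Module k Z]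
    {f : List A.Letter → Z} (hf : IsMultilinear f) (w : List A.Letter) :
    f (w.map (fun x ↦ ⟨x.1, A.signHom.map x.1 x.2⟩)) = koszul k 1 (Letter.deg w) • f w := by
  induction w generalizing f with
  | nil => simp [Letter.deg]
  | cons x w ih =>
    have h1 := ih (hf.cons ⟨x.1, A.signHom.map x.1 x.2⟩)
    have h2 := (hf [] x.1 w).map_smul (koszul k 1 x.1) x.2
    simp only [List.nil_append] at h2
    simp only [List.map_cons, Letter.deg, koszul_add_right]
    rw [h1, mul_comm, mul_smul, ← h2]
    rfl

/-- The functions of words which are linear in each letter. -/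
def multilinear (A : GrLieAlgebra k) (Z : Type*) [AddCommGroup Z] [Module k Z] :
    Submodule k (List A.Letter → Z) where
  carrier := {f | IsMultilinear f}
  add_mem' hf hg u p v := isLinearMap_add (hf u p v) (hg u p v)
  zero_mem' u p v := ⟨fun _ _ ↦ (add_zero _).symm, fun _ _ ↦ (smul_zero _).symm⟩
  smul_mem' c f hf u p v := isLinearMap_smul c (hf u p v)

/-- The adjoint representation of `B` on the product of its components. -/
def adjoint (B : GrLieAlgebra k) : Hom B (endomorphisms (∀ p, B.X p)) where
  map p :=
    { toFun x := LinearMap.pi fun n ↦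
        (B.bracket p (n - p) n (by lia) x).comp (LinearMap.proj (n - p))
      map_add' x y := by ext; simp
      map_smul' c x := by ext; simp }
  map_bracket p q n h x y := by
    have H (p q q' n : ℤ) (h : q = q') (h' : p + q = n) (x : B.X p) (z : ∀ p, B.X p) :
        B.bracket p q n h' x (z q) = B.bracket p q' n (by lia) x (z q') := by subst h; rfl
    refine LinearMap.ext fun z ↦ funext fun m ↦ ?_
    have := B.leibniz p q (m - n) n (m - q) (m - p) m h (by lia) (by lia) (by lia) x y (z (m - n))
    simp only [LinearMap.mk₂_apply, LinearMap.sub_apply, Module.End.mul_apply,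
      LinearMap.smul_apply, LinearMap.pi_apply, LinearMap.comp_apply, LinearMap.proj_apply,
      Pi.sub_apply, Pi.smul_apply, LinearMap.coe_mk, AddHom.coe_mk]
    rw [H q (m - p - q) (m - n) (m - p) (by lia), H p (m - q - p) (m - n) (m - q) (by lia), this]
    abel

lemma adjoint_apply (B : GrLieAlgebra k) {p : ℤ} (x : B.X p) (z : ∀ p, B.X p) {q n : ℤ}
    (h : p + q = n) : B.adjoint.map p x z n = B.bracket p q n h x (z q) := by
  obtain rfl : q = n - p := by lia
  rfl

lemma adjoint_single [DecidableEq ℤ] (B : GrLieAlgebra k) {p q n : ℤ} (h : p + q = n) (x : B.X p)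
    (y : B.X q) : B.adjoint.map p x (LinearMap.single k B.X q y) =
      LinearMap.single k B.X n (B.bracket p q n h x y) := by
  ext m
  by_cases hm : m = n
  · subst hm
    rw [adjoint_apply B x _ h]
    simp
  · rw [adjoint_apply B x _ (show p + (m - p) = m by lia)]
    simp [Pi.single_eq_of_ne hm, Pi.single_eq_of_ne (show m - p ≠ q by lia)]

namespace Words

section Act

variable {A : GrLieAlgebra k} {J : Type u}

/-- The action on words of the words in `A`: the letters in `A` at the beginning of the argument are
appended to the acting word, and the result is symmetrized. -/
noncomputable def act : Words A J →ₗ[k] multilinear A (Words A J) :=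
  primRec
    (fun p ↦
      { toFun x :=
          { toFun φ := ⟨fun w ↦ φ.1 (w ++ [⟨p, x⟩]), fun u q v ↦ by
              simpa using φ.2 u q (v ++ [⟨p, x⟩])⟩
            map_add' _ _ := rfl
            map_smul' _ _ := rfl }
        map_add' x y := by
          ext φ w : 3
          exact (φ.2 w p []).map_add x y
        map_smul' c x := by
          ext φ w : 3
          exact (φ.2 w p []).map_smul c x })
    (fun _ ↦ 0) (fun _ ↦ 0)
    (fun j ↦
      { toFun t := ⟨fun w ↦ symmWord A J w * (gen A j * t), fun u p v ↦
          ⟨fun x y ↦ (congr_arg (· * (gen A j * t))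
              ((isMultilinear_word.symm u p v).map_add x y)).trans (add_mul _ _ _),
            fun c x ↦ (congr_arg (· * (gen A j * t))
              ((isMultilinear_word.symm u p v).map_smul c x)).trans (smul_mul_assoc _ _ _)⟩⟩
        map_add' x y := by ext w : 2; simp [mul_add]
        map_smul' c x := by ext w : 2; simp })
    ⟨symmWord A J, isMultilinear_word.symm⟩

lemma act_one (w : List A.Letter) : (act (1 : Words A J)).1 w = symmWord A J w := by
  simp [act]

lemma act_letter_mul (n : ℤ) (x : A.X n) (t : Words A J) (w : List A.Letter) :
    (act (letter J n x * t)).1 w = (act t).1 (w ++ [⟨n, x⟩]) := by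
  simp [act]

lemma act_gen_mul (j : J) (t : Words A J) (w : List A.Letter) :
    (act (gen A j * t)).1 w = symmWord A J w * (gen A j * t) := by
  simp [act]

lemma act_word_mul (u w : List A.Letter) (t : Words A J) :
    (act (word J u * t)).1 w = (act t).1 (w ++ u) := by
  induction u generalizing w with
  | nil => simp [word]
  | cons x u ih => rw [word, mul_assoc, act_letter_mul, ih]; simp

variable [CharZero k]

/-- The action satisfies the relations of the universal enveloping algebra of `A`. -/
lemma act_swap (t : Words A J) (n : ℕ) : HasCommutator n (act t).1 (act t).1 := by
  intro u a b v huv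
  clear huv
  induction t using induction generalizing v with
  | one => simpa only [act_one] using symm_swap isMultilinear_word u a b v
  | add s t hs ht => simp only [map_add, Submodule.coe_add, Pi.add_apply, hs, ht]; module
  | smul c t ht => simp only [map_smul, Submodule.coe_smul, Pi.smul_apply, ht]; module
  | letter_mul m x t ht =>
    simpa [act_letter_mul] using! ht (v ++ [⟨m, x⟩])
  | gen_mul j t ht =>
    simp only [act_gen_mul]
    rw [← smul_mul_assoc, ← add_mul]
    exact congr_arg (· * _) (symm_swap isMultilinear_word u a b v)

/-- The action is associative. It suffices to compare both sides on words in place of symmetrized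
words, where they agree by definition. -/
lemma act_act (t : Words A J) (u w : List A.Letter) :
    (act ((act t).1 u)).1 w = (act t).1 (w ++ u) := by
  induction t using induction generalizing u with
  | one =>
    rw [act_one, act_one]
    exact map_symm ((LinearMap.proj w).comp ((multilinear A (Words A J)).subtype.comp act))
      (θ := fun u ↦ symmWord A J (w ++ u))
      (fun u ↦ by simpa [act_one] using act_word_mul u w (1 : Words A J))
      (fun n u' a b v _ ↦ by simpa using symm_swap isMultilinear_word (w ++ u') a b v) u
  | add s t hs ht => simp [hs, ht]
  | smul c t ht => simp [ht]
  | letter_mul m x t ht => simp [act_letter_mul, ht]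
  | gen_mul j t ht =>
    rw [act_gen_mul, act_gen_mul]
    exact map_symm ((LinearMap.proj w).comp ((multilinear A (Words A J)).subtype.comp
      (act.comp (LinearMap.mulRight k (gen A j * t)))))
      (θ := fun u ↦ symmWord A J (w ++ u) * (gen A j * t))
      (fun u ↦ (act_word_mul u w (gen A j * t)).trans (act_gen_mul j t _))
      (fun n u' a b v _ ↦ by
        simpa [add_mul] using congr_arg (· * (gen A j * t))
          (symm_swap isMultilinear_word (w ++ u') a b v)) u

lemma aug_act_cons (t : Words A J) (x : A.Letter) (w : List A.Letter) :
    aug ((act t).1 (x :: w)) = 0 := by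
  induction t using induction generalizing w with
  | one =>
    rw [act_one]
    exact map_symm aug (base := word J) (θ := fun w ↦ if w = [] then 1 else 0)
      (fun w ↦ by cases w <;> simp [word]) (fun n u a b v _ ↦ by simp) (x :: w)
  | add s t hs ht => simp [hs, ht]
  | smul c t ht => simp [ht]
  | letter_mul m x t ht => simp [act_letter_mul, ht]
  | gen_mul j t ht => rw [act_gen_mul, aug_mul, aug_gen_mul, mul_zero]

variable {A' : GrLieAlgebra k}

omit [CharZero k] in
lemma map_word (f : ∀ p, A.X p →ₗ[k] A'.X p) (w : List A.Letter) :
    map f (word J w) = word J (w.map (fun x ↦ ⟨x.1, f x.1 x.2⟩)) := by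
  induction w with
  | nil => simp [word]
  | cons x w ih => simp [word, ih]

omit [CharZero k] in
/-- The action is natural in `A`. -/
lemma map_act (f : Hom A A') (t : Words A J) (w : List A.Letter) :
    map f.map ((act t).1 w) = (act (map f.map t)).1 (w.map (fun x ↦ ⟨x.1, f.map x.1 x.2⟩)) := by
  induction t using induction generalizing w with
  | one =>
    rw [map_one, act_one, act_one]
    exact map_symm_of_hom f (map f.map) (map_word _) w
  | add s t hs ht => simp [hs, ht]
  | smul c t ht => simp [ht]
  | letter_mul m x t ht => simp [act_letter_mul, ht]
  | gen_mul j t ht =>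
    rw [map_gen_mul, act_gen_mul, act_gen_mul, map_mul, map_gen_mul]
    congr 1
    exact map_symm_of_hom f (map f.map) (map_word _) w

variable (deg : J → ℤ)

omit [CharZero k] in
lemma sgn_symmWord (w : List A.Letter) :
    sgn deg (symmWord A J w) = koszul k 1 (Letter.deg w) • symmWord A J w := by
  rw [map_symm_of_hom A.signHom (base' := word J) (sgn deg) (fun w ↦ ?_) w]
  · exact isMultilinear_word.symm.map_signHom w
  · rw [isMultilinear_word.map_signHom, sgn_word]

variable (d : ∀ p, A.X p →ₗ[k] A.X (p - 1))
  (hd : ∀ p q n h x y, d n (A.bracket p q n h x y) =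
    A.bracket (p - 1) q (n - 1) (by lia) (d p x) y +
      koszul k 1 p • A.bracket p (q - 1) (n - 1) (by lia) x (d q y))

omit [CharZero k] in
lemma diff_word (w : List A.Letter) : diff deg d (word J w) = diffSum d (word J) w := by
  induction w with
  | nil => simp [word, diffSum]
  | cons x w ih =>
    have := map_diffSum d (LinearMap.mulLeft k (letter J x.1 x.2)) (word J) w
    simp only [LinearMap.mulLeft_apply] at this
    simp only [word, diffSum, twistedDer_letter_mul, ih, LinearMap.id_apply, this]
    exact add_comm _ _

omit [CharZero k] in
include hd in
/-- The action is compatible with the differentials. -/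
lemma diff_act (t : Words A J) (w : List A.Letter) :
    diff deg d ((act t).1 w) = diffSum d (act t).1 w +
      koszul k 1 (Letter.deg w) • (act (diff deg d t)).1 w := by
  have h := map_symm_diff d hd (diff deg d) (isMultilinear_word (A := A) (J := J))
    (diff_word deg d)
  induction t using induction generalizing w with
  | one =>
    rw [twistedDer_one, act_one, h]
    simp [diffSum_congr d w (fun w' _ ↦ act_one (A := A) (J := J) w')]
  | add s t hs ht =>
    simp only [_root_.map_add, Submodule.coe_add, Pi.add_apply, hs, ht, smul_add]
    rw [show (↑(act s) + ↑(act t) : List A.Letter → Words A J) =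
      fun w ↦ (act s).1 w + (act t).1 w from rfl, diffSum_add]
    abel
  | smul c t ht =>
    simp only [_root_.map_smul, Submodule.coe_smul, Pi.smul_apply, ht, smul_add]
    rw [show (c • ↑(act t) : List A.Letter → Words A J) = fun w ↦ c • (act t).1 w from rfl,
      diffSum_smul, smul_comm]
  | letter_mul m x t ht =>
    have h1 : (act (letter J m x * t)).1 = fun w ↦ (act t).1 (w ++ [⟨m, x⟩]) :=
      funext (act_letter_mul m x t)
    rw [h1, ht, diffSum_append, twistedDer_letter_mul, _root_.map_add, _root_.map_smul]
    simp only [Submodule.coe_add, Submodule.coe_smul, Pi.add_apply, Pi.smul_apply,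
      act_letter_mul, LinearMap.id_apply, diffSum, deg_append, koszul_add_right, Letter.deg,
      koszul_zero_right, Letter.diff]
    module
  | gen_mul j t ht =>
    have h1 : (act (gen A j * t)).1 = fun w ↦ symmWord A J w * (gen A j * t) :=
      funext (act_gen_mul j t)
    have h2 := map_diffSum d (LinearMap.mulRight k (gen A j * t)) (symmWord A J) w
    simp only [LinearMap.mulRight_apply] at h2
    rw [h1, diff_mul, h, twistedDer_gen_mul, sgn_symmWord, _root_.map_smul, Submodule.coe_smul,
      Pi.smul_apply, act_gen_mul, ← h2]
    simp only [mul_smul_comm, smul_mul_assoc]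
    rw [smul_comm]

end Act

end Words

end GrLieAlgebra

namespace GrLieAlgebra

open Letter

variable {k : Type u} [Field k]

/-! ### The representation of a free extension on words -/

@[elab_as_elim]
lemma IsFree.induction {A B : GrLieAlgebra k} {i : Hom A B} {J : Type u} {deg : J → ℤ}
    {v : ∀ j, B.X (deg j)} (hB : IsFree i deg v) {P : ∀ p, B.X p → Prop}
    (add : ∀ p x y, P p x → P p y → P p (x + y)) (smul : ∀ p (c : k) x, P p x → P p (c • x))
    (bracket : ∀ p q n h x y, P p x → P q y → P n (B.bracket p q n h x y))
    (base : ∀ p a, P p (i.map p a)) (gen : ∀ j, P (deg j) (v j)) (p : ℤ) (x : B.X p) : P p x :=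
  hB.mem_of_bracket_mem
    (fun p ↦
      { carrier := {x | P p x}
        add_mem' hx hy := add p _ _ hx hy
        zero_mem' := by simpa using base p 0
        smul_mem' c x hx := smul p c x hx })
    (fun p q n h x hx y hy ↦ bracket p q n h x y hx hy) base gen p x

/-- The action of a derivation of degree `-1` on the product of all components. -/
def Der.total {B : GrLieAlgebra k} (δ : Der B (-1)) : Module.End k (∀ p, B.X p) :=
  LinearMap.pi fun n ↦ (δ.map (n + 1) n (by lia)).comp (LinearMap.proj (n + 1))

lemma Der.total_apply {B : GrLieAlgebra k} (δ : Der B (-1)) (z : ∀ p, B.X p) {p q : ℤ}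
    (h : p + -1 = q) : δ.total z q = δ.map p q h (z p) := by
  obtain rfl : p = q + 1 := by lia
  rfl

lemma Der.total_single {B : GrLieAlgebra k} (δ : Der B (-1)) {p q : ℤ}
    (h : p + -1 = q) (x : B.X p) :
    δ.total (LinearMap.single k B.X p x) = LinearMap.single k B.X q (δ.map p q h x) := by
  ext m
  by_cases hm : m = q
  · subst hm
    rw [δ.total_apply _ h]
    simp
  · rw [δ.total_apply _ (show m + 1 + -1 = m by lia)]
    simp [Pi.single_eq_of_ne hm, Pi.single_eq_of_ne (show m + 1 ≠ p by lia)]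

lemma Der.total_adjoint {B : GrLieAlgebra k} (δ : Der B (-1)) {p q : ℤ}
    (h : p + -1 = q) (x : B.X p) (z : ∀ p, B.X p) :
    δ.total (B.adjoint.map p x z) = B.adjoint.map q (δ.map p q h x) z +
      koszul k 1 p • B.adjoint.map p x (δ.total z) := by
  ext m
  have h1 : p + (m + 1 - p) = m + 1 := by lia
  rw [δ.total_apply _ (show m + 1 + -1 = m by lia), adjoint_apply B x z h1,
    δ.map_bracket p (m + 1 - p) (m + 1) q (m - p) m h1 h (by lia) (by lia), koszul_neg_left]
  rw [Pi.add_apply, Pi.smul_apply, adjoint_apply B _ z (show q + (m + 1 - p) = m by lia),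
    adjoint_apply B x _ (show p + (m - p) = m by lia),
    δ.total_apply z (show m + 1 - p + -1 = m - p by lia)]

namespace Words

section Eval

variable {A B : GrLieAlgebra k} (i : Hom A B) {J : Type u} {deg : J → ℤ} (v : ∀ j, B.X (deg j))

/-- The evaluation of a word as an iterated bracket. The words whose last letter is in `A` are sent
to zero, so that the words which are not killed have at least one letter in `J`. -/
noncomputable def eval : Words A J →ₗ[k] (∀ p, B.X p) :=
  primRec (fun p ↦ (B.adjoint.map p).comp (i.map p)) (fun j ↦ B.adjoint.map _ (v j))
    (fun _ ↦ 0) (fun j ↦ aug.smulRight (LinearMap.single k B.X (deg j) (v j))) 0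

@[simp] lemma eval_one : eval i v 1 = 0 := by simp [eval]

@[simp] lemma eval_letter_mul (n : ℤ) (x : A.X n) (t : Words A J) :
    eval i v (letter J n x * t) = B.adjoint.map n (i.map n x) (eval i v t) := by
  simp [eval]

@[simp] lemma eval_gen_mul (j : J) (t : Words A J) :
    eval i v (gen A j * t) = B.adjoint.map _ (v j) (eval i v t) +
      aug t • LinearMap.single k B.X (deg j) (v j) := by
  simp [eval]

/-- The iterated adjoint action of a word. -/
def adWord : List A.Letter → Module.End k (∀ p, B.X p)
  | [] => 1
  | x :: w => B.adjoint.map x.1 (i.map x.1 x.2) * adWord w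

lemma adWord_append (u w : List A.Letter) : adWord i (u ++ w) = adWord i u * adWord i w := by
  induction u with
  | nil => simp [adWord]
  | cons x u ih => simp [adWord, ih, mul_assoc]

lemma adWord_swap (z : ∀ p, B.X p) (n : ℕ) :
    HasCommutator n (fun w ↦ adWord i w z) (fun w ↦ adWord i w z) := by
  intro u a b w _
  have h := B.adjoint.map_bracket a.1 b.1 _ rfl (i.map _ a.2) (i.map _ b.2)
  simp only [LinearMap.mk₂_apply] at h
  simp only [adWord_append, adWord, br, i.map_bracket, h]
  simp only [Module.End.mul_apply, sub_mul, smul_mul_assoc, LinearMap.sub_apply,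
    LinearMap.smul_apply, map_sub, map_smul]
  abel

lemma eval_word_mul (w : List A.Letter) (t : Words A J) :
    eval i v (word J w * t) = adWord i w (eval i v t) := by
  induction w with
  | nil => simp [word, adWord]
  | cons x w ih => simp [word, adWord, mul_assoc, ih]

lemma eval_act [CharZero k] (t : Words A J) (w : List A.Letter) :
    eval i v ((act t).1 w) = adWord i w (eval i v t) := by
  induction t using induction generalizing w with
  | one =>
    rw [act_one]
    exact map_symm (eval i v) (θ := fun w ↦ adWord i w (eval i v 1))
      (fun w ↦ by simpa using eval_word_mul i v w 1) (adWord_swap i _) w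
  | add s t hs ht => simp [hs, ht]
  | smul c t ht => simp [ht]
  | letter_mul n x t ht => simp [act_letter_mul, ht, adWord_append, adWord]
  | gen_mul j t ht =>
    rw [act_gen_mul]
    exact map_symm ((eval i v).comp (LinearMap.mulRight k (gen A j * t)))
      (θ := fun w ↦ adWord i w (eval i v (gen A j * t)))
      (fun w ↦ eval_word_mul i v w _) (adWord_swap i _) w

lemma eval_diff (δ : Der B (-1)) (d : ∀ p, A.X p →ₗ[k] A.X (p - 1))
    (hδ : ∀ p a, δ.map p (p - 1) (by lia) (i.map p a) = i.map (p - 1) (d p a))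
    (hv : ∀ j, δ.map (deg j) (deg j - 1) (by lia) (v j) = 0) (t : Words A J) :
    eval i v (diff deg d t) = δ.total (eval i v t) := by
  induction t using induction with
  | one => simp
  | add s t hs ht => simp only [_root_.map_add, hs, ht]
  | smul c t ht => simp only [_root_.map_smul, ht]
  | letter_mul n x t ht =>
    rw [eval_letter_mul, δ.total_adjoint (show n + -1 = n - 1 by lia), hδ, ← ht]
    simp [add_comm]
  | gen_mul j t ht =>
    rw [eval_gen_mul, _root_.map_add, _root_.map_smul,
      δ.total_adjoint (show deg j + -1 = deg j - 1 by lia),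
      δ.total_single (show deg j + -1 = deg j - 1 by lia), hv, ← ht]
    simp [aug_twistedDer]

lemma eval_map {X Y : GrLieAlgebra k} (iY : Hom X Y) (f : Hom A X) (F : Hom B Y)
    (hF : F.comp i = iY.comp f) (t : Words A J) (n : ℤ) :
    F.map n (eval i v t n) = eval iY (fun j ↦ F.map _ (v j)) (map f.map t) n := by
  have hF' (p : ℤ) (a : A.X p) : F.map p (i.map p a) = iY.map p (f.map p a) := congr($(hF).map p a)
  induction t using induction generalizing n with
  | one => simp
  | add s t hs ht => simp [hs, ht]
  | smul c t ht => simp [ht]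
  | letter_mul m x t ht =>
    rw [eval_letter_mul, map_letter_mul, eval_letter_mul, adjoint_apply B _ _ (add_sub_cancel m n),
      adjoint_apply Y _ _ (add_sub_cancel m n), F.map_bracket, ht, hF']
  | gen_mul j t ht =>
    rw [eval_gen_mul, map_gen_mul, eval_gen_mul, Pi.add_apply, Pi.add_apply,
      adjoint_apply B _ _ (add_sub_cancel (deg j) n),
      adjoint_apply Y _ _ (add_sub_cancel (deg j) n), _root_.map_add, F.map_bracket, ht, aug_map,
      Pi.smul_apply, Pi.smul_apply, _root_.map_smul]
    congr 2
    by_cases hn : n = deg j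
    · subst hn; simp
    · simp [Pi.single_eq_of_ne hn]

end Eval

section Representation

variable [CharZero k] {A B : GrLieAlgebra k} {i : Hom A B} {J : Type u} {deg : J → ℤ}
  {v : ∀ j, B.X (deg j)}

/-- The representation of a free extension `B` of `A` on words: `A` acts by symmetrization, and the
generators act by multiplication. -/
structure IsRepresentation (i : Hom A B) (v : ∀ j, B.X (deg j))
    (ρ : Hom B (endomorphisms (Words A J))) : Prop where
  base (p : ℤ) (a : A.X p) (t : Words A J) : ρ.map p (i.map p a) t = (act t).1 [⟨p, a⟩]
  gen (j : J) (t : Words A J) : ρ.map (deg j) (v j) t = gen A j * t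

lemma exists_isRepresentation (hB : IsFree i deg v) :
    ∃ ρ : Hom B (endomorphisms (Words A J)), IsRepresentation i v ρ := by
  let φ : Hom A (endomorphisms (Words A J)) :=
    { map p :=
        { toFun a :=
            { toFun t := (act t).1 [⟨p, a⟩]
              map_add' s t := by simp
              map_smul' c t := by simp }
          map_add' a b := LinearMap.ext fun t ↦ ((act t).2 [] p []).map_add a b
          map_smul' c a := LinearMap.ext fun t ↦ ((act t).2 [] p []).map_smul c a }
      map_bracket p q n h a b := LinearMap.ext fun t ↦ by
        have h1 := act_swap t 2 [] ⟨p, a⟩ ⟨q, b⟩ [] rfl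
        simp [act_act, mk_bracket]
        simp at h1
        rw [h1]
        abel }
  obtain ⟨ρ, h₁, h₂⟩ := hB.exists_desc _ φ (fun j ↦ LinearMap.mulLeft k (gen A j))
  exact ⟨ρ, fun p a t ↦ congr($(h₁).map p a t), fun j t ↦ congr($(h₂ j) t)⟩

variable (hB : IsFree i deg v) {ρ : Hom B (endomorphisms (Words A J))}
  (hρ : IsRepresentation i v ρ)

include hB hρ

lemma aug_representation (p : ℤ) (x : B.X p) : ∀ t, aug (ρ.map p x t) = 0 := by
  induction p, x using hB.induction with
  | add p x y hx hy => intro t; simp [hx, hy]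
  | smul p c x hx => intro t; simp [hx]
  | bracket p q n h x y hx hy => intro t; simp [ρ.map_bracket, hx, hy]
  | base p a => intro t; rw [hρ.base]; exact aug_act_cons t _ []
  | gen j => intro t; rw [hρ.gen, aug_gen_mul]

/-- Let `D` be the derivation which multiplies by the number of generators. Then the evaluation of
`x • 1` is `D x`, so that an element of positive weight can be recovered from its action on words.
-/
lemma eval_representation (D : Der B 0) (hD : ∀ p a, D.map p p (add_zero p) (i.map p a) = 0)
    (hv : ∀ j, D.map (deg j) (deg j) (add_zero _) (v j) = v j) (p : ℤ) (x : B.X p) :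
    ∀ t, eval i v (ρ.map p x t) = B.adjoint.map p x (eval i v t) +
      aug t • LinearMap.single k B.X p (D.map p p (add_zero p) x) := by
  induction p, x using hB.induction with
  | add p x y hx hy =>
    intro t
    simp only [_root_.map_add, LinearMap.add_apply, hx, hy, smul_add]
    abel
  | smul p c x hx =>
    intro t
    simp only [_root_.map_smul, LinearMap.smul_apply, hx, smul_add]
    rw [smul_comm]
  | bracket p q n h x y hx hy =>
    intro t
    rw [D.map_bracket p q n p q n h (add_zero _) (add_zero _) (add_zero _), ρ.map_bracket,
      B.adjoint.map_bracket]
    simp only [LinearMap.mk₂_apply, LinearMap.sub_apply, Module.End.mul_apply,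
      LinearMap.smul_apply, _root_.map_sub, _root_.map_smul, hx, hy, aug_representation hB hρ,
      zero_smul, add_zero, koszul_zero_left, one_smul, _root_.map_add, adjoint_single B h,
      adjoint_single B (show q + p = n by lia), B.antisymm p q n h (D.map p p _ x) y]
    module
  | base p a =>
    intro t
    rw [hρ.base, hD, eval_act]
    simp [adWord]
  | gen j =>
    intro t
    rw [hρ.gen, hv, eval_gen_mul]

/-- The representation on words is compatible with the derivation `δ` which extends the differential
of `A` and vanishes on the generators. -/
lemma diff_representation (d : ∀ p, A.X p →ₗ[k] A.X (p - 1))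
    (hd : ∀ p q n h x y, d n (A.bracket p q n h x y) =
      A.bracket (p - 1) q (n - 1) (by lia) (d p x) y +
        koszul k 1 p • A.bracket p (q - 1) (n - 1) (by lia) x (d q y)) (δ : Der B (-1))
    (hδ : ∀ p a, δ.map p (p - 1) (by lia) (i.map p a) = i.map (p - 1) (d p a))
    (hv : ∀ j, δ.map (deg j) (deg j - 1) (by lia) (v j) = 0) (p : ℤ) (x : B.X p) :
    ∀ t, diff deg d (ρ.map p x t) = ρ.map (p - 1) (δ.map p (p - 1) (by lia) x) t +
      koszul k 1 p • ρ.map p x (diff deg d t) := by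
  induction p, x using hB.induction with
  | add p x y hx hy =>
    intro t
    simp only [_root_.map_add, LinearMap.add_apply, hx, hy, smul_add]
    abel
  | smul p c x hx =>
    intro t
    simp only [_root_.map_smul, LinearMap.smul_apply, hx, smul_add]
    rw [smul_comm]
  | bracket p q n h x y hx hy =>
    intro t
    rw [δ.map_bracket p q n (p - 1) (q - 1) (n - 1) h (by lia) (by lia) (by lia), ρ.map_bracket,
      _root_.map_add, _root_.map_smul, ρ.map_bracket, ρ.map_bracket]
    subst h
    simp only [LinearMap.mk₂_apply, LinearMap.sub_apply, Module.End.mul_apply, LinearMap.add_apply,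
      LinearMap.smul_apply, _root_.map_sub, _root_.map_smul, hx, hy, smul_add, _root_.map_add]
    simp only [koszul_neg_left, koszul_sub_left, koszul_sub_right, koszul_add_right,
      koszul_comm p 1]
    rcases koszul_eq_one_or (k := k) p q with e1 | e1 <;>
    rcases koszul_eq_one_or (k := k) 1 p with e2 | e2 <;>
    rcases koszul_eq_one_or (k := k) 1 q with e3 | e3 <;>
    simp only [e1, e2, e3] <;> module
  | base p a =>
    intro t
    rw [hρ.base, hρ.base, hδ, hρ.base, diff_act deg d hd]
    simp [diffSum, Letter.deg, Letter.diff]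
  | gen j =>
    intro t
    rw [hρ.gen, hρ.gen, hv, twistedDer_gen_mul]
    simp

/-- The representation on words is natural in the free extension. -/
lemma map_representation {X Y : GrLieAlgebra k} {iY : Hom X Y} {f : Hom A X} {F : Hom B Y}
    (hF : F.comp i = iY.comp f) {ρ' : Hom Y (endomorphisms (Words X J))}
    (hρ' : IsRepresentation iY (fun j ↦ F.map _ (v j)) ρ') (p : ℤ) (x : B.X p) :
    ∀ t, map f.map (ρ.map p x t) = ρ'.map p (F.map p x) (map f.map t) := by
  have hF' (p : ℤ) (a : A.X p) : F.map p (i.map p a) = iY.map p (f.map p a) := congr($(hF).map p a)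
  induction p, x using hB.induction with
  | add p x y hx hy => intro t; simp [hx, hy]
  | smul p c x hx => intro t; simp [hx]
  | bracket p q n h x y hx hy =>
    intro t
    simp [ρ.map_bracket, F.map_bracket, ρ'.map_bracket, hx, hy]
  | base p a =>
    intro t
    rw [hρ.base, hF', hρ'.base, map_act]
    rfl
  | gen j =>
    intro t
    rw [hρ.gen, hρ'.gen, map_gen_mul]

end Representation

end Words

/-- Let `B` and `Y` be free extensions of `A` and `X` on the same generators, and let `f : A → X` be
a morphism whose kernel has a contraction `h`, where `q = 1 - d h - h d` factors through `f`. For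
the derivation `δ` of `B` which extends the
differential of `A` and vanishes on the generators, and for a `δ`-cycle `x` in the kernel of
`B → Y`, the element `D x` is a boundary in this kernel. It is the boundary of the evaluation of
the element `h • x` in the words, where the contraction is a twisted derivation. -/
lemma IsFree.exists_primitive [CharZero k] {A B X Y : GrLieAlgebra k} {i : Hom A B} {iY : Hom X Y}
    {f : Hom A X} {F : Hom B Y} (hF : F.comp i = iY.comp f) {J : Type u} {deg : J → ℤ}
    {v : ∀ j, B.X (deg j)} (hB : IsFree i deg v) (hY : IsFree iY deg (fun j ↦ F.map _ (v j)))
    (d : ∀ p, A.X p →ₗ[k] A.X (p - 1))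
    (hd : ∀ p q n h x y, d n (A.bracket p q n h x y) =
      A.bracket (p - 1) q (n - 1) (by lia) (d p x) y +
        koszul k 1 p • A.bracket p (q - 1) (n - 1) (by lia) x (d q y))
    (δ : Der B (-1))
    (hδ : ∀ p a, δ.map p (p - 1) (by lia) (i.map p a) = i.map (p - 1) (d p a))
    (hδv : ∀ j, δ.map (deg j) (deg j - 1) (by lia) (v j) = 0)
    (D : Der B 0) (hD : ∀ p a, D.map p p (add_zero p) (i.map p a) = 0)
    (hDv : ∀ j, D.map (deg j) (deg j) (add_zero _) (v j) = v j)
    (h : ∀ p, A.X p →ₗ[k] A.X (p + 1)) (q : ∀ p, A.X p →ₗ[k] A.X p)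
    (s : ∀ p, X.X p →ₗ[k] A.X p) (hs : ∀ p x, s p (f.map p x) = q p x)
    (hfh : ∀ p x, f.map (p + 1) (h p x) = 0)
    (hdq : ∀ p x, d p (q p x) = q (p - 1) (d p x))
    (hdh : ∀ (p : ℤ) (x : A.X p), A.castₗ (by lia : p + 1 - 1 = p) (d (p + 1) (h p x)) +
      A.castₗ (by lia : p - 1 + 1 = p) (h (p - 1) (d p x)) + q p x = x)
    (p : ℤ) (x : B.X p) (hx : F.map p x = 0) (hx' : δ.map p (p - 1) (by lia) x = 0) :
    ∃ y : B.X (p + 1), F.map (p + 1) y = 0 ∧ δ.map (p + 1) p (by lia) y =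
      D.map p p (add_zero p) x := by
  obtain ⟨ρ, hρ⟩ := Words.exists_isRepresentation hB
  obtain ⟨ρ', hρ'⟩ := Words.exists_isRepresentation hY
  let t := ρ.map p x 1
  have ht : Words.diff deg d t = 0 := by
    rw [Words.diff_representation hB hρ d hd δ hδ hδv, hx']
    simp
  have ht' : Words.map f.map t = 0 := by
    rw [Words.map_representation hB hρ hF hρ', hx]
    simp
  have hq : Words.map q t = 0 := by
    have : (Words.map s).comp (Words.map f.map) = Words.map (J := J) q :=
      Words.linearMap_ext (by simp) (fun n x t ht ↦ by simp at ht ⊢; rw [ht, hs])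
        (fun j t ht ↦ by simp at ht ⊢; exact Or.inl ht)
    rw [← this, LinearMap.comp_apply, ht', map_zero]
  have key := Words.diff_homotopy deg q d h hdq hdh t
  rw [ht, hq, map_zero, add_zero, add_zero] at key
  refine ⟨Words.eval i v (Words.twistedDer deg q h t) (p + 1), ?_, ?_⟩
  · rw [Words.eval_map i v iY f F hF, Words.map_twistedDer_eq_zero]
    · simp
    · exact hfh
  · rw [← δ.total_apply, ← Words.eval_diff i v δ d hδ hδv, key,
      Words.eval_representation hB hρ D hD hDv]
    simp

end GrLieAlgebra

/-! ### Linear algebra -/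

section LinearAlgebra

variable {k V W : Type*} [Field k] [AddCommGroup V] [Module k V] [AddCommGroup W] [Module k W]

/-- A linear map which maps `K` onto a subspace containing `S` has, over `S`, a linear section with
values in `K`; this section is extended to the whole space. -/
lemma LinearMap.exists_section_on (D : V →ₗ[k] W) (K : Submodule k V) (S : Submodule k W)
    (h : ∀ x ∈ S, ∃ y ∈ K, D y = x) :
    ∃ σ : W →ₗ[k] V, (∀ w, σ w ∈ K) ∧ ∀ x ∈ S, D (σ x) = x := by
  let T : Submodule k V := K ⊓ S.comap D
  let D' : T →ₗ[k] S := (D.comp T.subtype).codRestrict S (fun x ↦ x.2.2)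
  have hD' : Function.Surjective D' := fun x ↦ by
    obtain ⟨y, hy, hy'⟩ := h x.1 x.2
    exact ⟨⟨y, hy, by simp [hy']⟩, Subtype.ext hy'⟩
  obtain ⟨r, hr⟩ := D'.exists_rightInverse_of_surjective (LinearMap.range_eq_top.2 hD')
  obtain ⟨π, hπ⟩ := S.subtype.exists_leftInverse_of_injective (by simp)
  refine ⟨T.subtype.comp (r.comp π), fun w ↦ (r (π w)).2.1, fun x hx ↦ ?_⟩
  have h1 : π x = ⟨x, hx⟩ := DFunLike.congr_fun hπ ⟨x, hx⟩
  have h2 := congr_arg Subtype.val (DFunLike.congr_fun hr ⟨x, hx⟩)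
  simpa [h1] using! h2

lemma Module.End.aeval_of_apply_eq_smul {D : Module.End k V} {z : V} {c : k} (h : D z = c • z)
    (P : Polynomial k) : Polynomial.aeval D P z = P.eval c • z := by
  induction P using Polynomial.induction_on' with
  | add p q hp hq => simp [hp, hq, add_smul]
  | monomial n a =>
    have : (D ^ n) z = c ^ n • z := by
      induction n with
      | zero => simp
      | succ n ih => rw [pow_succ, Module.End.mul_apply, h, map_smul, ih, smul_smul, pow_succ']
    simp [Polynomial.aeval_monomial, this, smul_smul, mul_comm]

lemma Module.End.map_aeval {L : V →ₗ[k] W} {D : Module.End k V} {D' : Module.End k W}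
    (h : ∀ x, L (D x) = D' (L x)) (P : Polynomial k) (x : V) :
    L (Polynomial.aeval D P x) = Polynomial.aeval D' P (L x) := by
  induction P using Polynomial.induction_on' with
  | add p q hp hq => simp [hp, hq]
  | monomial n a =>
    have : L ((D ^ n) x) = (D' ^ n) (L x) := by
      induction n with
      | zero => simp
      | succ n ih => rw [pow_succ', Module.End.mul_apply, h, ih, pow_succ', Module.End.mul_apply]
    simp [Polynomial.aeval_monomial, this]

lemma descPochhammer_eval_neg_one_ne_zero [CharZero k] (n : ℕ) :
    (descPochhammer k n).eval (-1) ≠ 0 := by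
  induction n with
  | zero => simp
  | succ n ih =>
    rw [descPochhammer_succ_right, Polynomial.eval_mul]
    refine mul_ne_zero ih ?_
    simp only [Polynomial.eval_sub, Polynomial.eval_X, Polynomial.eval_natCast]
    have : (n + 1 : k) ≠ 0 := Nat.cast_add_one_ne_zero n
    intro h
    exact this (by linear_combination -h)

end LinearAlgebra

/-! ### The weight of an element of a free extension -/

namespace GrLieAlgebra

variable {k : Type u} [Field k]

/-- The difference of two derivations. -/
def Der.sub {G : GrLieAlgebra k} {r : ℤ} (P Q : Der G r) : Der G r where
  map p q h := P.map p q h - Q.map p q h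
  map_bracket p q n p' q' n' h hp hq hn x y := by
    simp only [LinearMap.sub_apply, P.map_bracket p q n p' q' n' h hp hq hn,
      Q.map_bracket p q n p' q' n' h hp hq hn, map_sub]
    module

section Weight

variable {A B : GrLieAlgebra k} {i : Hom A B} {J : Type u} {deg : J → ℤ}
  {v : ∀ j, B.X (deg j)} (hB : IsFree i deg v) (D : Der B 0)
  (hD : ∀ p a, D.map p p (add_zero p) (i.map p a) = 0)
  (hDv : ∀ j, D.map (deg j) (deg j) (add_zero _) (v j) = v j)

/-- A derivation of degree `0`, on a component. -/
abbrev Der.op (D : Der B 0) (p : ℤ) : Module.End k (B.X p) := D.map p p (add_zero p)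

lemma Der.op_bracket (p q n : ℤ) (h : p + q = n) (x : B.X p) (y : B.X q) :
    D.op n (B.bracket p q n h x y) =
      B.bracket p q n h (D.op p x) y + B.bracket p q n h x (D.op q y) := by
  simpa using D.map_bracket p q n p q n h (add_zero _) (add_zero _) (add_zero _) x y

include hB hD hDv

/-- A free extension is spanned by the eigenvectors of the derivation `D` which vanishes on `A` and
is the identity on the generators; the eigenvalue, the weight, is the number of generators. -/
lemma IsFree.mem_span_eigenvectors (p : ℤ) (x : B.X p) :
    x ∈ Submodule.span k
      {z : B.X p | ∃ n : ℕ, D.op p z = (n : k) • z ∧ (n = 0 → z ∈ LinearMap.range (i.map p))} := by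
  refine hB.mem_of_bracket_mem (fun p ↦ Submodule.span k
    {z : B.X p | ∃ n : ℕ, D.op p z = (n : k) • z ∧ (n = 0 → z ∈ LinearMap.range (i.map p))})
    (fun p q n h x hx y hy ↦ ?_) (fun p a ↦ ?_) (fun j ↦ ?_) p x
  · induction hx using Submodule.span_induction with
    | zero => simp
    | add x x' _ _ hx hx' => simpa using add_mem hx hx'
    | smul c x _ hx => simpa using Submodule.smul_mem _ c hx
    | mem x hx =>
      induction hy using Submodule.span_induction with
      | zero => simp
      | add y y' _ _ hy hy' => simpa using add_mem hy hy'
      | smul c y _ hy => simpa using Submodule.smul_mem _ c hy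
      | mem y hy =>
        obtain ⟨m, hm, hm'⟩ := hx
        obtain ⟨m', hn, hn'⟩ := hy
        refine Submodule.subset_span ⟨m + m', ?_, fun h0 ↦ ?_⟩
        · rw [D.op_bracket, hm, hn]
          simp [add_smul]
        · obtain ⟨a, rfl⟩ := hm' (by lia)
          obtain ⟨b, rfl⟩ := hn' (by lia)
          exact ⟨_, i.map_bracket p q n h a b⟩
  · exact Submodule.subset_span ⟨0, by simpa using hD p a, fun _ ↦ ⟨a, rfl⟩⟩
  · exact Submodule.subset_span ⟨1, by simpa using hDv j, by simp⟩

/-- Every element is the sum of an element of `A` and of a sum of elements of positive, bounded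
weights. The latter is expressed by a polynomial in `D` with roots `1, …, m`. -/
lemma IsFree.exists_decomposition (p : ℤ) (x : B.X p) :
    ∃ (a : A.X p) (m₀ : ℕ), ∀ m, m₀ ≤ m → Polynomial.aeval (D.op p)
      ((descPochhammer k m).comp (Polynomial.X - 1)) (x - i.map p a) = 0 := by
  induction hB.mem_span_eigenvectors D hD hDv p x using Submodule.span_induction with
  | zero => exact ⟨0, 0, by simp⟩
  | add x y _ _ hx hy =>
    obtain ⟨a, m, hm⟩ := hx
    obtain ⟨b, n, hn⟩ := hy
    refine ⟨a + b, max m n, fun l hl ↦ ?_⟩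
    rw [show x + y - i.map p (a + b) = (x - i.map p a) + (y - i.map p b) by
      rw [map_add]; abel, map_add, hm l (by lia), hn l (by lia), add_zero]
  | smul c x _ hx =>
    obtain ⟨a, m, hm⟩ := hx
    refine ⟨c • a, m, fun l hl ↦ ?_⟩
    rw [map_smul, ← smul_sub, map_smul, hm l hl, smul_zero]
  | mem z hz =>
    obtain ⟨n, hn, hn'⟩ := hz
    obtain _ | n := n
    · obtain ⟨a, rfl⟩ := hn' rfl
      exact ⟨a, 0, by simp⟩
    · refine ⟨0, n + 1, fun m hm ↦ ?_⟩
      rw [map_zero, sub_zero, Module.End.aeval_of_apply_eq_smul hn]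
      have : (Polynomial.eval (n : k) (descPochhammer k m)) = 0 := by
        rw [descPochhammer_eval_eq_descFactorial, Nat.descFactorial_of_lt (by lia), Nat.cast_zero]
      simp [this]

/-- The weights of an element are bounded. -/
lemma IsFree.exists_descPochhammer_eq_zero (p : ℤ) (x : B.X p) :
    ∃ m₀ : ℕ, ∀ m, m₀ ≤ m → Polynomial.aeval (D.op p) (descPochhammer k (m + 1)) x = 0 := by
  obtain ⟨a, m₀, h⟩ := hB.exists_decomposition D hD hDv p x
  refine ⟨m₀, fun m hm ↦ ?_⟩
  have h1 : Polynomial.aeval (D.op p) (descPochhammer k (m + 1)) (x - i.map p a) = 0 := by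
    rw [descPochhammer_succ_left, map_mul, Module.End.mul_apply, h m hm, map_zero]
  have h2 : Polynomial.aeval (D.op p) (descPochhammer k (m + 1)) (i.map p a) = 0 := by
    rw [Module.End.aeval_of_apply_eq_smul (c := 0) (by simpa using hD p a)]
    simp [descPochhammer_succ_left]
  simpa [h2] using h1

/-- The elements of weight `0` come from `A`. -/
lemma IsFree.exists_of_op_eq_zero [CharZero k] (p : ℤ) (x : B.X p) (hx : D.op p x = 0) :
    ∃ a, i.map p a = x := by
  obtain ⟨a, m, hm⟩ := hB.exists_decomposition D hD hDv p x
  refine ⟨a, ?_⟩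
  have h := hm m le_rfl
  rw [Module.End.aeval_of_apply_eq_smul (c := 0) (by rw [map_sub, hx, hD]; simp)] at h
  have := descPochhammer_eval_neg_one_ne_zero (k := k) m
  simp only [Polynomial.eval_comp, Polynomial.eval_sub, Polynomial.eval_X, Polynomial.eval_one,
    zero_sub] at h
  exact (sub_eq_zero.1 ((smul_eq_zero.1 h).resolve_left this)).symm

end Weight

end GrLieAlgebra

/-! ### Acyclicity of the kernel of a cobase change along a cell attachment -/

namespace GrLieAlgebra

lemma castₗ_apply_family {k : Type u} [Field k] (G : GrLieAlgebra k) {p q : ℤ} (h : p = q)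
    (φ : ∀ n, n = q → G.X n) : G.castₗ h (φ p h) = φ q rfl := by
  subst h; rfl

section Filtration

variable {k : Type u} [Field k] {A B Y : GrLieAlgebra k} {i : Hom A B} {J : Type u} {deg : J → ℤ}
  {v : ∀ j, B.X (deg j)} (hB : IsFree i deg v)

include hB

/-- `A` is a retract of `B`, by the projection which kills the generators. -/
lemma IsFree.eq_zero_of_map_eq_zero (p : ℤ) (x : A.X p) (hx : i.map p x = 0) : x = 0 := by
  obtain ⟨r, hr, -⟩ := hB.exists_desc A (Hom.id _) (fun _ ↦ 0)
  have : r.map p (i.map p x) = x := congr($(hr).map p x)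
  rw [← this, hx, map_zero]

lemma IsFree.map_op {D : Der B 0} {D' : Der Y 0} {F : Hom B Y}
    (hi : ∀ p a, F.map p (D.op p (i.map p a)) = D'.op p (F.map p (i.map p a)))
    (hv : ∀ j, F.map _ (D.op _ (v j)) = D'.op _ (F.map _ (v j))) (p : ℤ) (x : B.X p) :
    F.map p (D.op p x) = D'.op p (F.map p x) := by
  induction p, x using hB.induction with
  | add p x y hx hy => rw [map_add, map_add, map_add, map_add, hx, hy]
  | smul p c x hx => rw [map_smul, map_smul, map_smul, map_smul, hx]
  | bracket p q n h x y hx hy =>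
    rw [D.op_bracket, map_add, F.map_bracket, F.map_bracket, F.map_bracket, D'.op_bracket, hx, hy]
  | base p a => exact hi p a
  | gen j => exact hv j

/-- A derivation `P` which lowers the weight by `c` satisfies `P (D - c) = D P`; it suffices to
check this on generators. -/
lemma IsFree.der_op {D : Der B 0} {r : ℤ} {P : Der B r} (c : k)
    (hi : ∀ p q h a, P.map p q h (D.op p (i.map p a)) - c • P.map p q h (i.map p a) =
      D.op q (P.map p q h (i.map p a)))
    (hv : ∀ j q h, P.map _ q h (D.op _ (v j)) - c • P.map _ q h (v j) =
      D.op q (P.map _ q h (v j))) (p : ℤ) (x : B.X p) :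
    ∀ q h, P.map p q h ((D.op p - c • 1) x) = D.op q (P.map p q h x) := by
  suffices ∀ q h, P.map p q h (D.op p x) - c • P.map p q h x = D.op q (P.map p q h x) by
    intro q h
    rw [← this q h]
    simp
  induction p, x using hB.induction with
  | add p x y hx hy =>
    intro q h
    rw [map_add, map_add, map_add, map_add, ← hx, ← hy]
    module
  | smul p c' x hx =>
    intro q h
    rw [map_smul, map_smul, map_smul, map_smul, ← hx]
    module
  | bracket p q n h x y hx hy =>
    intro n' hn
    rw [D.op_bracket, map_add,
      P.map_bracket p q n (p + r) (q + r) n' h rfl rfl hn,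
      P.map_bracket p q n (p + r) (q + r) n' h rfl rfl hn,
      P.map_bracket p q n (p + r) (q + r) n' h rfl rfl hn,
      map_add, map_smul, D.op_bracket, D.op_bracket, ← hx, ← hy, map_sub, map_sub, map_smul,
      map_smul, LinearMap.sub_apply, LinearMap.smul_apply]
    module
  | base p a => exact fun q h ↦ hi p q h a
  | gen j => exact fun q h ↦ hv j q h

/-- If a differential `δ + θ` on a free extension `B` of `A` is the sum of a derivation `δ` which
preserves the weight, and of a derivation `θ` which lowers it by one, then the acyclicity of the
kernel of `F` follows from the part of weight `0` and from `δ`-acyclicity in positive weights. -/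
lemma IsFree.acyclic_of_weight [CharZero k] {D : Der B 0}
    (hD : ∀ p a, D.map p p (add_zero p) (i.map p a) = 0)
    (hDv : ∀ j, D.map (deg j) (deg j) (add_zero _) (v j) = v j) {D' : Der Y 0} {F : Hom B Y}
    (hFD : ∀ p x, F.map p (D.op p x) = D'.op p (F.map p x)) {d δ θ : Der B (-1)}
    (hd : ∀ p q h x, d.map p q h x = δ.map p q h x + θ.map p q h x)
    (hδD : ∀ p q h x, δ.map p q h (D.op p x) = D.op q (δ.map p q h x))
    (hθD : ∀ p q h x, θ.map p q h ((D.op p - 1) x) = D.op q (θ.map p q h x))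
    (hθ : ∀ p q h a, θ.map p q h (i.map p a) = 0)
    (hdd : ∀ p q r h h' x, d.map q r h' (d.map p q h x) = 0)
    (hFd : ∀ p q h x, F.map p x = 0 → F.map q (d.map p q h x) = 0)
    (hbase : ∀ p q r h h' a, F.map p (i.map p a) = 0 → d.map p r h' (i.map p a) = 0 →
      ∃ y, F.map q y = 0 ∧ d.map q p h y = i.map p a)
    (hδ : ∀ p q r h h' x, F.map p x = 0 → δ.map p r h' x = 0 →
      ∃ y, F.map q y = 0 ∧ δ.map q p h y = D.op p x)
    (p q r : ℤ) (h : q + -1 = p) (h' : p + -1 = r) (x : B.X p) (hx : F.map p x = 0)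
    (hdx : d.map p r h' x = 0) : ∃ y, F.map q y = 0 ∧ d.map q p h y = x := by
  -- induction on a bound `m` of the weights of `x`
  obtain ⟨m, hm⟩ : ∃ m, Polynomial.aeval (D.op p) (descPochhammer k m) x = 0 := by
    obtain ⟨m, hm⟩ := hB.exists_descPochhammer_eq_zero D hD hDv p x
    exact ⟨m + 1, hm m le_rfl⟩
  induction m generalizing x with
  | zero => exact ⟨0, by simp, by simpa using hm.symm⟩
  | succ m ih =>
    obtain rfl | hm0 := Nat.eq_zero_or_pos m
    · obtain ⟨b, rfl⟩ := hB.exists_of_op_eq_zero D hD hDv p x (by simpa using hm)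
      exact hbase p q r h h' b hx hdx
    · let c : k := m.factorial
      have hc : c ≠ 0 := Nat.cast_ne_zero.2 m.factorial_ne_zero
      have hc' : (descPochhammer k m).eval (m : k) = c := by
        rw [descPochhammer_eval_eq_descFactorial, Nat.descFactorial_self]
      have hm1 : (m : k) ≠ 0 := by exact_mod_cast hm0.ne'
      -- the component of `x` of weight `m`
      obtain ⟨z, hz'⟩ : ∃ z, z = c⁻¹ • Polynomial.aeval (D.op p) (descPochhammer k m) x := ⟨_, rfl⟩
      have hz : D.op p z = (m : k) • z := by
        have h1 : Polynomial.aeval (D.op p)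
            ((Polynomial.X - (m : Polynomial k)) * descPochhammer k m) x = 0 := by
          rw [mul_comm, ← descPochhammer_succ_right, hm]
        rw [map_mul, map_sub, Polynomial.aeval_X, map_natCast, Module.End.mul_apply,
          LinearMap.sub_apply, sub_eq_zero] at h1
        rw [hz', map_smul, h1, smul_comm, Nat.cast_smul_eq_nsmul]
        simp
      have hFz : F.map p z = 0 := by
        rw [hz', map_smul, Module.End.map_aeval (hFD p), hx, map_zero, smul_zero]
      have hxz : Polynomial.aeval (D.op p) (descPochhammer k m) (x - z) = 0 := by
        rw [map_sub, Module.End.aeval_of_apply_eq_smul hz, hc', hz', smul_smul, mul_inv_cancel₀ hc,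
          one_smul, sub_self]
      -- `δ z` is the component of weight `m` of `d x`, as `θ` lowers weights
      have hδz : δ.map p r h' z = 0 := by
        have h1 : θ.map p r h' (Polynomial.aeval (D.op p - 1) (descPochhammer k m) x) = 0 := by
          have h2 : Polynomial.aeval (D.op p) (Polynomial.X * (descPochhammer k m).comp
            (Polynomial.X - 1)) x = 0 := by rw [← descPochhammer_succ_left, hm]
          rw [map_mul, Polynomial.aeval_X, Module.End.mul_apply, Polynomial.aeval_comp] at h2
          simp only [map_sub, Polynomial.aeval_X, map_one] at h2
          obtain ⟨b, hb⟩ := hB.exists_of_op_eq_zero D hD hDv p _ h2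
          rw [← hb, hθ]
        rw [hz', map_smul, Module.End.map_aeval (hδD p r h'),
          show δ.map p r h' x = -θ.map p r h' x by
            rw [← sub_eq_zero, sub_neg_eq_add, ← hd, hdx], map_neg,
          ← Module.End.map_aeval (hθD p r h'), h1, neg_zero, smul_zero]
      obtain ⟨y₀, hFy₀, hy₀⟩ := hδ p q r h h' z hFz hδz
      -- the component of weight `m` of the primitive; the roots of `R` are all the weights of `y₀`
      -- except `m`
      obtain ⟨M, hM⟩ := hB.exists_descPochhammer_eq_zero D hD hDv q y₀
      obtain ⟨R, hR'⟩ : ∃ R, R = descPochhammer k m *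
        (descPochhammer k M).comp (Polynomial.X - ((m + 1 : ℕ) : Polynomial k)) := ⟨_, rfl⟩
      have hR : R.eval (m : k) ≠ 0 := by
        simp only [hR', Polynomial.eval_mul, Polynomial.eval_comp, hc']
        refine mul_ne_zero hc ?_
        simpa using! descPochhammer_eval_neg_one_ne_zero (k := k) M
      obtain ⟨y, hy'⟩ : ∃ y, y = ((m : k) * R.eval (m : k))⁻¹ •
        Polynomial.aeval (D.op q) R y₀ := ⟨_, rfl⟩
      have hFy : F.map q y = 0 := by
        rw [hy', map_smul, Module.End.map_aeval (hFD _), hFy₀, map_zero, smul_zero]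
      have hδy : δ.map q p h y = z := by
        rw [hy', map_smul, Module.End.map_aeval (hδD q p h), hy₀, hz, map_smul,
          Module.End.aeval_of_apply_eq_smul hz, smul_smul, smul_smul,
          mul_assoc, inv_mul_cancel₀ (mul_ne_zero hm1 hR), one_smul]
      have hy : D.op q y = (m : k) • y := by
        have h1 : Polynomial.aeval (D.op q)
            ((Polynomial.X - (m : Polynomial k)) * R) y₀ = 0 := by
          rw [hR', ← mul_assoc, mul_comm (Polynomial.X - (m : Polynomial k)),
            ← descPochhammer_succ_right, descPochhammer_mul, show m + 1 + M = (m + M) + 1 by omega]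
          exact hM _ (by omega)
        rw [map_mul, map_sub, Polynomial.aeval_X, map_natCast, Module.End.mul_apply,
          LinearMap.sub_apply, sub_eq_zero] at h1
        rw [hy', map_smul, h1, smul_comm, Nat.cast_smul_eq_nsmul]
        simp
      have hθy : D.op p (θ.map q p h y) = ((m - 1 : ℕ) : k) • θ.map q p h y := by
        rw [← hθD, LinearMap.sub_apply, hy, Module.End.one_apply, map_sub, map_smul,
          Nat.cast_sub hm0, Nat.cast_one, sub_smul, one_smul]
      -- the weights of `x - d y` are less than `m`
      obtain ⟨y', hFy', hy'⟩ := ih (x - d.map q p h y)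
        (by rw [map_sub, hx, hFd _ _ _ _ hFy, sub_zero])
        (by rw [map_sub, hdx, hdd, sub_zero])
        (by
          rw [hd, hδy, ← sub_sub, map_sub, hxz,
            Module.End.aeval_of_apply_eq_smul hθy,
            descPochhammer_eval_coe_nat_of_lt (Nat.sub_lt hm0 one_pos)]
          simp)
      exact ⟨y + y', by rw [map_add, hFy, hFy', add_zero], by rw [map_add, hy']; abel⟩

end Filtration

end GrLieAlgebra

namespace DGLieAlgebra

variable {k : Type u} [Field k]

/-- The differential of a dg Lie algebra, as a linear map. -/
abbrev d (L : DGLieAlgebra k) (p q : ℤ) : L.complex.X p →ₗ[k] L.complex.X q :=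
  (L.complex.d p q).hom

/-- The components of a morphism of dg Lie algebras, as linear maps. -/
abbrev app {L M : DGLieAlgebra k} (f : L ⟶ M) (p : ℤ) : L.complex.X p →ₗ[k] M.complex.X p :=
  (f.hom.f p).hom

lemma d_d (L : DGLieAlgebra k) (p q r : ℤ) (x : L.complex.X p) : L.d q r (L.d p q x) = 0 := by
  change (L.complex.d p q ≫ L.complex.d q r).hom x = 0
  rw [L.complex.d_comp_d]
  rfl

lemma app_d {L M : DGLieAlgebra k} (f : L ⟶ M) (p q : ℤ) (x : L.complex.X p) :
    app f q (L.d p q x) = M.d p q (app f p x) := congr($(f.hom.comm p q) x).symm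

lemma app_bracket {L M : DGLieAlgebra k} (f : L ⟶ M) (p q n : ℤ) (h : p + q = n)
    (x : L.complex.X p) (y : L.complex.X q) :
    app f n (L.bracket p q n h x y) = M.bracket p q n h (app f p x) (app f q y) :=
  f.map_bracket p q n h x y

/-- The kernel of a morphism of dg Lie algebras is acyclic. -/
def HasAcyclicKernel {L M : DGLieAlgebra k} (f : L ⟶ M) : Prop :=
  ∀ p (x : L.complex.X p), app f p x = 0 → L.d p (p - 1) x = 0 →
    ∃ y : L.complex.X (p + 1), app f (p + 1) y = 0 ∧ L.d (p + 1) p y = x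

/-- The differential as a derivation. -/
def der (L : DGLieAlgebra k) : GrLieAlgebra.Der L.toGraded (-1) where
  map p q _ := L.d p q
  map_bracket := by
    rintro p q n p' q' n' h hp hq hn x y
    obtain rfl : p' = p - 1 := by lia
    obtain rfl : q' = q - 1 := by lia
    obtain rfl : n' = n - 1 := by lia
    rw [koszul_neg_left, koszul_one_left]
    exact L.leibniz p q n h x y

/-- Over a field, an acyclic kernel is contractible, and a contraction can be extended. -/
lemma HasAcyclicKernel.exists_contraction {A X : DGLieAlgebra k} {f : A ⟶ X}
    (hf : HasAcyclicKernel f) : ∃ h : ∀ p q : ℤ, p + 1 = q → (A.complex.X p →ₗ[k] A.complex.X q),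
      (∀ p q hpq x, app f q (h p q hpq x) = 0) ∧
      ∀ p q r hpq hrp x, app f p x = 0 → A.d q p (h p q hpq x) + h r p hrp (A.d p r x) = x := by
  have h1 (p q : ℤ) (hpq : p + 1 = q) : ∃ σ : A.complex.X p →ₗ[k] A.complex.X q,
      (∀ x, app f q (σ x) = 0) ∧ ∀ x, app f p x = 0 → A.d p (p - 1) x = 0 → A.d q p (σ x) = x := by
    subst hpq
    obtain ⟨σ, h₁, h₂⟩ := LinearMap.exists_section_on (A.d (p + 1) p)
      (LinearMap.ker (app f (p + 1))) (LinearMap.ker (app f p) ⊓ LinearMap.ker (A.d p (p - 1)))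
      (fun x hx ↦ hf p x hx.1 hx.2)
    exact ⟨σ, h₁, fun x hx hx' ↦ h₂ x ⟨hx, hx'⟩⟩
  choose σ hσ hσ' using h1
  have h2 (p : ℤ) : ∃ π : A.complex.X p →ₗ[k] A.complex.X p,
      (∀ x, app f p (π x) = 0) ∧ ∀ x, app f p x = 0 → π x = x := by
    obtain ⟨π, hπ⟩ :=
      (LinearMap.ker (app f p)).subtype.exists_leftInverse_of_injective (by simp)
    exact ⟨(Submodule.subtype _).comp π, fun x ↦ (π x).2,
      fun x hx ↦ congr_arg Subtype.val (DFunLike.congr_fun hπ (⟨x, hx⟩ : LinearMap.ker (app f p)))⟩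
  choose π hπ hπ' using h2
  refine ⟨fun p q hpq ↦ (σ p q hpq).comp
      (π p - (σ (p - 1) p (by lia)).comp ((A.d p (p - 1)).comp (π p))),
    fun p q hpq x ↦ hσ _ _ _ _, fun p q r hpq hrp x hx ↦ ?_⟩
  obtain rfl : r = p - 1 := by lia
  have hdx : app f (p - 1) (A.d p (p - 1) x) = 0 := by rw [app_d, hx, map_zero]
  have e1 := hσ' (p - 1) p hrp (A.d p (p - 1) x) hdx (A.d_d _ _ _ _)
  simp only [LinearMap.comp_apply, LinearMap.sub_apply, hπ' _ x hx, hπ' _ _ hdx, A.d_d]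
  rw [hσ' p q hpq _ (by rw [map_sub, hx, hσ, sub_zero]) (by rw [map_sub, e1, sub_self]), map_zero,
    sub_zero, sub_add_cancel]

/-- Cobase change along a cell attachment preserves surjections with acyclic kernel. The kernel of
`F` is filtered by the number of cells; on the associated graded, the differential becomes the
derivation which vanishes on the cells. -/
theorem IsCellAttachment.hasAcyclicKernel [CharZero k] {A B X Y : DGLieAlgebra k} {i : A ⟶ B}
    {J : Type u} {deg : J → ℤ} {a : ∀ j, A.complex.X (deg j - 1)} {v : ∀ j, B.complex.X (deg j)}
    (hi : IsCellAttachment i deg a v) {iY : X ⟶ Y} {f : A ⟶ X} {F : B ⟶ Y}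
    (comm : i ≫ F = f ≫ iY)
    (hY : GrLieAlgebra.IsFree (Hom.toGraded iY) deg (fun j ↦ app F _ (v j)))
    (hf : HasAcyclicKernel f) (hf' : ∀ p, Function.Surjective (app f p)) :
    HasAcyclicKernel F := by
  have hB := hi.isFree
  have comm' (p : ℤ) (x : A.complex.X p) : app F p (app i p x) = app iY p (app f p x) :=
    congr($(comm).hom.f p x)
  have hF : (Hom.toGraded F).comp (Hom.toGraded i) = (Hom.toGraded iY).comp (Hom.toGraded f) := by
    ext p x
    exact comm' p x
  obtain ⟨h, hh, hh'⟩ := hf.exists_contraction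
  -- `q` vanishes on the kernel of `f`, hence factors through `f`
  let q (p : ℤ) : A.complex.X p →ₗ[k] A.complex.X p :=
    LinearMap.id - (A.d (p + 1) p).comp (h p (p + 1) rfl) -
      (h (p - 1) p (by omega)).comp (A.d p (p - 1))
  have hq (p : ℤ) (x) : q p x = x - A.d (p + 1) p (h p (p + 1) rfl x) -
    h (p - 1) p (by omega) (A.d p (p - 1) x) := rfl
  have hs (p : ℤ) : ∃ s : X.complex.X p →ₗ[k] A.complex.X p, ∀ x, s (app f p x) = q p x := by
    obtain ⟨r, hr⟩ := (app f p).exists_rightInverse_of_surjective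
      (LinearMap.range_eq_top.2 (hf' p))
    refine ⟨(q p).comp r, fun x ↦ ?_⟩
    have h1 : app f p (x - r (app f p x)) = 0 := by
      rw [map_sub, show app f p (r (app f p x)) = app f p x from DFunLike.congr_fun hr _, sub_self]
    have h2 : q p (x - r (app f p x)) = 0 := by
      have := hh' p (p + 1) (p - 1) rfl (by omega) _ h1
      rw [hq]
      nth_rw 1 [← this]
      abel
    rw [map_sub, sub_eq_zero] at h2
    exact h2.symm
  choose s hs using hs
  -- `D` multiplies by the number of cells; `θ` is the part of the differential which replaces a
  -- cell by its boundary in `A`, and `δ` is the rest of it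
  obtain ⟨D, hD, hDv⟩ := hB.exists_der 0 deg (fun _ ↦ add_zero _) v
  obtain ⟨θ, hθ, hθv⟩ := hB.exists_der (-1) (fun j ↦ deg j - 1) (fun _ ↦ rfl)
    (fun j ↦ app i _ (a j))
  obtain ⟨δ, hδ⟩ : ∃ δ : B.toGraded.Der (-1), ∀ p q h x, δ.map p q h x =
    B.d p q x - θ.map p q h x := ⟨B.der.sub θ, fun _ _ _ _ ↦ rfl⟩
  obtain ⟨D', hD', hDv'⟩ := hY.exists_der 0 deg (fun _ ↦ add_zero _) (fun j ↦ app F _ (v j))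
  have hDi (p : ℤ) (a : A.toGraded.X p) : D.op p ((Hom.toGraded i).map p a) = 0 := hD p p _ a
  have hDv₀ (j : J) : D.op (deg j) (v j) = v j := hDv j
  have hFD := hB.map_op (F := Hom.toGraded F) (D := D) (D' := D')
    (fun p a ↦ by
      have h2 := hD' p p (add_zero p) (app f p a)
      have h3 : (Hom.toGraded F).map p ((Hom.toGraded i).map p a) =
        (Hom.toGraded iY).map p (app f p a) := comm' p a
      rw [hDi, map_zero, h3]
      exact h2.symm)
    (fun j ↦ by
      rw [hDv₀]
      exact (hDv' j).symm)
  have hδi (p q : ℤ) (h : p + -1 = q) (a : A.toGraded.X p) :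
      δ.map p q h ((Hom.toGraded i).map p a) = (Hom.toGraded i).map q (A.d p q a) := by
    rw [hδ, hθ, sub_zero]
    exact (app_d i p q a).symm
  have hδv (j : J) : δ.map (deg j) (deg j - 1) rfl (v j) = 0 :=
    (hδ _ _ _ _).trans (sub_eq_zero.2 ((hi.d_v j).trans (hθv j).symm))
  have hδD := hB.der_op (D := D) (P := δ) 0
    (fun p q h a ↦ by rw [hDi, hδi, hDi, map_zero, zero_smul, sub_zero])
    (fun j q h ↦ by
      obtain rfl : q = deg j - 1 := by omega
      rw [hDv₀, hδv, map_zero, smul_zero, sub_zero])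
  have hθD := hB.der_op (D := D) (P := θ) 1
    (fun p q h a ↦ by rw [hDi, hθ, map_zero, smul_zero, sub_zero, map_zero])
    (fun j q h ↦ by
      obtain rfl : q = deg j - 1 := by omega
      rw [hDv₀, hθv, one_smul, sub_self]
      exact (hDi _ (a j)).symm)
  simp only [zero_smul, sub_zero, one_smul] at hδD hθD
  have hbase (p q r : ℤ) (h : q + -1 = p) (h' : p + -1 = r) (b : A.complex.X p)
      (hb : app F p (app i p b) = 0) (hdb : B.d p r (app i p b) = 0) :
      ∃ y, app F q y = 0 ∧ B.d q p y = app i p b := by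
    obtain rfl : q = p + 1 := by omega
    obtain rfl : r = p - 1 := by omega
    rw [comm'] at hb
    rw [← app_d] at hdb
    obtain ⟨y, hy, hy'⟩ := hf p b (hY.eq_zero_of_map_eq_zero _ _ hb)
      (hB.eq_zero_of_map_eq_zero _ _ hdb)
    exact ⟨app i _ y, by rw [comm', hy, map_zero], by rw [← app_d, hy']⟩
  have hprim (p q' r : ℤ) (hpq : q' + -1 = p) (hpr : p + -1 = r) (x : B.toGraded.X p)
      (hx : app F p x = 0) (hδx : δ.map p r hpr x = 0) :
      ∃ y, app F q' y = 0 ∧ δ.map q' p hpq y = D.op p x := by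
    obtain rfl : q' = p + 1 := by omega
    obtain rfl : r = p - 1 := by omega
    refine GrLieAlgebra.IsFree.exists_primitive hF hB hY
      (fun p ↦ A.d p (p - 1))
      (fun p q n h x y ↦ by
        rw [koszul_one_left]
        exact A.leibniz p q n h x y) δ (fun p ↦ hδi p _ _) hδv D (fun p ↦ hD p p _) hDv
      (fun p ↦ h p (p + 1) rfl) q s hs
      (fun p x ↦ hh _ _ _ _)
      (fun p x ↦ ?_)
      (fun p x ↦ ?_)
      p x hx hδx
    · have e (n : ℤ) (hn : p - 1 + 1 = n) : A.d n (p - 1) (h (p - 1) n hn (A.d p (p - 1) x)) =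
          A.d (p - 1 + 1) (p - 1) (h (p - 1) (p - 1 + 1) rfl (A.d p (p - 1) x)) := by
        subst hn; rfl
      rw [hq, hq, map_sub, map_sub, A.d_d, A.d_d, map_zero, sub_zero, sub_zero, e]
    · have e1 := A.toGraded.castₗ_apply_family (show p + 1 - 1 = p by omega)
        (fun n _ ↦ A.d (p + 1) n (h p (p + 1) rfl x))
      have e2 := A.toGraded.castₗ_apply_family (show p - 1 + 1 = p by omega)
        (fun n hn ↦ h (p - 1) n (by omega) (A.d p (p - 1) x))
      rw [e1, e2, hq]
      abel
  exact fun p x hx hdx ↦ hB.acyclic_of_weight (d := B.der) (fun p ↦ hD p p _) hDv hFD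
    (fun p q h x ↦ by rw [hδ, sub_add_cancel]; rfl)
    (fun p q h x ↦ hδD p x q h) (fun p q h x ↦ hθD p x q h) hθ
    (fun p q r _ _ x ↦ B.d_d p q r x)
    (fun p q h x hx ↦ (app_d F p q x).trans ((congr_arg _ hx).trans (map_zero _)))
    hbase hprim p (p + 1) (p - 1) (by omega) (by omega) x hx hdx

end DGLieAlgebra

/-! ### Quotients by ideals -/

namespace DGLieAlgebra

variable {k : Type u} [Field k]

section JointlySurjective

variable {ι : Type*} (L : ι → DGLieAlgebra k) (C : ChainComplex (ModuleCat.{u} k) ℤ)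
  (π : ∀ j, (L j).complex ⟶ C)

/-- A family of morphisms of complexes `π j : L j → C` from dg Lie algebras induces a bracket on `C`
if any three elements of `C` come from a single `L j`, and if the brackets are compatible. -/
structure IsJointlySurjective : Prop where
  exists_lift (p q r : ℤ) (x : C.X p) (y : C.X q) (z : C.X r) : ∃ (j : ι)
    (x' : (L j).complex.X p) (y' : (L j).complex.X q) (z' : (L j).complex.X r),
      ((π j).f p).hom x' = x ∧ ((π j).f q).hom y' = y ∧ ((π j).f r).hom z' = z
  bracket_eq (p q n : ℤ) (h : p + q = n) (j j' : ι) (x : (L j).complex.X p)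
    (y : (L j).complex.X q) (x' : (L j').complex.X p) (y' : (L j').complex.X q) :
    ((π j).f p).hom x = ((π j').f p).hom x' → ((π j).f q).hom y = ((π j').f q).hom y' →
      ((π j).f n).hom ((L j).bracket p q n h x y) =
        ((π j').f n).hom ((L j').bracket p q n h x' y')

namespace IsJointlySurjective

variable {L C π} (hπ : IsJointlySurjective L C π)

include hπ

lemma exists_bracket (p q n : ℤ) (h : p + q = n) (x : C.X p) (y : C.X q) :
    ∃ z : C.X n, ∀ j x' y', ((π j).f p).hom x' = x → ((π j).f q).hom y' = y →
      ((π j).f n).hom ((L j).bracket p q n h x' y') = z := by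
  obtain ⟨j, x', y', -, rfl, rfl, -⟩ := hπ.exists_lift p q q x y y
  exact ⟨_, fun j' x'' y'' h₁ h₂ ↦ hπ.bracket_eq p q n h j' j _ _ _ _ h₁ h₂⟩

/-- The induced bracket, on elements. -/
noncomputable def br (p q n : ℤ) (h : p + q = n) (x : C.X p) (y : C.X q) : C.X n :=
  (hπ.exists_bracket p q n h x y).choose

lemma br_π (p q n : ℤ) (h : p + q = n) (j : ι) (x : (L j).complex.X p)
    (y : (L j).complex.X q) : hπ.br p q n h (((π j).f p).hom x) (((π j).f q).hom y) =
      ((π j).f n).hom ((L j).bracket p q n h x y) :=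
  ((hπ.exists_bracket p q n h _ _).choose_spec j x y rfl rfl).symm

omit hπ in
lemma d_π (p q : ℤ) (j : ι) (x : (L j).complex.X p) :
    (C.d p q).hom (((π j).f p).hom x) = ((π j).f q).hom ((L j).d p q x) :=
  congr($((π j).comm p q) x)

/-- The induced bracket, as a bilinear map. -/
noncomputable def brₗ (p q n : ℤ) (h : p + q = n) : C.X p →ₗ[k] C.X q →ₗ[k] C.X n :=
  LinearMap.mk₂ k (hπ.br p q n h)
    (fun x x' y ↦ by
      obtain ⟨j, x, x', y, rfl, rfl, rfl⟩ := hπ.exists_lift p p q x x' y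
      rw [← map_add, hπ.br_π, hπ.br_π, hπ.br_π, map_add, LinearMap.add_apply, map_add])
    (fun c x y ↦ by
      obtain ⟨j, x, y, -, rfl, rfl, -⟩ := hπ.exists_lift p q q x y y
      rw [← map_smul, hπ.br_π, hπ.br_π, map_smul, LinearMap.smul_apply, map_smul])
    (fun x y y' ↦ by
      obtain ⟨j, x, y, y', rfl, rfl, rfl⟩ := hπ.exists_lift p q q x y y'
      rw [← map_add, hπ.br_π, hπ.br_π, hπ.br_π, map_add, map_add])
    (fun c x y ↦ by
      obtain ⟨j, x, y, -, rfl, rfl, -⟩ := hπ.exists_lift p q q x y y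
      rw [← map_smul, hπ.br_π, hπ.br_π, map_smul, map_smul])

lemma brₗ_π (p q n : ℤ) (h : p + q = n) (j : ι) (x : (L j).complex.X p)
    (y : (L j).complex.X q) : hπ.brₗ p q n h (((π j).f p).hom x) (((π j).f q).hom y) =
      ((π j).f n).hom ((L j).bracket p q n h x y) := hπ.br_π p q n h j x y

/-- The dg Lie algebra structure induced on `C`. -/
noncomputable abbrev dgLieAlgebra : DGLieAlgebra k where
  complex := C
  bracket := hπ.brₗ
  antisymm p q n h x y := by
    obtain ⟨j, x, y, -, rfl, rfl, -⟩ := hπ.exists_lift p q q x y y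
    have := congr_arg ((π j).f n).hom ((L j).antisymm p q n h x y)
    rw [map_add, map_smul, map_zero] at this
    rw [hπ.brₗ_π, hπ.brₗ_π, this]
  jacobi p q r n h x y z := by
    obtain ⟨j, x, y, z, rfl, rfl, rfl⟩ := hπ.exists_lift p q r x y z
    have := congr_arg ((π j).f n).hom ((L j).jacobi p q r n h x y z)
    rw [map_add, map_add, map_zero] at this
    erw [map_smul, map_smul, map_smul] at this
    rw [hπ.brₗ_π, hπ.brₗ_π, hπ.brₗ_π, hπ.brₗ_π, hπ.brₗ_π, hπ.brₗ_π]
    exact this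
  leibniz p q n h x y := by
    obtain ⟨j, x, y, -, rfl, rfl, -⟩ := hπ.exists_lift p q q x y y
    have := congr_arg ((π j).f (n - 1)).hom ((L j).leibniz p q n h x y)
    rw [map_add, map_smul] at this
    rw [hπ.brₗ_π, d_π, d_π, d_π, hπ.brₗ_π, hπ.brₗ_π, ← this]

/-- The canonical morphisms to the induced dg Lie algebra. -/
noncomputable abbrev toDGLieAlgebra (j : ι) : L j ⟶ hπ.dgLieAlgebra where
  hom := π j
  map_bracket p q n h x y := (hπ.brₗ_π p q n h j x y).symm

/-- A morphism of complexes out of the induced dg Lie algebra is a morphism of dg Lie algebras if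
its restrictions are. -/
noncomputable abbrev desc {M : DGLieAlgebra k} (g : C ⟶ M.complex) (g' : ∀ j, L j ⟶ M)
    (hg : ∀ j, π j ≫ g = (g' j).hom) : hπ.dgLieAlgebra ⟶ M where
  hom := g
  map_bracket p q n h x y := by
    obtain ⟨j, x, y, -, rfl, rfl, -⟩ := hπ.exists_lift p q q x y y
    have hg' (p : ℤ) (x : (L j).complex.X p) : (g.f p).hom (((π j).f p).hom x) = app (g' j) p x :=
      congr($(hg j).f p x)
    rw [hπ.brₗ_π, hg', hg', hg', app_bracket]

end IsJointlySurjective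

end JointlySurjective

/-- A dg ideal of a dg Lie algebra. -/
structure Ideal (L : DGLieAlgebra k) where
  /-- the components of the ideal -/
  carrier (p : ℤ) : Submodule k (L.complex.X p)
  d_mem (p q : ℤ) (x : L.complex.X p) : x ∈ carrier p → L.d p q x ∈ carrier q
  bracket_mem (p q n : ℤ) (h : p + q = n) (x : L.complex.X p) (y : L.complex.X q) :
    y ∈ carrier q → L.bracket p q n h x y ∈ carrier n

namespace Ideal

variable {L : DGLieAlgebra k}

lemma bracket_mem' (I : Ideal L) (p q n : ℤ) (h : p + q = n) (x : L.complex.X p)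
    (y : L.complex.X q) (hx : x ∈ I.carrier p) : L.bracket p q n h x y ∈ I.carrier n := by
  rw [eq_neg_of_add_eq_zero_left (L.antisymm p q n h x y)]
  exact neg_mem (Submodule.smul_mem _ _ (I.bracket_mem _ _ _ _ _ _ hx))

/-- The dg ideal generated by a set of homogeneous elements. -/
def span (s : ∀ p, Set (L.complex.X p)) : Ideal L where
  carrier p := ⨅ (I : Ideal L) (_ : ∀ p, s p ⊆ I.carrier p), I.carrier p
  d_mem p q x hx := by
    simp only [Submodule.mem_iInf] at hx ⊢
    exact fun I hI ↦ I.d_mem p q x (hx I hI)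
  bracket_mem p q n h x y hy := by
    simp only [Submodule.mem_iInf] at hy ⊢
    exact fun I hI ↦ I.bracket_mem p q n h x y (hy I hI)

lemma subset_span (s : ∀ p, Set (L.complex.X p)) (p : ℤ) : s p ⊆ (span s).carrier p := by
  intro x hx
  simp only [span, SetLike.mem_coe, Submodule.mem_iInf]
  exact fun I hI ↦ hI p hx

lemma span_le {s : ∀ p, Set (L.complex.X p)} {I : Ideal L} (h : ∀ p, s p ⊆ I.carrier p) (p : ℤ) :
    (span s).carrier p ≤ I.carrier p := by
  intro x hx
  simp only [span, Submodule.mem_iInf] at hx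
  exact hx I h

/-- The kernel of a morphism, as a dg ideal. -/
def ker {M : DGLieAlgebra k} (f : L ⟶ M) : Ideal L where
  carrier p := LinearMap.ker (app f p)
  d_mem p q x hx := by
    rw [LinearMap.mem_ker] at hx ⊢
    rw [app_d, hx, map_zero]
  bracket_mem p q n h x y hy := by
    rw [LinearMap.mem_ker] at hy ⊢
    rw [app_bracket, hy, map_zero]

variable (I : Ideal L)

/-- The quotient complex by a dg ideal. -/
abbrev quotientComplex : ChainComplex (ModuleCat.{u} k) ℤ where
  X p := ModuleCat.of k (L.complex.X p ⧸ I.carrier p)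
  d p q := ModuleCat.ofHom ((I.carrier p).mapQ (I.carrier q) (L.d p q) (fun x ↦ I.d_mem p q x))
  shape p q h := by
    ext x
    simp [d, L.complex.shape p q h]
  d_comp_d' p q r _ _ := by
    ext x
    simp [L.d_d]

/-- The projection to the quotient complex. -/
abbrev quotientComplexπ : L.complex ⟶ I.quotientComplex where
  f p := ModuleCat.ofHom (I.carrier p).mkQ
  comm' p q _ := by ext x; simp [d]

lemma isJointlySurjective :
    IsJointlySurjective (fun _ : Unit ↦ L) I.quotientComplex (fun _ ↦ I.quotientComplexπ) where
  exists_lift p q r x y z := by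
    obtain ⟨x, rfl⟩ := Submodule.mkQ_surjective _ x
    obtain ⟨y, rfl⟩ := Submodule.mkQ_surjective _ y
    obtain ⟨z, rfl⟩ := Submodule.mkQ_surjective _ z
    exact ⟨(), x, y, z, rfl, rfl, rfl⟩
  bracket_eq p q n h _ _ x y x' y' hx hy := by
    change Submodule.Quotient.mk _ = Submodule.Quotient.mk _ at hx hy
    change Submodule.Quotient.mk _ = Submodule.Quotient.mk _
    rw [Submodule.Quotient.eq] at hx hy ⊢
    have : L.bracket p q n h x y - L.bracket p q n h x' y' =
      L.bracket p q n h (x - x') y + L.bracket p q n h x' (y - y') := by simp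
    rw [this]
    exact add_mem (I.bracket_mem' _ _ _ _ _ _ hx) (I.bracket_mem _ _ _ _ _ _ hy)

/-- The quotient of a dg Lie algebra by a dg ideal. -/
noncomputable def quotient : DGLieAlgebra k := I.isJointlySurjective.dgLieAlgebra

/-- The projection to the quotient. -/
noncomputable def proj : L ⟶ I.quotient := I.isJointlySurjective.toDGLieAlgebra ()

lemma proj_surjective (p : ℤ) : Function.Surjective (app I.proj p) := Submodule.mkQ_surjective _

lemma proj_eq_zero_iff (p : ℤ) (x : L.complex.X p) : app I.proj p x = 0 ↔ x ∈ I.carrier p :=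
  Submodule.Quotient.mk_eq_zero _

variable {M : DGLieAlgebra k}

lemma exists_desc (f : L ⟶ M) (hf : ∀ p x, x ∈ I.carrier p → app f p x = 0) :
    ∃ g : I.quotient ⟶ M, I.proj ≫ g = f :=
  ⟨I.isJointlySurjective.desc
    { f p := ModuleCat.ofHom ((I.carrier p).liftQ (app f p) (hf p))
      comm' p q _ := by
        ext x
        simpa using! (app_d f p q x).symm } (fun _ ↦ f) (fun _ ↦ by ext; rfl), by
    ext; rfl⟩

lemma hom_ext {f g : I.quotient ⟶ M} (h : I.proj ≫ f = I.proj ≫ g) : f = g := by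
  refine hom_ext_apply fun p x ↦ ?_
  obtain ⟨x, rfl⟩ := I.proj_surjective p x
  exact congr($(h).hom.f p x)

lemma exists_desc_span {s : ∀ p, Set (L.complex.X p)} (f : L ⟶ M)
    (hf : ∀ p, ∀ x ∈ s p, app f p x = 0) : ∃ g : (span s).quotient ⟶ M, (span s).proj ≫ g = f :=
  exists_desc _ f fun p _ hx ↦ span_le (I := ker f) hf p hx

end Ideal

end DGLieAlgebra

/-! ### Limits and colimits -/

namespace DGLieAlgebra

variable {k : Type u} [Field k]

section FilteredComplexes

variable {J : Type u} [SmallCategory J] [IsFiltered J]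
  {K : J ⥤ ChainComplex (ModuleCat.{u} k) ℤ} {c : Cocone K} (hc : IsColimit c)

include hc

lemma exists_rep_of_isColimit (p : ℤ) (x : c.pt.X p) :
    ∃ (j : J) (y : (K.obj j).X p), ((c.ι.app j).f p).hom y = x := by
  obtain ⟨j, y, h⟩ := Types.jointly_surjective _
    (isColimitOfPreserves (HomologicalComplex.eval _ _ p ⋙ forget (ModuleCat.{u} k)) hc) x
  exact ⟨j, y, h⟩

lemma exists_map_eq_of_isColimit (p : ℤ) (j j' : J) (x : (K.obj j).X p) (x' : (K.obj j').X p)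
    (h : ((c.ι.app j).f p).hom x = ((c.ι.app j').f p).hom x') :
    ∃ (l : J) (f : j ⟶ l) (g : j' ⟶ l), ((K.map f).f p).hom x = ((K.map g).f p).hom x' :=
  (Types.FilteredColimit.isColimit_eq_iff _
    (isColimitOfPreserves (HomologicalComplex.eval _ _ p ⋙ forget (ModuleCat.{u} k)) hc)).1 h

end FilteredComplexes

section FilteredColimits

variable {J : Type u} [SmallCategory J] [IsFiltered J] (F : J ⥤ DGLieAlgebra k)

lemma app_comp {L M N : DGLieAlgebra k} (f : L ⟶ M) (g : M ⟶ N) (p : ℤ) (x : L.complex.X p) :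
    app (f ≫ g) p x = app g p (app f p x) := rfl

lemma isJointlySurjective_of_isFiltered (c : Cocone (F ⋙ forgetToComplex k)) (hc : IsColimit c) :
    IsJointlySurjective F.obj c.pt (fun j ↦ c.ι.app j) := by
  have w {j l : J} (f : j ⟶ l) (p : ℤ) (x : (F.obj j).complex.X p) :
      ((c.ι.app l).f p).hom (app (F.map f) p x) = ((c.ι.app j).f p).hom x :=
    congr($(c.w f).f p x)
  constructor
  · intro p q r x y z
    obtain ⟨j₁, x, rfl⟩ := exists_rep_of_isColimit hc p x
    obtain ⟨j₂, y, rfl⟩ := exists_rep_of_isColimit hc q y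
    obtain ⟨j₃, z, rfl⟩ := exists_rep_of_isColimit hc r z
    let f₁ := IsFiltered.firstToMax₃ j₁ j₂ j₃
    let f₂ := IsFiltered.secondToMax₃ j₁ j₂ j₃
    let f₃ := IsFiltered.thirdToMax₃ j₁ j₂ j₃
    exact ⟨_, app (F.map f₁) _ x, app (F.map f₂) _ y, app (F.map f₃) _ z, w _ _ _, w _ _ _,
      w _ _ _⟩
  · intro p q n h j j' x y x' y' hx hy
    obtain ⟨l₁, f, f', hf⟩ := exists_map_eq_of_isColimit hc p j j' x x' hx
    obtain ⟨l₂, g, g', hg⟩ := exists_map_eq_of_isColimit hc q j j' y y' hy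
    obtain ⟨l, a, b, hab⟩ := IsFiltered.span f g
    -- a common target of the four morphisms
    obtain ⟨m, e, he⟩ : ∃ (m : J) (e : l ⟶ m), f' ≫ a ≫ e = g' ≫ b ≫ e :=
      ⟨_, IsFiltered.coeqHom (f' ≫ a) (g' ≫ b), by
        simpa using IsFiltered.coeq_condition (f' ≫ a) (g' ≫ b)⟩
    have hab' : f ≫ a ≫ e = g ≫ b ≫ e := by simpa using congr_arg (· ≫ e) hab
    have h1 : app (F.map (f ≫ a ≫ e)) p x = app (F.map (f' ≫ a ≫ e)) p x' := by
      rw [F.map_comp f, F.map_comp f', app_comp, app_comp]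
      exact congr_arg _ hf
    have h2 : app (F.map (f ≫ a ≫ e)) q y = app (F.map (f' ≫ a ≫ e)) q y' := by
      rw [hab', he, F.map_comp g, F.map_comp g', app_comp, app_comp]
      exact congr_arg _ hg
    have h3 : ((c.ι.app j).f n).hom ((F.obj j).bracket p q n h x y) = _ :=
      (w (f ≫ a ≫ e) n ((F.obj j).bracket p q n h x y)).symm
    have h4 : ((c.ι.app j').f n).hom ((F.obj j').bracket p q n h x' y') = _ :=
      (w (f' ≫ a ≫ e) n ((F.obj j').bracket p q n h x' y')).symm
    refine h3.trans (Eq.trans ?_ h4.symm)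
    rw [app_bracket, app_bracket, h1, h2]

/-- The forgetful functor to complexes preserves filtered colimits: a filtered colimit of the
underlying complexes inherits a bracket. -/
instance : PreservesColimitsOfShape J (forgetToComplex k) where
  preservesColimit {F} := by
    let c := colimit.cocone (F ⋙ forgetToComplex k)
    let hc : IsColimit c := colimit.isColimit _
    have H := isJointlySurjective_of_isFiltered F c hc
    let c' : Cocone F :=
      { pt := H.dgLieAlgebra
        ι := { app j := H.toDGLieAlgebra j
               naturality j j' f := by
                 ext : 1
                 exact c.ι.naturality f } }
    have hc' : IsColimit c' :=
      { desc s := H.desc (hc.desc ((forgetToComplex k).mapCocone s)) s.ι.app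
          (hc.fac ((forgetToComplex k).mapCocone s))
        fac s j := by
          ext : 1
          exact hc.fac ((forgetToComplex k).mapCocone s) j
        uniq s m hm := by
          ext : 1
          exact hc.uniq ((forgetToComplex k).mapCocone s) m.hom
            (fun j ↦ congr_arg Hom.hom (hm j)) }
    exact preservesColimit_of_preserves_colimit_cocone hc' hc

end FilteredColimits

instance : HasColimitsOfSize.{u, u} (DGLieAlgebra k) where
  has_colimits_of_shape J _ :=
    { has_colimit F := by
        let c := colimit.cocone (F ⋙ forgetToComplex k)
        let hc : IsColimit c := colimit.isColimit _
        let ι (j : J) : (F.obj j).complex ⟶ (freeObj c.pt).complex := c.ι.app j ≫ freeUnit c.pt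
        -- the free dg Lie algebra on the colimit of complexes, modulo the relations which turn
        -- the morphisms from `F.obj j` into morphisms of dg Lie algebras
        let s (n : ℤ) : Set ((freeObj c.pt).complex.X n) :=
          {z | ∃ (j : J) (p q : ℤ) (h : p + q = n) (x : (F.obj j).complex.X p)
            (y : (F.obj j).complex.X q), z = ((ι j).f n).hom ((F.obj j).bracket p q n h x y) -
              (freeObj c.pt).bracket p q n h (((ι j).f p).hom x) (((ι j).f q).hom y)}
        let I := Ideal.span s
        let c' : Cocone F :=
          { pt := I.quotient
            ι :=
              { app j :=
                  { hom := ι j ≫ I.proj.hom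
                    map_bracket p q n h x y := by
                      have := (I.proj_eq_zero_iff n _).2 (Ideal.subset_span s n
                        ⟨j, p, q, h, x, y, rfl⟩)
                      rw [map_sub, sub_eq_zero, app_bracket] at this
                      exact this }
                naturality j j' f := by
                  ext : 1
                  have := congr_arg (· ≫ freeUnit c.pt ≫ I.proj.hom) (c.w f)
                  simp only [Category.assoc] at this
                  change (F.map f).hom ≫ (c.ι.app j' ≫ freeUnit c.pt) ≫ I.proj.hom =
                    ((c.ι.app j ≫ freeUnit c.pt) ≫ I.proj.hom) ≫ 𝟙 _
                  simp only [Category.assoc, Category.comp_id]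
                  exact this } }
        have key (t : Cocone F) : ∃ g : I.quotient ⟶ t.pt, ∀ j, c'.ι.app j ≫ g = t.ι.app j := by
          let g₀ : c.pt ⟶ t.pt.complex := hc.desc ((forgetToComplex k).mapCocone t)
          have hg₀ (j : J) : ι j ≫ (freeDesc g₀).hom = (t.ι.app j).hom :=
            hc.fac ((forgetToComplex k).mapCocone t) j
          have hg₀' (j : J) (p : ℤ) (x : (F.obj j).complex.X p) :
            app (freeDesc g₀) p (((ι j).f p).hom x) = app (t.ι.app j) p x := congr($(hg₀ j).f p x)
          obtain ⟨g, hg⟩ := Ideal.exists_desc_span (s := s) (freeDesc g₀) (by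
            rintro n _ ⟨j, p, q, h, x, y, rfl⟩
            rw [map_sub, app_bracket, hg₀', hg₀', hg₀', app_bracket]
            exact sub_self _)
          refine ⟨g, fun j ↦ ?_⟩
          ext : 1
          change (ι j ≫ I.proj.hom) ≫ g.hom = _
          rw [Category.assoc, ← comp_hom, hg, hg₀]
        choose desc fac using key
        exact ⟨⟨c',
          { desc := desc
            fac := fac
            uniq t m hm := by
              refine I.hom_ext ((freeHomEquiv _ _).injective (hc.hom_ext fun j ↦ ?_))
              have := congr_arg Hom.hom ((hm j).trans (fac t j).symm)
              change (ι j ≫ I.proj.hom) ≫ m.hom = (ι j ≫ I.proj.hom) ≫ (desc t).hom at this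
              simp only [ι, Category.assoc] at this
              exact this }⟩⟩ }

instance : HasLimitsOfSize.{u, u} (DGLieAlgebra k) where
  has_limits_of_shape J _ :=
    { has_limit F := by
        let c := limit.cone (F ⋙ forgetToComplex k)
        let hc : IsLimit c := limit.isLimit _
        let π (j : J) : c.pt ⟶ (F.obj j).complex := c.π.app j
        let hcp (p : ℤ) := isLimitOfPreserves
          (HomologicalComplex.eval _ _ p ⋙ forget (ModuleCat.{u} k)) hc
        have ext (p : ℤ) (x y : c.pt.X p) (h : ∀ j, ((π j).f p).hom x = ((π j).f p).hom y) :
            x = y := (Types.isLimitEquivSections (hcp p)).injective (Subtype.ext (funext h))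
        have hex (p q n : ℤ) (h : p + q = n) (x : c.pt.X p) (y : c.pt.X q) : ∃ z : c.pt.X n,
            ∀ j, ((π j).f n).hom z =
              (F.obj j).bracket p q n h (((π j).f p).hom x) (((π j).f q).hom y) := by
          have w {j l : J} (f : j ⟶ l) (p : ℤ) (x : c.pt.X p) :
            app (F.map f) p (((π j).f p).hom x) = ((π l).f p).hom x := congr($(c.w f).f p x)
          let σ : (F ⋙ forgetToComplex k ⋙
              HomologicalComplex.eval _ _ n ⋙ forget (ModuleCat.{u} k)).sections :=
            ⟨fun j ↦ (F.obj j).bracket p q n h (((π j).f p).hom x) (((π j).f q).hom y),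
              fun {j l} f ↦ (app_bracket (F.map f) p q n h _ _).trans (by rw [w, w])⟩
          exact ⟨(Types.isLimitEquivSections (hcp n)).symm σ, fun j ↦
            Types.isLimitEquivSections_symm_apply (hcp n) σ j⟩
        choose br hbr using hex
        have hd (p q : ℤ) (x : c.pt.X p) (j : J) : ((π j).f q).hom ((c.pt.d p q).hom x) =
          (F.obj j).d p q (((π j).f p).hom x) := congr($((π j).comm p q) x).symm
        let brₗ (p q n : ℤ) (h : p + q = n) : c.pt.X p →ₗ[k] c.pt.X q →ₗ[k] c.pt.X n :=
          LinearMap.mk₂ k (br p q n h)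
            (fun x x' y ↦ ext _ _ _ fun j ↦ by simp [hbr])
            (fun a x y ↦ ext _ _ _ fun j ↦ by simp [hbr])
            (fun x y y' ↦ ext _ _ _ fun j ↦ by simp [hbr])
            (fun a x y ↦ ext _ _ _ fun j ↦ by simp [hbr])
        replace hbr (p q n : ℤ) (h : p + q = n) (x : c.pt.X p) (y : c.pt.X q) (j : J) :
          ((π j).f n).hom (brₗ p q n h x y) =
            (F.obj j).bracket p q n h (((π j).f p).hom x) (((π j).f q).hom y) := hbr p q n h x y j
        clear_value brₗ
        let L : DGLieAlgebra k :=
          { complex := c.pt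
            bracket := brₗ
            antisymm p q n h x y := ext _ _ _ fun j ↦ by
              rw [map_add, map_smul, map_zero, hbr, hbr]
              exact (F.obj j).antisymm p q n h _ _
            jacobi p q r n h x y z := ext _ _ _ fun j ↦ by
              rw [map_add, map_add, map_zero, map_smul, map_smul, map_smul, hbr, hbr, hbr, hbr,
                hbr, hbr]
              exact (F.obj j).jacobi p q r n h _ _ _
            leibniz p q n h x y := ext _ _ _ fun j ↦ by
              rw [map_add, map_smul, hd, hbr, hbr, hbr, hd, hd]
              exact (F.obj j).leibniz p q n h _ _ }
        let c' : Cone F :=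
          { pt := L
            π :=
              { app j := { hom := π j, map_bracket p q n h x y := hbr p q n h x y j }
                naturality j j' f := by
                  ext : 1
                  exact c.π.naturality f } }
        have fac (t : Cone F) (j : J) (p : ℤ) (x : t.pt.complex.X p) :
            ((π j).f p).hom (((hc.lift ((forgetToComplex k).mapCone t)).f p).hom x) =
              app (t.π.app j) p x := congr($(hc.fac ((forgetToComplex k).mapCone t) j).f p x)
        exact ⟨⟨c',
          { lift t :=
              { hom := hc.lift ((forgetToComplex k).mapCone t)
                map_bracket p q n h x y := ext _ _ _ fun j ↦ by
                  erw [fac, hbr, fac, fac]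
                  exact app_bracket _ _ _ _ _ _ _ }
            fac t j := by
              ext : 1
              exact hc.fac ((forgetToComplex k).mapCone t) j
            uniq t m hm := by
              ext : 1
              exact hc.uniq ((forgetToComplex k).mapCone t) m.hom
                (fun j ↦ congr_arg Hom.hom (hm j)) }⟩⟩ }

end DGLieAlgebra

/-! ### Quasi-isomorphisms in terms of elements -/

section QuasiIso

variable {k : Type u} [Field k] {K L : ChainComplex (ModuleCat.{u} k) ℤ}

/-- A class in homology is represented by a cycle. -/
lemma ChainComplex.exists_homologyπ_eq (p : ℤ) (x : K.homology p) :
    ∃ z : K.cycles p, (K.homologyπ p).hom z = x :=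
  (ModuleCat.epi_iff_surjective _).1 inferInstance x

lemma ChainComplex.exists_iCycles_eq (p : ℤ) (x : K.X p) (hx : (K.d p (p - 1)).hom x = 0) :
    ∃ z : K.cycles p, (K.iCycles p).hom z = x :=
  (ShortComplex.moduleCat_exact_iff _).1
    (ShortComplex.exact_of_f_is_kernel (ShortComplex.mk _ _ (K.iCycles_d p (p - 1)))
      (K.cyclesIsKernel p (p - 1) (by simp))) x hx

lemma ChainComplex.iCycles_injective (p : ℤ) : Function.Injective (K.iCycles p).hom :=
  (ModuleCat.mono_iff_injective _).1 inferInstance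

lemma ChainComplex.homologyπ_eq_zero_iff (p : ℤ) (z : K.cycles p) :
    (K.homologyπ p).hom z = 0 ↔ ∃ y : K.X (p + 1), (K.d (p + 1) p).hom y = (K.iCycles p).hom z := by
  have h (y : K.X (p + 1)) : (K.iCycles p).hom ((K.toCycles (p + 1) p).hom y) =
    (K.d (p + 1) p).hom y := congr($(K.toCycles_i (p + 1) p) y)
  constructor
  · intro hz
    obtain ⟨y, hy⟩ := (ShortComplex.moduleCat_exact_iff _).1
      (ShortComplex.exact_of_g_is_cokernel
        (ShortComplex.mk _ _ (K.toCycles_comp_homologyπ (p + 1) p))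
        (K.homologyIsCokernel (p + 1) p (by simp))) z hz
    exact ⟨y, (h y).symm.trans (congr_arg _ hy)⟩
  · rintro ⟨y, hy⟩
    obtain rfl := iCycles_injective p ((h y).trans hy)
    exact congr($(K.toCycles_comp_homologyπ (p + 1) p) y)

lemma ChainComplex.iCycles_cyclesMap (φ : K ⟶ L) (p : ℤ) (z : K.cycles p) :
    (L.iCycles p).hom ((HomologicalComplex.cyclesMap φ p).hom z) =
      (φ.f p).hom ((K.iCycles p).hom z) := congr($(HomologicalComplex.cyclesMap_i φ p) z)

lemma ChainComplex.homologyMap_homologyπ (φ : K ⟶ L) (p : ℤ) (z : K.cycles p) :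
    (HomologicalComplex.homologyMap φ p).hom ((K.homologyπ p).hom z) =
      (L.homologyπ p).hom ((HomologicalComplex.cyclesMap φ p).hom z) :=
  congr($(HomologicalComplex.homologyπ_naturality φ p) z)

lemma ChainComplex.d_iCycles (p : ℤ) (z : K.cycles p) :
    (K.d p (p - 1)).hom ((K.iCycles p).hom z) = 0 := congr($(K.iCycles_d p (p - 1)) z)

open ChainComplex in
/-- A morphism is a quasi-isomorphism if every cycle of the target is homologous to the image of a
cycle, and if cycles whose image is a boundary are boundaries. -/
lemma ChainComplex.quasiIso_iff (φ : K ⟶ L) : QuasiIso φ ↔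
    (∀ p (x : L.X p), (L.d p (p - 1)).hom x = 0 → ∃ (z : K.X p) (y : L.X (p + 1)),
      (K.d p (p - 1)).hom z = 0 ∧ x = (φ.f p).hom z + (L.d (p + 1) p).hom y) ∧
    ∀ p (z : K.X p) (y : L.X (p + 1)), (K.d p (p - 1)).hom z = 0 →
      (L.d (p + 1) p).hom y = (φ.f p).hom z → ∃ y', (K.d (p + 1) p).hom y' = z := by
  simp only [_root_.quasiIso_iff, quasiIsoAt_iff_isIso_homologyMap,
    ConcreteCategory.isIso_iff_bijective]
  constructor
  · intro h
    refine ⟨fun p x hx ↦ ?_, fun p z y hz hy ↦ ?_⟩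
    · obtain ⟨x, rfl⟩ := exists_iCycles_eq p x hx
      obtain ⟨z, hz⟩ := (h p).2 ((L.homologyπ p).hom x)
      obtain ⟨z, rfl⟩ := exists_homologyπ_eq p z
      have h1 : (L.homologyπ p).hom (x - (HomologicalComplex.cyclesMap φ p).hom z) = 0 := by
        rw [map_sub, ← homologyMap_homologyπ, sub_eq_zero]
        exact hz.symm
      obtain ⟨y, hy⟩ := (homologyπ_eq_zero_iff p _).1 h1
      refine ⟨(K.iCycles p).hom z, y, d_iCycles p z, ?_⟩
      rw [hy, map_sub, iCycles_cyclesMap, add_sub_cancel]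
    · obtain ⟨z, rfl⟩ := exists_iCycles_eq p z hz
      rw [← iCycles_cyclesMap] at hy
      have h1 := (homologyπ_eq_zero_iff p _).2 ⟨y, hy⟩
      rw [← homologyMap_homologyπ] at h1
      exact (homologyπ_eq_zero_iff p z).1 ((h p).1 (h1.trans (map_zero _).symm))
  · rintro ⟨h₁, h₂⟩ p
    constructor
    · refine (injective_iff_map_eq_zero (HomologicalComplex.homologyMap φ p).hom).2 fun x hx ↦ ?_
      obtain ⟨z, rfl⟩ := exists_homologyπ_eq p x
      rw [homologyMap_homologyπ] at hx
      obtain ⟨y, hy⟩ := (homologyπ_eq_zero_iff p _).1 hx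
      rw [iCycles_cyclesMap] at hy
      exact (homologyπ_eq_zero_iff p z).2 (h₂ p _ y (d_iCycles p z) hy)
    · intro x
      obtain ⟨x, rfl⟩ := exists_homologyπ_eq p x
      obtain ⟨z, y, hz, hy⟩ := h₁ p _ (d_iCycles p x)
      obtain ⟨z, rfl⟩ := exists_iCycles_eq p z hz
      refine ⟨(K.homologyπ p).hom z, (homologyMap_homologyπ φ p z).trans ?_⟩
      rw [eq_comm, ← sub_eq_zero, ← map_sub, homologyπ_eq_zero_iff]
      exact ⟨y, by rw [map_sub, iCycles_cyclesMap, hy, add_sub_cancel_left]⟩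

end QuasiIso

namespace DGLieAlgebra

variable {k : Type u} [Field k]

lemma quasiIsos_iff {L M : DGLieAlgebra k} (f : L ⟶ M) : quasiIsos k f ↔
    (∀ p x, M.d p (p - 1) x = 0 → ∃ z y, L.d p (p - 1) z = 0 ∧ x = app f p z + M.d (p + 1) p y) ∧
    ∀ p z y, L.d p (p - 1) z = 0 → M.d (p + 1) p y = app f p z → ∃ y', L.d (p + 1) p y' = z :=
  ChainComplex.quasiIso_iff f.hom

lemma HasAcyclicKernel.quasiIsos {L M : DGLieAlgebra k} {f : L ⟶ M} (hf : HasAcyclicKernel f)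
    (hf' : degreewiseSurjections k f) : quasiIsos k f := by
  refine (quasiIsos_iff f).2 ⟨fun p x hx ↦ ?_, fun p z y hz hy ↦ ?_⟩
  · obtain ⟨x, rfl⟩ := hf' p x
    obtain ⟨y, hy, hy'⟩ := hf (p - 1) (L.d p (p - 1) x) ((app_d _ _ _ _).trans hx) (L.d_d _ _ _ _)
    have e (n : ℤ) (hn : n = p) (w : L.complex.X n) (hw : app f n w = 0)
        (hw' : L.d n (p - 1) w = L.d p (p - 1) x) : ∃ z y, L.d p (p - 1) z = 0 ∧
          app f p x = app f p z + M.d (p + 1) p y := by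
      subst hn
      exact ⟨x - w, 0, by rw [map_sub, hw', sub_self], by rw [map_sub, hw, map_zero]; abel⟩
    exact e _ (by omega) y hy hy'
  · obtain ⟨y, rfl⟩ := hf' _ y
    have hy2 := hy
    change M.d (p + 1) p (app f _ y) = _ at hy2
    rw [← app_d] at hy2
    obtain ⟨w, hw, hw'⟩ := hf p (z - L.d (p + 1) p y) (by rw [map_sub, hy2, sub_self])
      (by rw [map_sub, hz, L.d_d, sub_zero])
    exact ⟨w + y, by rw [map_add, hw', sub_add_cancel]⟩

lemma hasAcyclicKernel_of_quasiIsos {L M : DGLieAlgebra k} {f : L ⟶ M} (hf : quasiIsos k f)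
    (hf' : degreewiseSurjections k f) : HasAcyclicKernel f := by
  intro p x hx hdx
  obtain ⟨h₁, h₂⟩ := (quasiIsos_iff f).1 hf
  obtain ⟨y, rfl⟩ := h₂ p x 0 hdx (by rw [hx, map_zero])
  have h0 : M.d (p + 1) (p + 1 - 1) (app f _ y) = 0 := by
    have e (n : ℤ) (hn : n = p) : M.d (p + 1) n (app f _ y) = 0 := by
      subst hn
      rw [← app_d, hx]
    exact e _ (by omega)
  obtain ⟨z, w, hz, hw⟩ := h₁ (p + 1) (app f _ y) h0
  obtain ⟨w, rfl⟩ := hf' _ w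
  have hz' : L.d (p + 1) p z = 0 := by
    have e (n : ℤ) (hn : n = p + 1 - 1) : L.d (p + 1) n z = 0 := by
      subst hn
      exact hz
    exact e _ (by omega)
  refine ⟨y - z - L.d _ _ w, ?_, ?_⟩
  · rw [map_sub, map_sub, hw, app_d]
    abel
  · rw [map_sub, map_sub, hz', L.d_d, sub_zero, sub_zero]

instance : (quasiIsos k).HasTwoOutOfThreeProperty where
  comp_mem f g hf hg := by
    have : QuasiIso f.hom := hf
    have : QuasiIso g.hom := hg
    exact inferInstanceAs (QuasiIso (f.hom ≫ g.hom))
  of_postcomp f g hg hfg := by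
    have : QuasiIso g.hom := hg
    have : QuasiIso (f.hom ≫ g.hom) := hfg
    exact quasiIso_of_comp_right f.hom g.hom
  of_precomp f g hf hfg := by
    have : QuasiIso f.hom := hf
    have : QuasiIso (f.hom ≫ g.hom) := hfg
    exact quasiIso_of_comp_left f.hom g.hom

instance : (quasiIsos k).IsStableUnderRetracts where
  of_retract {X Y Z W f g} h hg := by
    have hg : QuasiIso ((forgetToComplex k).map g) := hg
    exact quasiIso_of_retractArrow (h.map (forgetToComplex k))

instance : (quasiIsos k).IsMultiplicative where
  id_mem L := inferInstanceAs (QuasiIso (𝟙 L.complex))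

/-! ### The generating morphisms -/

section Generators

variable (k)

/-- The free dg Lie algebra on `E(n)`: it corepresents the component of degree `n`. -/
noncomputable abbrev freeE (n : ℤ) : DGLieAlgebra k := (free k).obj (E k n)

/-- The free dg Lie algebra on `∂E(n)`: it corepresents the cycles of degree `n - 1`. -/
noncomputable abbrev freeBoundaryE (n : ℤ) : DGLieAlgebra k := (free k).obj (boundaryE k n)

/-- The generator of degree `n` of `Free(E(n))`. -/
noncomputable def genE (n : ℤ) : (freeE k n).complex.X n :=
  (((freeAdjunction k).unit.app (E k n)).f n).hom
    ((HomologicalComplex.doubleXIso₀ (c := ComplexShape.down ℤ) (i₀ := n) (i₁ := n - 1)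
      (𝟙 (ModuleCat.of k k)) (by simp)).inv.hom (1 : k))

/-- The generator of degree `n - 1` of `Free(∂E(n))`. -/
noncomputable def genBoundaryE (n : ℤ) : (freeBoundaryE k n).complex.X (n - 1) :=
  (((freeAdjunction k).unit.app (boundaryE k n)).f (n - 1)).hom
    ((HomologicalComplex.singleObjXSelf (ComplexShape.down ℤ) (n - 1)
      (ModuleCat.of k k)).inv.hom (1 : k))

variable {k}

/-- A morphism out of `Free(E(n))` is the same as an element of degree `n`. -/
lemma existsUnique_of_genE {L : DGLieAlgebra k} (n : ℤ) (x : L.complex.X n) :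
    ∃! f : freeE k n ⟶ L, app f n (genE k n) = x := by
  let e := (HomologicalComplex.evalCompCoyonedaCorepresentableByDoubleId
    (c := ComplexShape.down ℤ) (i₀ := n) (i₁ := n - 1) (by simp) (by lia)
    (ModuleCat.of k k)).homEquiv (Y := L.complex)
  let e' : (freeE k n ⟶ L) ≃ (ModuleCat.of k k ⟶ L.complex.X n) :=
    ((freeAdjunction k).homEquiv (E k n) L).trans e
  have h (f : freeE k n ⟶ L) : app f n (genE k n) = (e' f).hom (1 : k) := rfl
  refine ⟨e'.symm (ModuleCat.ofHom (LinearMap.toSpanSingleton k _ x)), ?_, fun f hf ↦ ?_⟩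
  · change app _ _ _ = _
    rw [h, e'.apply_symm_apply]
    simp
  · rw [e'.eq_symm_apply]
    ext
    rw [← h, hf]
    simp

/-- A morphism out of `Free(∂E(n))` is the same as a cycle of degree `n - 1`. -/
lemma existsUnique_of_genBoundaryE {L : DGLieAlgebra k} (n : ℤ) (x : L.complex.X (n - 1))
    (hx : L.d (n - 1) (n - 1 - 1) x = 0) :
    ∃! f : freeBoundaryE k n ⟶ L, app f (n - 1) (genBoundaryE k n) = x := by
  let e' : (freeBoundaryE k n ⟶ L) ≃ ((HomologicalComplex.single (ModuleCat.{u} k)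
    (ComplexShape.down ℤ) (n - 1)).obj (ModuleCat.of k k) ⟶ L.complex) :=
    (freeAdjunction k).homEquiv (boundaryE k n) L
  let ψ := (HomologicalComplex.singleObjXSelf (ComplexShape.down ℤ) (n - 1) (ModuleCat.of k k))
  have h (f : freeBoundaryE k n ⟶ L) : app f (n - 1) (genBoundaryE k n) =
    (ψ.inv ≫ (e' f).f (n - 1)).hom (1 : k) := rfl
  refine ⟨e'.symm (HomologicalComplex.mkHomFromSingle
    (ModuleCat.ofHom (LinearMap.toSpanSingleton k _ x)) ?_), ?_, fun f hf ↦ ?_⟩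
  · intro j hj
    obtain rfl : j = n - 1 - 1 := by simp at hj; omega
    ext
    change L.d (n - 1) (n - 1 - 1) ((1 : k) • x) = 0
    rw [one_smul, hx]
  · change app _ _ _ = _
    rw [h, e'.apply_symm_apply, HomologicalComplex.mkHomFromSingle_f]
    simp [ψ]
  · rw [e'.eq_symm_apply]
    apply HomologicalComplex.from_single_hom_ext
    rw [HomologicalComplex.mkHomFromSingle_f, ← Iso.inv_comp_eq]
    ext
    refine (h f).symm.trans (hf.trans ?_)
    simp

lemma d_genBoundaryE (n m : ℤ) : (freeBoundaryE k n).d (n - 1) m (genBoundaryE k n) = 0 := by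
  have := (freeAdjunction k).unit.app (boundaryE k n) |>.comm (n - 1) m
  refine (congr($this _)).trans ?_
  have h : (boundaryE k n).d (n - 1) m = 0 := HomologicalComplex.single_obj_d _ _ _ _ _
  change (((freeAdjunction k).unit.app (boundaryE k n)).f m).hom
    (((boundaryE k n).d (n - 1) m).hom _) = 0
  rw [h]
  exact map_zero _

lemma map_boundaryEInclusion_genBoundaryE (n : ℤ) :
    app ((free k).map (boundaryEInclusion k n)) (n - 1) (genBoundaryE k n) =
      (freeE k n).d n (n - 1) (genE k n) := by
  let ψ := HomologicalComplex.singleObjXSelf (ComplexShape.down ℤ) (n - 1) (ModuleCat.of k k)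
  let ψ' := HomologicalComplex.doubleXIso₀ (c := ComplexShape.down ℤ) (i₀ := n) (i₁ := n - 1)
    (𝟙 (ModuleCat.of k k)) (by simp)
  have h1 (x : (boundaryE k n).X (n - 1)) := congr($((freeAdjunction k).unit.naturality
    (boundaryEInclusion k n)).f (n - 1) x)
  have h2 (x : (E k n).X n) := congr($((freeAdjunction k).unit.app (E k n) |>.comm n (n - 1)) x)
  refine (h1 (ψ.inv.hom (1 : k))).symm.trans (Eq.trans ?_ (h2 (ψ'.inv.hom (1 : k))).symm)
  refine congr_arg (((freeAdjunction k).unit.app (E k n)).f (n - 1)).hom ?_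
  have h3 : (HomologicalComplex.singleObjXSelf (ComplexShape.down ℤ) (n - 1)
      (ModuleCat.of k k)).inv ≫ (boundaryEInclusion k n).f (n - 1) =
    (HomologicalComplex.doubleXIso₀ (c := ComplexShape.down ℤ) (i₀ := n) (i₁ := n - 1)
      (𝟙 (ModuleCat.of k k)) (by simp)).inv ≫ (E k n).d n (n - 1) := by
    have h4 : (boundaryEInclusion k n).f (n - 1) = ψ.hom ≫ (HomologicalComplex.doubleXIso₁
        (c := ComplexShape.down ℤ) (i₀ := n) (i₁ := n - 1) (𝟙 (ModuleCat.of k k)) (by simp)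
        (by omega)).inv :=
      HomologicalComplex.mkHomFromSingle_f (K := E k n) _ _
    have h5 := HomologicalComplex.double_d (c := ComplexShape.down ℤ) (i₀ := n) (i₁ := n - 1)
      (𝟙 (ModuleCat.of k k)) (by simp) (by omega)
    change ψ.inv ≫ _ = _
    rw [h4]
    refine (ψ.inv_hom_id_assoc _).trans (Eq.trans ?_ (congr_arg (ψ'.inv ≫ ·) h5).symm)
    exact ((ψ'.inv_hom_id_assoc _).trans (Category.id_comp _)).symm
  exact congr($h3 (1 : k))

end Generators

end DGLieAlgebra

namespace DGLieAlgebra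

variable {k : Type u} [Field k]

/-! ### Presentability -/

section Presentable

lemma exists_rep {J : Type u} [SmallCategory J] [IsFiltered J] {F : J ⥤ DGLieAlgebra k}
    {c : Cocone F} (hc : IsColimit c) (p : ℤ) (x : c.pt.complex.X p) :
    ∃ (j : J) (y : (F.obj j).complex.X p), app (c.ι.app j) p y = x :=
  exists_rep_of_isColimit (isColimitOfPreserves (forgetToComplex k) hc) p x

lemma exists_map_eq {J : Type u} [SmallCategory J] [IsFiltered J] {F : J ⥤ DGLieAlgebra k}
    {c : Cocone F} (hc : IsColimit c) (p : ℤ) {j j' : J} (x : (F.obj j).complex.X p)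
    (x' : (F.obj j').complex.X p) (h : app (c.ι.app j) p x = app (c.ι.app j') p x') :
    ∃ (l : J) (f : j ⟶ l) (g : j' ⟶ l), app (F.map f) p x = app (F.map g) p x' :=
  exists_map_eq_of_isColimit (isColimitOfPreserves (forgetToComplex k) hc) p j j' x x' h

lemma app_ι_map {J : Type u} [SmallCategory J] {F : J ⥤ DGLieAlgebra k}
    (c : Cocone F) {j j' : J} (f : j ⟶ j') (p : ℤ) (x : (F.obj j).complex.X p) :
    app (c.ι.app j') p (app (F.map f) p x) = app (c.ι.app j) p x :=
  congr($(c.w f).hom.f p x)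

lemma exists_map_eq_zero {J : Type u} [SmallCategory J] [IsFiltered J] {F : J ⥤ DGLieAlgebra k}
    {c : Cocone F} (hc : IsColimit c) (p : ℤ) {j : J} (x : (F.obj j).complex.X p)
    (h : app (c.ι.app j) p x = 0) : ∃ (l : J) (f : j ⟶ l), app (F.map f) p x = 0 := by
  obtain ⟨l, f, g, e⟩ := exists_map_eq hc p x (0 : (F.obj j).complex.X p)
    (h.trans (map_zero _).symm)
  exact ⟨l, f, e.trans (map_zero _)⟩

attribute [local instance] Cardinal.fact_isRegular_aleph0 Cardinal.orderBotAleph0OrdToType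

open Cardinal

instance isCardinalPresentable_freeE (n : ℤ) :
    IsCardinalPresentable (freeE k n) (Cardinal.aleph0.{u}) where
  preservesColimitOfShape J _ _ :=
    { preservesColimit {F} :=
        { preserves {c} hc := ⟨by
            have := isFiltered_of_isCardinalFiltered J Cardinal.aleph0.{u}
            refine Types.FilteredColimit.isColimitOf _ _ (fun f ↦ ?_) (fun i j f g h ↦ ?_)
            · obtain ⟨j, y, hy⟩ := exists_rep hc n (app f n (genE k n))
              obtain ⟨g, hg, -⟩ := existsUnique_of_genE n y
              refine ⟨j, g, (existsUnique_of_genE n (app f n (genE k n))).unique rfl ?_⟩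
              exact (congr_arg (app (c.ι.app j) n) hg).trans hy
            · obtain ⟨l, a, b, e⟩ := exists_map_eq hc n (app f n (genE k n)) (app g n (genE k n))
                (congr_arg (fun t : freeE k n ⟶ c.pt ↦ app t n (genE k n)) h)
              exact ⟨l, a, b, (existsUnique_of_genE n _).unique rfl e.symm⟩⟩ } }

instance isCardinalPresentable_freeBoundaryE (n : ℤ) :
    IsCardinalPresentable (freeBoundaryE k n) (Cardinal.aleph0.{u}) where
  preservesColimitOfShape J _ _ :=
    { preservesColimit {F} :=
        { preserves {c} hc := ⟨by
            have := isFiltered_of_isCardinalFiltered J Cardinal.aleph0.{u}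
            have h0 {L : DGLieAlgebra k} (f : freeBoundaryE k n ⟶ L) :
                L.d (n - 1) (n - 1 - 1) (app f (n - 1) (genBoundaryE k n)) = 0 := by
              rw [← app_d, d_genBoundaryE, map_zero]
            refine Types.FilteredColimit.isColimitOf _ _ (fun f ↦ ?_) (fun i j f g h ↦ ?_)
            · obtain ⟨i, x, hx⟩ := exists_rep hc (n - 1) (app f (n - 1) (genBoundaryE k n))
              have hdx : app (c.ι.app i) (n - 1 - 1) ((F.obj i).d (n - 1) (n - 1 - 1) x) = 0 := by
                rw [app_d]
                exact (congr_arg _ hx).trans (h0 f)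
              obtain ⟨j, a, ha⟩ := exists_map_eq_zero hc _ _ hdx
              obtain ⟨g, hg, -⟩ := existsUnique_of_genBoundaryE n (app (F.map a) (n - 1) x)
                (by rw [← app_d, ha])
              refine ⟨j, g, (existsUnique_of_genBoundaryE n _ (h0 f)).unique rfl ?_⟩
              exact (congr_arg (app (c.ι.app j) (n - 1)) hg).trans ((app_ι_map c a _ x).trans hx)
            · obtain ⟨l, a, b, e⟩ := exists_map_eq hc (n - 1) (app f (n - 1) (genBoundaryE k n))
                (app g (n - 1) (genBoundaryE k n))
                (congr_arg (fun t : freeBoundaryE k n ⟶ c.pt ↦ app t (n - 1) (genBoundaryE k n)) h)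
              exact ⟨l, a, b, (existsUnique_of_genBoundaryE n _ (h0 (f ≫ F.map a))).unique rfl
                e.symm⟩⟩ } }

variable (k) in
instance isCardinalPresentable_initial :
    IsCardinalPresentable (⊥_ (DGLieAlgebra k)) (Cardinal.aleph0.{u}) where
  preservesColimitOfShape J _ _ :=
    { preservesColimit {F} :=
        { preserves {c} hc := ⟨by
            have := isFiltered_of_isCardinalFiltered J Cardinal.aleph0.{u}
            exact Types.FilteredColimit.isColimitOf _ _
              (fun f ↦ ⟨IsFiltered.nonempty.some, initial.to _, initialIsInitial.hom_ext _ _⟩)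
              (fun i j f g h ↦ ⟨_, IsFiltered.leftToMax i j, IsFiltered.rightToMax i j,
                initialIsInitial.hom_ext _ _⟩)⟩ } }

variable (k) in
/-- The dg Lie algebras `Free(E(n))` form a strong generator. -/
lemma isStrongGenerator_freeE : (ObjectProperty.ofObj (freeE k)).IsStrongGenerator := by
  rw [ObjectProperty.isStrongGenerator_iff]
  refine ⟨fun X Y f g h ↦ ?_, fun X Y i _ h ↦ ?_⟩
  · refine hom_ext_apply fun p x ↦ ?_
    obtain ⟨t, rfl, -⟩ := existsUnique_of_genE p x
    exact congr($(h _ (ObjectProperty.ofObj_apply _ p) t).hom.f p (genE k p))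
  · have inj (p : ℤ) : Function.Injective (app i p) := by
      intro x y hxy
      obtain ⟨s, rfl, -⟩ := existsUnique_of_genE p x
      obtain ⟨t, rfl, -⟩ := existsUnique_of_genE p y
      obtain rfl : s = t := by
        rw [← cancel_mono i]
        exact (existsUnique_of_genE p _).unique rfl hxy.symm
      rfl
    have surj (p : ℤ) : Function.Surjective (app i p) := by
      intro y
      obtain ⟨t, rfl, -⟩ := existsUnique_of_genE p y
      obtain ⟨s, rfl⟩ := h _ (ObjectProperty.ofObj_apply _ p) t
      exact ⟨app s p (genE k p), rfl⟩
    have (p : ℤ) : IsIso (i.hom.f p) :=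
      (ConcreteCategory.isIso_iff_bijective _).2 ⟨inj p, surj p⟩
    have : IsIso i.hom := HomologicalComplex.Hom.isIso_of_components _
    refine ⟨⟨{ hom := inv i.hom, map_bracket p q n h x y := inj n ?_ }, ?_, ?_⟩⟩
    · have e (p : ℤ) (x : Y.complex.X p) : app i p (((inv i.hom).f p).hom x) = x :=
        congr($(IsIso.inv_hom_id i.hom).f p x)
      rw [app_bracket, e, e, e]
    · ext : 1; exact IsIso.hom_inv_id i.hom
    · ext : 1; exact IsIso.inv_hom_id i.hom

instance : IsLocallyPresentable.{u} (DGLieAlgebra k) where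
  exists_cardinal := ⟨Cardinal.aleph0, inferInstance,
    (IsCardinalLocallyPresentable.iff_exists_isStrongGenerator _ _).2
      ⟨_, inferInstance, isStrongGenerator_freeE k, by
        rintro _ ⟨n⟩
        exact isCardinalPresentable_freeE n⟩⟩

variable (k) in
/-- The morphisms `0 → Free(E(n))`, which generate the trivial cofibrations. -/
noncomputable def generatingTrivialCofibrations : MorphismProperty (DGLieAlgebra k) :=
  MorphismProperty.ofHoms fun n : ℤ ↦ initial.to (freeE k n)

instance : MorphismProperty.IsSmall.{u} (generatingCofibrations k) :=
  MorphismProperty.isSmall_ofHoms ..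

instance : MorphismProperty.IsSmall.{u} (generatingTrivialCofibrations k) :=
  MorphismProperty.isSmall_ofHoms ..

instance : MorphismProperty.IsCardinalForSmallObjectArgument (generatingCofibrations k)
    Cardinal.aleph0.{u} where
  preservesColimit i hi f hf := by
    obtain ⟨n⟩ := hi
    have := preservesColimitsOfShape_of_isCardinalPresentable (freeBoundaryE k n)
      Cardinal.aleph0.{u} (Cardinal.aleph0.{u}.ord.ToType)
    infer_instance

instance : MorphismProperty.IsCardinalForSmallObjectArgument (generatingTrivialCofibrations k)
    Cardinal.aleph0.{u} where
  preservesColimit i hi f hf := by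
    obtain ⟨n⟩ := hi
    have := preservesColimitsOfShape_of_isCardinalPresentable (⊥_ (DGLieAlgebra k))
      Cardinal.aleph0.{u} (Cardinal.aleph0.{u}.ord.ToType)
    infer_instance

instance : MorphismProperty.HasSmallObjectArgument.{u} (generatingCofibrations k) :=
  ⟨.aleph0, inferInstance, inferInstance, inferInstance⟩

instance : MorphismProperty.HasSmallObjectArgument.{u} (generatingTrivialCofibrations k) :=
  ⟨.aleph0, inferInstance, inferInstance, inferInstance⟩

end Presentable

/-! ### Lifting properties -/

lemma HasAcyclicKernel.exists_d_eq {L M : DGLieAlgebra k} {f : L ⟶ M} (hf : HasAcyclicKernel f)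
    (n : ℤ) (x : L.complex.X (n - 1)) (hx : app f (n - 1) x = 0)
    (hdx : L.d (n - 1) (n - 1 - 1) x = 0) :
    ∃ y : L.complex.X n, app f n y = 0 ∧ L.d n (n - 1) y = x := by
  have e (m : ℤ) (hm : m = n) (h : ∃ y : L.complex.X m, app f m y = 0 ∧ L.d m (n - 1) y = x) :
      ∃ y : L.complex.X n, app f n y = 0 ∧ L.d n (n - 1) y = x := by
    subst hm
    exact h
  exact e _ (by omega) (hf (n - 1) x hx hdx)

lemma generatingCofibrations_rlp_iff {L M : DGLieAlgebra k} (f : L ⟶ M) :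
    (generatingCofibrations k).rlp f ↔ ∀ (n : ℤ) (x : L.complex.X (n - 1)) (y : M.complex.X n),
      L.d (n - 1) (n - 1 - 1) x = 0 → M.d n (n - 1) y = app f (n - 1) x →
        ∃ z, L.d n (n - 1) z = x ∧ app f n z = y := by
  constructor
  · intro hf n x y hx hy
    obtain ⟨s, rfl, -⟩ := existsUnique_of_genBoundaryE n x hx
    obtain ⟨t, rfl, -⟩ := existsUnique_of_genE n y
    have sq : CommSq s ((free k).map (boundaryEInclusion k n)) f t := ⟨by
      refine (existsUnique_of_genBoundaryE n _ ?_).unique rfl ?_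
      · rw [← app_d, d_genBoundaryE, map_zero]
      · rw [app_comp, map_boundaryEInclusion_genBoundaryE, app_d]
        exact hy⟩
    have := hf _ (MorphismProperty.ofHoms.mk n)
    refine ⟨app sq.lift n (genE k n), ?_, ?_⟩
    · rw [← app_d, ← map_boundaryEInclusion_genBoundaryE, ← app_comp, sq.fac_left]
    · rw [← app_comp, sq.fac_right]
  · rintro hf _ _ _ ⟨n⟩
    refine ⟨fun {s t} sq ↦ CommSq.HasLift.mk' (Classical.choice ?_)⟩
    obtain ⟨z, hz, hz'⟩ := hf n (app s (n - 1) (genBoundaryE k n)) (app t n (genE k n))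
      (by rw [← app_d, d_genBoundaryE, map_zero])
      (by rw [← app_d, ← map_boundaryEInclusion_genBoundaryE, ← app_comp, ← app_comp, sq.w])
    obtain ⟨l, hl, -⟩ := existsUnique_of_genE n z
    exact ⟨⟨l, (existsUnique_of_genBoundaryE n (app s (n - 1) (genBoundaryE k n))
          (by rw [← app_d, d_genBoundaryE, map_zero])).unique
          (by rw [app_comp, map_boundaryEInclusion_genBoundaryE, app_d, hl, hz]) rfl,
      (existsUnique_of_genE n (app t n (genE k n))).unique (by rw [app_comp, hl, hz']) rfl⟩⟩

/-- The morphisms with the right lifting property with respect to the generating cofibrations are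
the degreewise surjective quasi-isomorphisms. -/
lemma generatingCofibrations_rlp :
    (generatingCofibrations k).rlp = degreewiseSurjections k ⊓ quasiIsos k := by
  ext L M f
  rw [generatingCofibrations_rlp_iff]
  constructor
  · intro hf
    have hs : degreewiseSurjections k f := by
      intro n y
      obtain ⟨x, hx, hx'⟩ := hf (n - 1) 0 (M.d n (n - 1) y) (map_zero _)
        (by rw [M.d_d, map_zero])
      obtain ⟨z, -, hz⟩ := hf n x y hx hx'.symm
      exact ⟨z, hz⟩
    refine ⟨hs, HasAcyclicKernel.quasiIsos (fun p x hx hdx ↦ ?_) hs⟩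
    have hf' : ∀ n m r : ℤ, n - 1 = m → m - 1 = r → ∀ (x : L.complex.X m) (y : M.complex.X n),
        L.d m r x = 0 → M.d n m y = app f m x → ∃ z, L.d n m z = x ∧ app f n z = y := by
      rintro n _ _ rfl rfl
      exact hf n
    obtain ⟨y, hy, hy'⟩ := hf' (p + 1) p _ (by omega) rfl x 0 hdx (by rw [hx, map_zero])
    exact ⟨y, hy', hy⟩
  · rintro ⟨hs, hq⟩ n x y hx hy
    obtain ⟨z, hz⟩ := hs n y
    obtain ⟨w, hw, hw'⟩ := (hasAcyclicKernel_of_quasiIsos hq hs).exists_d_eq n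
      (x - L.d n (n - 1) z) (by rw [map_sub, app_d, hz, ← hy, sub_self])
      (by rw [map_sub, hx, L.d_d, sub_zero])
    exact ⟨z + w, by rw [map_add, hw', add_sub_cancel], by rw [map_add, hw, hz, add_zero]⟩

/-- The morphisms with the right lifting property with respect to `0 → Free(E(n))` are
the degreewise surjections. -/
lemma generatingTrivialCofibrations_rlp :
    (generatingTrivialCofibrations k).rlp = degreewiseSurjections k := by
  ext L M f
  constructor
  · intro hf n y
    obtain ⟨t, rfl, -⟩ := existsUnique_of_genE n y
    have sq : CommSq (initial.to L) (initial.to (freeE k n)) f t := ⟨initialIsInitial.hom_ext _ _⟩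
    have := hf _ (MorphismProperty.ofHoms.mk n)
    exact ⟨app sq.lift n (genE k n), by rw [← app_comp, sq.fac_right]⟩
  · rintro hf _ _ _ ⟨n⟩
    refine ⟨fun {s t} sq ↦ CommSq.HasLift.mk' (Classical.choice ?_)⟩
    obtain ⟨z, hz⟩ := hf n (app t n (genE k n))
    obtain ⟨l, hl, -⟩ := existsUnique_of_genE n z
    exact ⟨⟨l, initialIsInitial.hom_ext _ _,
      (existsUnique_of_genE n (app t n (genE k n))).unique (by rw [app_comp, hl]; exact hz) rfl⟩⟩

/-! ### Filtered colimits of quasi-isomorphisms -/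

instance : MorphismProperty.IsStableUnderFilteredColimits.{u, u} (quasiIsos k) where
  isStableUnderColimitsOfShape J _ _ :=
    { condition X₁ X₂ c₁ c₂ h₁ h₂ f hf φ hφ := by
        have hφ' (j : J) (p : ℤ) (x : (X₁.obj j).complex.X p) :
            app φ p (app (c₁.ι.app j) p x) = app (c₂.ι.app j) p (app (f.app j) p x) :=
          congr($(hφ j).hom.f p x)
        have nat {j l : J} (a : j ⟶ l) (p : ℤ) (x : (X₁.obj j).complex.X p) :
            app (f.app l) p (app (X₁.map a) p x) = app (X₂.map a) p (app (f.app j) p x) :=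
          congr($(f.naturality a).hom.f p x)
        refine (quasiIsos_iff φ).2 ⟨fun p x hx ↦ ?_, fun p z y hz hy ↦ ?_⟩
        · obtain ⟨j, x, rfl⟩ := exists_rep h₂ p x
          rw [← app_d] at hx
          obtain ⟨l, a, hl⟩ := exists_map_eq_zero h₂ _ _ hx
          rw [app_d] at hl
          obtain ⟨z, y, hz, hy⟩ := ((quasiIsos_iff _).1 (hf l)).1 p _ hl
          refine ⟨app (c₁.ι.app l) p z, app (c₂.ι.app l) _ y, by rw [← app_d, hz, map_zero], ?_⟩
          rw [hφ', ← app_d, ← map_add, ← hy, app_ι_map]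
        · obtain ⟨j, z, rfl⟩ := exists_rep h₁ p z
          obtain ⟨j', y, rfl⟩ := exists_rep h₂ _ y
          rw [← app_d] at hz
          obtain ⟨l, a, hl⟩ := exists_map_eq_zero h₁ _ _ hz
          rw [← app_d, hφ', ← app_ι_map c₂ a, ← nat] at hy
          obtain ⟨m, b, b', hm⟩ := exists_map_eq h₂ _ _ _ hy
          rw [app_d, ← nat] at hm
          obtain ⟨y', hy'⟩ := ((quasiIsos_iff _).1 (hf m)).2 p
            (app (X₁.map b') p (app (X₁.map a) p z)) _ (by rw [← app_d, ← app_d, hl, map_zero]) hm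
          exact ⟨app (c₁.ι.app m) _ y', by rw [← app_d, hy', app_ι_map, app_ι_map]⟩ }

end DGLieAlgebra

namespace DGLieAlgebra

variable {k : Type u} [Field k]

/-! ### Cell attachments -/

section CellAttachments

variable {A B X Y : DGLieAlgebra k}

lemma IsCellAttachment.of_isPushout {i : A ⟶ B} {J : Type u} {deg : J → ℤ}
    {a : ∀ j, A.complex.X (deg j - 1)} {v : ∀ j, B.complex.X (deg j)}
    (hi : IsCellAttachment i deg a v) {f : A ⟶ X} {j : X ⟶ Y} {h : B ⟶ Y}
    (sq : IsPushout f i j h) :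
    IsCellAttachment j deg (fun l ↦ app f _ (a l)) (fun l ↦ app h _ (v l)) where
  d_a l := (app_d f _ _ _).symm.trans ((congr_arg _ (hi.d_a l)).trans (map_zero _))
  d_v l := by
    refine (app_d h _ _ _).symm.trans ((congr_arg _ (hi.d_v l)).trans ?_)
    exact congr($(sq.w).hom.f _ (a l)).symm
  exists_desc Z g z hz := by
    obtain ⟨t, ht, ht'⟩ := hi.exists_desc Z (f ≫ g) z hz
    refine ⟨sq.desc g t ht.symm, sq.inl_desc _ _ _, fun l ↦ ?_⟩
    exact congr($(sq.inr_desc g t ht.symm).hom.f _ (v l)).trans (ht' l)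
  hom_ext Z t t' h₁ h₂ := sq.hom_ext h₁ (hi.hom_ext Z _ _ (by
    rw [← sq.w_assoc, ← sq.w_assoc, h₁]) h₂)

variable (k) in
/-- The morphisms of dg Lie algebras which attach a family of cells. -/
def cellAttachments : MorphismProperty (DGLieAlgebra k) := fun A B i ↦
  ∃ (J : Type u) (deg : J → ℤ) (a : ∀ j, A.complex.X (deg j - 1))
    (v : ∀ j, B.complex.X (deg j)), IsCellAttachment i deg a v

instance : (cellAttachments k).IsStableUnderCobaseChange where
  of_isPushout sq h := by
    obtain ⟨J, deg, a, v, h⟩ := h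
    exact ⟨J, deg, _, _, h.of_isPushout sq⟩

instance : MorphismProperty.IsStableUnderCoproducts.{u} (cellAttachments k) where
  isStableUnderCoproductsOfShape J :=
    { condition X₁ X₂ c₁ c₂ h₁ h₂ f hf φ hφ := by
        choose I deg a v H using fun j : J ↦ hf ⟨j⟩
        have hφ' (j : J) (p : ℤ) (x : (X₁.obj ⟨j⟩).complex.X p) :
            app φ p (app (c₁.ι.app ⟨j⟩) p x) = app (c₂.ι.app ⟨j⟩) p (app (f.app ⟨j⟩) p x) :=
          congr($(hφ ⟨j⟩).hom.f p x)
        refine ⟨Σ j, I j, fun l ↦ deg l.1 l.2, fun l ↦ app (c₁.ι.app ⟨l.1⟩) _ (a l.1 l.2),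
          fun l ↦ app (c₂.ι.app ⟨l.1⟩) _ (v l.1 l.2), fun l ↦ ?_, fun l ↦ ?_, fun Z g z hz ↦ ?_,
          fun Z t t' ht ht' ↦ ?_⟩
        · exact (app_d _ _ _ _).symm.trans ((congr_arg _ ((H l.1).d_a l.2)).trans (map_zero _))
        · exact (app_d _ _ _ _).symm.trans ((congr_arg _ ((H l.1).d_v l.2)).trans (hφ' _ _ _).symm)
        · choose s hs hs' using fun j ↦ (H j).exists_desc Z (c₁.ι.app ⟨j⟩ ≫ g)
            (fun l ↦ z ⟨j, l⟩) (fun l ↦ hz ⟨j, l⟩)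
          let c : Cocone X₂ := { pt := Z, ι := Discrete.natTrans (fun j ↦ s j.as) }
          refine ⟨h₂.desc c, h₁.hom_ext fun j ↦ ?_, fun l ↦ ?_⟩
          · rw [← Category.assoc, hφ, Category.assoc, h₂.fac]
            exact hs j.as
          · exact congr($(h₂.fac c ⟨l.1⟩).hom.f _ (v l.1 l.2)).trans (hs' l.1 l.2)
        · refine h₂.hom_ext fun j ↦ (H j.as).hom_ext Z _ _ ?_ (fun l ↦ ht' ⟨j.as, l⟩)
          have := congr_arg (c₁.ι.app j ≫ ·) ht
          simp only [← Category.assoc, hφ] at this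
          simpa only [Category.assoc] using this }

variable (k) in
lemma generatingCofibrations_le : generatingCofibrations k ≤ cellAttachments k := by
  rintro _ _ _ ⟨n⟩
  refine ⟨PUnit, fun _ ↦ n, fun _ ↦ genBoundaryE k n, fun _ ↦ genE k n,
    fun _ ↦ d_genBoundaryE _ _, fun _ ↦ (map_boundaryEInclusion_genBoundaryE n).symm,
    fun Z g z hz ↦ ?_, fun Z t t' _ h ↦ ?_⟩
  · obtain ⟨t, ht, -⟩ := existsUnique_of_genE n (z ⟨⟩)
    refine ⟨t, (existsUnique_of_genBoundaryE n (app g (n - 1) (genBoundaryE k n)) ?_).unique ?_ rfl,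
      fun _ ↦ ht⟩
    · rw [← app_d, d_genBoundaryE, map_zero]
    · rw [app_comp, map_boundaryEInclusion_genBoundaryE, app_d, ht]
      exact hz ⟨⟩
  · exact (existsUnique_of_genE n _).unique (h ⟨⟩) rfl

variable (k) in
lemma pushouts_coproducts_generatingCofibrations_le :
    (MorphismProperty.coproducts.{u} (generatingCofibrations k)).pushouts ≤ cellAttachments k := by
  rw [MorphismProperty.pushouts_le_iff, MorphismProperty.coproducts_le_iff]
  exact generatingCofibrations_le k

end CellAttachments

/-! ### Disk attachments -/

section DiskAttachments

/-- `B` is the free product of `A` with the free dg Lie algebra on elements `v j`. -/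
structure IsDiskAttachment {A B : DGLieAlgebra k} (i : A ⟶ B) {J : Type u} (deg : J → ℤ)
    (v : ∀ j, B.complex.X (deg j)) : Prop where
  exists_desc (Z : DGLieAlgebra k) (g : A ⟶ Z) (z : ∀ j, Z.complex.X (deg j)) :
    ∃ f : B ⟶ Z, i ≫ f = g ∧ ∀ j, app f _ (v j) = z j
  hom_ext (Z : DGLieAlgebra k) (f f' : B ⟶ Z) (h : i ≫ f = i ≫ f')
    (h' : ∀ j, app f _ (v j) = app f' _ (v j)) : f = f'

variable {A B : DGLieAlgebra k} {i : A ⟶ B} {J : Type u} {deg : J → ℤ}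
  {v : ∀ j, B.complex.X (deg j)}

lemma IsDiskAttachment.of_isPushout (hi : IsDiskAttachment i deg v) {X Y : DGLieAlgebra k}
    {f : A ⟶ X} {j : X ⟶ Y} {h : B ⟶ Y} (sq : IsPushout f i j h) :
    IsDiskAttachment j deg (fun l ↦ app h _ (v l)) where
  exists_desc Z g z := by
    obtain ⟨t, ht, ht'⟩ := hi.exists_desc Z (f ≫ g) z
    refine ⟨sq.desc g t ht.symm, sq.inl_desc _ _ _, fun l ↦ ?_⟩
    exact congr($(sq.inr_desc g t ht.symm).hom.f _ (v l)).trans (ht' l)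
  hom_ext Z t t' h₁ h₂ := sq.hom_ext h₁ (hi.hom_ext Z _ _ (by
    rw [← sq.w_assoc, ← sq.w_assoc, h₁]) h₂)

/-- As a graded Lie algebra, `B` is free over `A` on the elements `v j` and `d (v j)`. -/
lemma IsDiskAttachment.isFree (hi : IsDiskAttachment i deg v) :
    GrLieAlgebra.IsFree (Hom.toGraded i) (Sum.elim deg (fun j ↦ deg j - 1))
      (Sum.rec v (fun j ↦ B.d (deg j) (deg j - 1) (v j))) where
  exists_desc G φ g := by
    obtain ⟨f, h₁, h₂⟩ := hi.exists_desc G.coinduced (GrLieAlgebra.toCoinduced φ)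
      (fun j ↦ (g (.inl j), g (.inr j)))
    refine ⟨GrLieAlgebra.ofCoinduced f, ?_, ?_⟩
    · ext p x
      exact congr_arg Prod.fst (congr($(h₁).hom.f p x))
    · rintro (j | j)
      · exact congr_arg Prod.fst (h₂ j)
      · refine (congr_arg Prod.fst ((app_d f _ _ (v j)).trans (congr_arg _ (h₂ j)))).trans ?_
        simp [d]
        rfl
  hom_ext G ψ ψ' h₁ h₂ := by
    have hψ (p : ℤ) (x : A.complex.X p) : ψ.map p (app i p x) = ψ'.map p (app i p x) :=
      congr($(h₁).map p x)
    have := hi.hom_ext _ (GrLieAlgebra.toCoinduced ψ) (GrLieAlgebra.toCoinduced ψ')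
      (by
        refine hom_ext_apply fun p x ↦ Prod.ext (hψ p x) ?_
        change ψ.map (p - 1) (B.d p (p - 1) (app i p x)) =
          ψ'.map (p - 1) (B.d p (p - 1) (app i p x))
        rw [← app_d, hψ])
      (fun j ↦ Prod.ext (h₂ (.inl j)) (h₂ (.inr j)))
    ext p x
    exact congr_arg Prod.fst congr($(this).hom.f p x)

/-- In characteristic zero, attaching disks is a quasi-isomorphism: the derivation `H` which sends
`d (v j)` to `v j` and `v j` to `0` is a homotopy between `0` and the derivation `d H + H d`, which
multiplies by the number of generators. -/
lemma IsDiskAttachment.quasiIsos [CharZero k] (hi : IsDiskAttachment i deg v) : quasiIsos k i := by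
  have hB := hi.isFree
  obtain ⟨r, hr, hrv⟩ := hi.exists_desc A (𝟙 A) (fun _ ↦ 0)
  have hr' (p : ℤ) (a : A.complex.X p) : app r p (app i p a) = a := congr($(hr).hom.f p a)
  obtain ⟨D, hD, hDv⟩ := hB.exists_der 0 _ (fun _ ↦ add_zero _)
    (Sum.rec v (fun j ↦ B.d (deg j) (deg j - 1) (v j)))
  obtain ⟨H, hH, hHv⟩ := hB.exists_der 1 (Sum.elim (fun j ↦ deg j + 1) deg)
    (by rintro (j | j) <;> simp) (Sum.rec (fun _ ↦ 0) v)
  -- both sides are derivations, hence it suffices to compare them on `A` and on the generators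
  have hHd (p : ℤ) (x : B.complex.X p) : ∀ q r hq hr, B.d q p (H.map p q hq x) +
      H.map r p hr (B.d p r x) = D.op p x := by
    induction p, x using hB.induction with
    | add p x y hx hy =>
      intro q r hq hr
      rw [map_add, map_add, map_add, map_add, map_add, ← hx q r hq hr, ← hy q r hq hr]
      abel
    | smul p c x hx =>
      intro q r hq hr
      rw [map_smul, map_smul, map_smul, map_smul, map_smul, ← hx q r hq hr, smul_add]
    | bracket p q n h x y hx hy =>
      intro n' m hn' hm
      have e1 := H.map_bracket p q n (p + 1) (q + 1) n' h rfl rfl hn' x y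
      have e2 := B.der.map_bracket (p + 1) q n' p (q - 1) n (by omega) (by omega) (by omega)
        (by omega) (H.map p (p + 1) rfl x) y
      have e3 := B.der.map_bracket p (q + 1) n' (p - 1) q n (by omega) (by omega) (by omega)
        (by omega) x (H.map q (q + 1) rfl y)
      have e4 := B.der.map_bracket p q n (p - 1) (q - 1) m h (by omega) (by omega) (by omega) x y
      have e5 := H.map_bracket (p - 1) q m p (q + 1) n (by omega) (by omega) (by omega)
        (by omega) (B.d p (p - 1) x) y
      have e6 := H.map_bracket p (q - 1) m (p + 1) q n (by omega) (by omega) (by omega)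
        (by omega) x (B.d q (q - 1) y)
      have e7 := hx (p + 1) (p - 1) rfl (by omega)
      have e8 := hy (q + 1) (q - 1) rfl (by omega)
      simp only [der, koszul_neg_left] at e2 e3 e4
      rw [D.op_bracket, ← e7, ← e8, e1, map_add, map_smul, e2, e3, e4, map_add, map_smul, e5, e6]
      simp only [koszul_add_right, koszul_sub_right, koszul_one_one, map_add, LinearMap.add_apply]
      rcases koszul_eq_one_or (k := k) 1 p with e | e <;> simp only [e] <;> module
    | base p a =>
      intro q r hq hr
      have h1 : H.map p q hq (app i p a) = 0 := hH p q hq a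
      have h2 : H.map r p hr (app i r (A.d p r a)) = 0 := hH r p hr _
      refine Eq.trans ?_ (hD p p _ a).symm
      change B.d q p (H.map p q hq (app i p a)) + H.map r p hr (B.d p r (app i p a)) = 0
      rw [h1, ← app_d, h2, map_zero, add_zero]
    | gen j =>
      intro q r hq hr
      obtain j | j := j
      · obtain rfl : q = deg j + 1 := hq.symm
        obtain rfl : r = deg j - 1 := by change r + 1 = deg j at hr; omega
        have h1 : H.map (deg j) (deg j + 1) hq (v j) = 0 := hHv (.inl j)
        have h2 : H.map (deg j - 1) (deg j) hr (B.d (deg j) (deg j - 1) (v j)) = v j :=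
          hHv (.inr j)
        refine Eq.trans ?_ (hDv (.inl j)).symm
        change B.d (deg j + 1) (deg j) (H.map (deg j) (deg j + 1) hq (v j)) +
          H.map (deg j - 1) (deg j) hr (B.d (deg j) (deg j - 1) (v j)) = v j
        rw [h1, h2, map_zero, zero_add]
      · obtain rfl : q = deg j := by change deg j - 1 + 1 = q at hq; omega
        have h2 : H.map (deg j - 1) (deg j) hq (B.d (deg j) (deg j - 1) (v j)) = v j :=
          hHv (.inr j)
        refine Eq.trans ?_ (hDv (.inr j)).symm
        change B.d (deg j) (deg j - 1) (H.map (deg j - 1) (deg j) hq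
          (B.d (deg j) (deg j - 1) (v j))) +
            H.map r (deg j - 1) hr (B.d (deg j - 1) r (B.d (deg j) (deg j - 1) (v j))) =
          B.d (deg j) (deg j - 1) (v j)
        rw [h2, B.d_d, map_zero, add_zero]
  let D' : GrLieAlgebra.Der A.toGraded 0 := { map _ _ _ := 0, map_bracket := by simp }
  have hrD : ∀ p x, app r p (D.op p x) = 0 := hB.map_op (F := Hom.toGraded r) (D := D) (D' := D')
    (fun p a ↦ (congr_arg _ (hD p p _ a)).trans (map_zero _))
    (by
      rintro (j | j)
      · exact (congr_arg _ (hDv (.inl j))).trans (hrv j)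
      · refine (congr_arg _ (hDv (.inr j))).trans ((app_d r _ _ (v j)).trans ?_)
        rw [hrv, map_zero]
        rfl)
  -- the differential preserves the weight, hence its part `θ` which lowers the weight is zero
  have hacyclic : HasAcyclicKernel r := fun p x hx hdx ↦ by
    refine hB.acyclic_of_weight (F := Hom.toGraded r) (D := D) (D' := D') (d := B.der)
      (δ := B.der) (θ := B.der.sub B.der) (fun p ↦ hD p p _) hDv hrD
      (fun p q h x ↦ ?_) (fun p q h x ↦ ?_) (fun p q h x ↦ ?_) (fun p q h x ↦ sub_self _)
      (fun p q r _ _ x ↦ B.d_d p q r x)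
      (fun p q h x hx ↦ (app_d r p q x).trans ((congr_arg _ hx).trans (map_zero _)))
      (fun p q s h h' a ha _ ↦ ⟨0, map_zero _, ?_⟩) (fun p q s h h' x hx hdx ↦ ?_)
      p (p + 1) (p - 1) (by omega) (by omega) x hx hdx
    · exact (add_eq_left.2 (sub_self _)).symm
    · change B.d p q (D.op p x) = D.op q (B.d p q x)
      rw [← hHd p x (p + 1) q rfl (by omega), ← hHd q (B.d p q x) p (q - 1) (by omega) (by omega),
        map_add, B.d_d, B.d_d, map_zero, zero_add, add_zero]
    · exact (sub_self _).trans ((congr_arg _ (sub_self _)).trans (map_zero _)).symm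
    · have ha : a = 0 := (hr' p a).symm.trans ha
      subst ha
      exact (map_zero _).trans (map_zero _).symm
    · have h1 := hHd p x q s (by omega) (by omega)
      have hdx : B.d p s x = 0 := hdx
      rw [hdx, map_zero, add_zero] at h1
      refine ⟨H.map p q (by omega) x - app i q (app r q (H.map p q (by omega) x)),
        (map_sub _ _ _).trans (sub_eq_zero.2 (hr' _ _).symm), ?_⟩
      change B.d q p _ = _
      rw [map_sub, ← app_d, ← app_d, h1, hrD, map_zero, sub_zero]
  have hrq : DGLieAlgebra.quasiIsos k r := hacyclic.quasiIsos fun p a ↦ ⟨app i p a, hr' p a⟩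
  refine MorphismProperty.of_postcomp _ i r hrq ?_
  rw [hr]
  exact MorphismProperty.id_mem _ _

variable (k) in
/-- The morphisms of dg Lie algebras which attach a family of disks. -/
def diskAttachments : MorphismProperty (DGLieAlgebra k) := fun A B i ↦
  ∃ (J : Type u) (deg : J → ℤ) (v : ∀ j, B.complex.X (deg j)), IsDiskAttachment i deg v

instance : (diskAttachments k).IsStableUnderCobaseChange where
  of_isPushout sq h := by
    obtain ⟨J, deg, v, h⟩ := h
    exact ⟨J, deg, _, h.of_isPushout sq⟩

instance : MorphismProperty.IsStableUnderCoproducts.{u} (diskAttachments k) where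
  isStableUnderCoproductsOfShape J :=
    { condition X₁ X₂ c₁ c₂ h₁ h₂ f hf φ hφ := by
        choose I deg v H using fun j : J ↦ hf ⟨j⟩
        refine ⟨Σ j, I j, fun l ↦ deg l.1 l.2, fun l ↦ app (c₂.ι.app ⟨l.1⟩) _ (v l.1 l.2),
          fun Z g z ↦ ?_, fun Z t t' ht ht' ↦ ?_⟩
        · choose s hs hs' using fun j ↦ (H j).exists_desc Z (c₁.ι.app ⟨j⟩ ≫ g) (fun l ↦ z ⟨j, l⟩)
          let c : Cocone X₂ := { pt := Z, ι := Discrete.natTrans (fun j ↦ s j.as) }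
          refine ⟨h₂.desc c, h₁.hom_ext fun j ↦ ?_, fun l ↦ ?_⟩
          · rw [← Category.assoc, hφ, Category.assoc, h₂.fac]
            exact hs j.as
          · exact congr($(h₂.fac c ⟨l.1⟩).hom.f _ (v l.1 l.2)).trans (hs' l.1 l.2)
        · refine h₂.hom_ext fun j ↦ (H j.as).hom_ext Z _ _ ?_ (fun l ↦ ht' ⟨j.as, l⟩)
          have := congr_arg (c₁.ι.app j ≫ ·) ht
          simp only [← Category.assoc, hφ] at this
          simpa only [Category.assoc] using this }

variable (k) in
lemma generatingTrivialCofibrations_le : generatingTrivialCofibrations k ≤ diskAttachments k := by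
  rintro _ _ _ ⟨n⟩
  refine ⟨PUnit, fun _ ↦ n, fun _ ↦ genE k n, fun Z g z ↦ ?_, fun Z t t' _ h ↦ ?_⟩
  · obtain ⟨t, ht, -⟩ := existsUnique_of_genE n (z ⟨⟩)
    exact ⟨t, initialIsInitial.hom_ext _ _, fun _ ↦ ht⟩
  · exact (existsUnique_of_genE n _).unique (h ⟨⟩) rfl

variable (k) in
/-- The morphisms with the left lifting property with respect to surjections are
quasi-isomorphisms. -/
lemma llp_degreewiseSurjections_le_quasiIsos [CharZero k] :
    (degreewiseSurjections k).llp ≤ quasiIsos k := by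
  rw [← generatingTrivialCofibrations_rlp, MorphismProperty.llp_rlp_of_hasSmallObjectArgument.{u},
    MorphismProperty.retracts_le_iff, MorphismProperty.transfiniteCompositions_le_iff]
  have h : diskAttachments k ≤ quasiIsos k := by
    rintro _ _ _ ⟨J, deg, v, h⟩
    exact h.quasiIsos
  refine le_trans ?_ h
  rw [MorphismProperty.pushouts_le_iff, MorphismProperty.coproducts_le_iff]
  exact generatingTrivialCofibrations_le k

end DiskAttachments

end DGLieAlgebra

namespace DGLieAlgebra

variable {k : Type u} [Field k]

/-! ### The model structure -/

local instance : CategoryWithWeakEquivalences (DGLieAlgebra k) where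
  weakEquivalences := quasiIsos k

local instance : CategoryWithFibrations (DGLieAlgebra k) where
  fibrations := degreewiseSurjections k

local instance : CategoryWithCofibrations (DGLieAlgebra k) where
  cofibrations := (degreewiseSurjections k ⊓ quasiIsos k).llp

variable (k) in
lemma cofibrations_eq : cofibrations (DGLieAlgebra k) = (generatingCofibrations k).rlp.llp := by
  rw [generatingCofibrations_rlp]
  rfl

variable (k) in
/-- The trivial cofibrations are the morphisms with the left lifting property with respect to
surjections. Indeed, a trivial cofibration is factored into such a morphism, which is a
quasi-isomorphism, followed by a surjection, which is then a quasi-isomorphism as well; hence it is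
a retract of its first factor. -/
lemma trivialCofibrations_eq [CharZero k] :
    trivialCofibrations (DGLieAlgebra k) = (generatingTrivialCofibrations k).rlp.llp := by
  refine le_antisymm ?_ ?_
  · rintro A B i ⟨hi, hi'⟩
    let fac := MorphismProperty.factorizationData (generatingTrivialCofibrations k).rlp.llp
      (generatingTrivialCofibrations k).rlp i
    have hp : degreewiseSurjections k fac.p := generatingTrivialCofibrations_rlp.le _ fac.hp
    have hj' : quasiIsos k fac.i := llp_degreewiseSurjections_le_quasiIsos k _ (by
      rw [← generatingTrivialCofibrations_rlp]
      exact fac.hi)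
    have hp' : quasiIsos k fac.p := by
      refine MorphismProperty.of_precomp _ _ _ hj' ?_
      rw [fac.fac]
      exact hi'
    have : HasLiftingProperty i fac.p := hi _ ⟨hp, hp'⟩
    exact MorphismProperty.of_retract (RetractArrow.ofLeftLiftingProperty fac.fac) fac.hi
  · rw [generatingTrivialCofibrations_rlp]
    exact le_inf (MorphismProperty.antitone_llp inf_le_left)
      (llp_degreewiseSurjections_le_quasiIsos k)

instance : (weakEquivalences (DGLieAlgebra k)).HasTwoOutOfThreeProperty :=
  inferInstanceAs (quasiIsos k).HasTwoOutOfThreeProperty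

instance : MorphismProperty.IsWeakFactorizationSystem (cofibrations (DGLieAlgebra k))
    (trivialFibrations (DGLieAlgebra k)) where
  rlp := by
    rw [cofibrations_eq, MorphismProperty.rlp_llp_rlp, generatingCofibrations_rlp]
    rfl
  llp := rfl
  hasFactorization := by
    have : trivialFibrations (DGLieAlgebra k) = (generatingCofibrations k).rlp :=
      generatingCofibrations_rlp.symm
    rw [cofibrations_eq, this]
    infer_instance

instance [CharZero k] : MorphismProperty.IsWeakFactorizationSystem
    (trivialCofibrations (DGLieAlgebra k)) (fibrations (DGLieAlgebra k)) where
  rlp := by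
    rw [trivialCofibrations_eq, MorphismProperty.rlp_llp_rlp, generatingTrivialCofibrations_rlp]
    rfl
  llp := by
    rw [trivialCofibrations_eq, generatingTrivialCofibrations_rlp]
    rfl
  hasFactorization := by
    have : fibrations (DGLieAlgebra k) = (generatingTrivialCofibrations k).rlp :=
      generatingTrivialCofibrations_rlp.symm
    rw [trivialCofibrations_eq, this]
    infer_instance

variable (k) in
/-- The model structure on dg Lie algebras. -/
@[reducible]
noncomputable def modelCategory [CharZero k] : ModelCategory (DGLieAlgebra k) :=
  have : HasLimits (DGLieAlgebra k) := inferInstance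
  have : HasColimits (DGLieAlgebra k) := inferInstance
  .mk' _

/-! ### Left properness -/

section LeftProper

open MorphismProperty

variable (k) in
/-- The morphisms all of whose cobase changes have the property that pushouts of quasi-isomorphisms
along them are quasi-isomorphisms. -/
def flatMorphisms : MorphismProperty (DGLieAlgebra k) := fun A B i ↦
  ∀ ⦃A' B' X Y : DGLieAlgebra k⦄ (g : A ⟶ A') (i' : A' ⟶ B') (g' : B ⟶ B') (f : A' ⟶ X)
    (j : X ⟶ Y) (h : B' ⟶ Y), IsPushout g i i' g' → IsPushout f i' j h →
      quasiIsos k f → quasiIsos k h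

/-- A quasi-isomorphism is the composition of a trivial cofibration, which is preserved by all
pushouts, and of a surjection with acyclic kernel. -/
lemma cellAttachments_le_flatMorphisms [CharZero k] : cellAttachments k ≤ flatMorphisms k := by
  rintro A B i hi A' B' X Y g i' g' f j h sq' sq hf
  obtain ⟨J, deg, a, v, hi⟩ : cellAttachments k i' := of_isPushout sq' hi
  clear sq' g g'
  let fac := factorizationData (generatingTrivialCofibrations k).rlp.llp
    (generatingTrivialCofibrations k).rlp f
  have sq₁ := IsPushout.of_hasPushout fac.i i'
  let q : pushout fac.i i' ⟶ Y := pushout.desc (fac.p ≫ j) h (by rw [fac.fac_assoc, sq.w])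
  have hq : pushout.inr fac.i i' ≫ q = h := pushout.inr_desc _ _ _
  have sq₂ : IsPushout fac.p (pushout.inl fac.i i') j q := by
    refine IsPushout.of_left ?_ (pushout.inl_desc _ _ _).symm sq₁
    rwa [fac.fac, hq]
  have hq' (p : ℤ) (x : fac.Z.complex.X p) :
    app q p (app (pushout.inl fac.i i') p x) = app j p (app fac.p p x) :=
      congr($(sq₂.w).hom.f p x).symm
  have hi' := hi.of_isPushout sq₁
  have hi'' := (hi'.of_isPushout sq₂).isFree
  have hs : degreewiseSurjections k fac.p := generatingTrivialCofibrations_rlp.le _ fac.hp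
  have le := llp_degreewiseSurjections_le_quasiIsos k
  rw [← generatingTrivialCofibrations_rlp] at le
  have hp : quasiIsos k fac.p := by
    refine of_precomp _ _ _ (le _ fac.hi) ?_
    rwa [fac.fac]
  -- `q` is surjective, as its image contains the image of `j` and the new cells
  have hqs : degreewiseSurjections k q := hi''.mem_of_bracket_mem
    (fun p ↦ LinearMap.range (app q p))
    (by
      rintro p q' n hn _ ⟨x, rfl⟩ _ ⟨y, rfl⟩
      exact ⟨_, app_bracket q p q' n hn x y⟩)
    (fun p a ↦ by
      obtain ⟨x, rfl⟩ := hs p a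
      exact ⟨_, hq' p x⟩)
    (fun l ↦ ⟨_, rfl⟩)
  rw [← hq]
  refine comp_mem _ _ _ (le _ (of_isPushout sq₁.flip fac.hi)) ?_
  exact (hi'.hasAcyclicKernel sq₂.w.symm hi'' (hasAcyclicKernel_of_quasiIsos hp hs) hs).quasiIsos
    hqs

lemma quasiIsos_of_isIso {A B : DGLieAlgebra k} (f : A ⟶ B) [IsIso f] : quasiIsos k f := by
  have : IsIso f.hom := inferInstanceAs (IsIso ((forgetToComplex k).map f))
  exact inferInstanceAs (QuasiIso f.hom)

lemma flatMorphisms_of_isIso {A B : DGLieAlgebra k} (i : A ⟶ B) [IsIso i] : flatMorphisms k i := by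
  intro A' B' X Y g i' g' f j h sq sq' hf
  have hi' : IsIso i' := of_isPushout (P := isomorphisms _) sq (isomorphisms.infer_property i)
  have hj : IsIso j := of_isPushout (P := isomorphisms _) sq' hi'
  refine of_precomp _ i' h (quasiIsos_of_isIso i') ?_
  rw [← sq'.w]
  exact comp_mem _ _ _ hf (quasiIsos_of_isIso j)

instance : (flatMorphisms k).IsMultiplicative where
  id_mem A := flatMorphisms_of_isIso (𝟙 A)
  comp_mem i₁ i₂ h₁ h₂ A' B' X Y g i' g' f j h sq sq' hf := by
    have t := IsPushout.of_hasPushout g i₁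
    have sq₁ := IsPushout.of_top' sq t
    have hi' := t.inl_desc i' (i₂ ≫ g') (by rw [sq.w, Category.assoc])
    generalize t.desc i' (i₂ ≫ g') _ = v at sq₁ hi'
    subst hi'
    have t' := IsPushout.of_hasPushout f (pushout.inl g i₁)
    exact h₂ _ _ _ _ _ _ sq₁ (IsPushout.of_top' sq' t') (h₁ _ _ _ _ _ _ t t' hf)

instance : (flatMorphisms k).IsStableUnderRetracts where
  of_retract {A B A₁ B₁ i i₁} r hi A' B' X Y g i' g' f j h sq sq' hf := by
    obtain ⟨a, b, a', b', e₁, e₂, e₃, e₄⟩ : ∃ (a : A ⟶ A₁) (b : B ⟶ B₁) (a' : A₁ ⟶ A) (b' : B₁ ⟶ B),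
        a ≫ i₁ = i ≫ b ∧ a' ≫ i = i₁ ≫ b' ∧ a ≫ a' = 𝟙 _ ∧ b ≫ b' = 𝟙 _ :=
      ⟨_, _, _, _, r.i.w, r.r.w, r.retract_left, r.retract_right⟩
    have t := IsPushout.of_hasPushout (a' ≫ g) i₁
    have t' := IsPushout.of_hasPushout f (pushout.inl (a' ≫ g) i₁)
    -- `h` is a retract of the pushout of `f` along the cobase change of `i₁` to `A'`
    have e₅ : g ≫ pushout.inl (a' ≫ g) i₁ = i ≫ b ≫ pushout.inr (a' ≫ g) i₁ := by
      rw [← reassoc_of% e₁, ← pushout.condition, Category.assoc, reassoc_of% e₃]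
    have e₆ : (a' ≫ g) ≫ i' = i₁ ≫ b' ≫ g' := by
      rw [← reassoc_of% e₂, Category.assoc, sq.w]
    let s := sq.desc _ _ e₅
    let ρ := t.desc _ _ e₆
    have hs : i' ≫ s = _ := sq.inl_desc _ _ e₅
    have hs' : g' ≫ s = _ := sq.inr_desc _ _ e₅
    have hρ : pushout.inl _ _ ≫ ρ = _ := t.inl_desc _ _ e₆
    have hρ' : pushout.inr _ _ ≫ ρ = _ := t.inr_desc _ _ e₆
    have hsρ : s ≫ ρ = 𝟙 _ := sq.hom_ext (by rw [reassoc_of% hs, hρ, Category.comp_id])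
      (by rw [reassoc_of% hs', hρ', reassoc_of% e₄, Category.comp_id])
    have e₇ : f ≫ pushout.inl f (pushout.inl (a' ≫ g) i₁) = i' ≫ s ≫ pushout.inr _ _ := by
      rw [reassoc_of% hs, pushout.condition]
    have e₈ : f ≫ j = pushout.inl _ _ ≫ ρ ≫ h := by rw [reassoc_of% hρ, sq'.w]
    let S := sq'.desc _ _ e₇
    let R := t'.desc _ _ e₈
    have hS : j ≫ S = _ := sq'.inl_desc _ _ e₇
    have hS' : h ≫ S = _ := sq'.inr_desc _ _ e₇
    have hR : pushout.inl _ _ ≫ R = _ := t'.inl_desc _ _ e₈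
    have hR' : pushout.inr _ _ ≫ R = _ := t'.inr_desc _ _ e₈
    have hSR : S ≫ R = 𝟙 _ := sq'.hom_ext (by rw [reassoc_of% hS, hR, Category.comp_id])
      (by rw [reassoc_of% hS', hR', reassoc_of% hsρ, Category.comp_id])
    exact of_retract (P := quasiIsos k) (f := h) (g := pushout.inr _ _)
      { i := Arrow.homMk s S hS'.symm
        r := Arrow.homMk ρ R hR'.symm
        retract := by ext1 <;> assumption } (hi _ _ _ _ _ _ t t' hf)

section TransfiniteComposition

variable {C : Type*} [Category C] {J : Type*} [Category J]

/-- The cobase change along `g : A ⟶ A'` of a functor `F` under `A`: `P j` is the pushout of `g` and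
of `α j : A ⟶ F j`. -/
lemma exists_isPushout_functor [HasPushouts C] {A A' : C} (g : A ⟶ A') {F : J ⥤ C}
    (α : ∀ j, A ⟶ F.obj j) (hα : ∀ {j l} (a : j ⟶ l), α j ≫ F.map a = α l) :
    ∃ (P : J ⥤ C) (β : ∀ j, A' ⟶ P.obj j) (γ : F ⟶ P),
      (∀ {j l} (a : j ⟶ l), β j ≫ P.map a = β l) ∧ ∀ j, IsPushout g (α j) (β j) (γ.app j) := by
  let α' : (Functor.const J).obj A ⟶ F := { app := α, naturality j l a := by simp [hα a] }
  let sq := IsPushout.of_hasPushout ((Functor.const J).map g) α'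
  refine ⟨_, fun j ↦ (pushout.inl ((Functor.const J).map g) α').app j, pushout.inr _ _,
    fun {j l} a ↦ ?_, fun j ↦ sq.map ((evaluation J C).obj j)⟩
  have := (pushout.inl ((Functor.const J).map g) α').naturality a
  dsimp at this
  rw [← this, Category.id_comp]

variable {A A' B' : C} {g : A ⟶ A'} {F P : J ⥤ C}
    {α : ∀ j, A ⟶ F.obj j} {β : ∀ j, A' ⟶ P.obj j} {γ : F ⟶ P}
    (hβ : ∀ {j l} (a : j ⟶ l), β j ≫ P.map a = β l)
    (hP : ∀ j, IsPushout g (α j) (β j) (γ.app j)) {c : Cocone F} {i : A ⟶ c.pt}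
    (hi : ∀ j, α j ≫ c.ι.app j = i) {i' : A' ⟶ B'} {g' : c.pt ⟶ B'}

/-- The cobase change of a cocone under `A`. -/
noncomputable def pushoutCocone (sq : g ≫ i' = i ≫ g') : Cocone P where
  pt := B'
  ι :=
    { app j := (hP j).desc i' (c.ι.app j ≫ g') (by rw [sq, ← hi j, Category.assoc])
      naturality j l a := by
        have := γ.naturality_assoc a ((hP l).desc i' (c.ι.app l ≫ g')
          (by rw [sq, ← hi l, Category.assoc]))
        refine (hP j).hom_ext ?_ ?_
        · simp only [Functor.const_obj_obj, Functor.const_obj_map, Category.comp_id,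
            IsPushout.inl_desc]
          rw [← Category.assoc, hβ a, IsPushout.inl_desc]
        · simp [← this] }

lemma comp_pushoutCocone_ι₁ (sq : g ≫ i' = i ≫ g') (j : J) {Z : C} (m : B' ⟶ Z) :
    β j ≫ (pushoutCocone hβ hP hi sq).ι.app j ≫ m = i' ≫ m :=
  (Category.assoc ..).symm.trans (congrArg (· ≫ m) ((hP j).inl_desc ..))

lemma comp_pushoutCocone_ι₂ (sq : g ≫ i' = i ≫ g') (j : J) {Z : C} (m : B' ⟶ Z) :
    γ.app j ≫ (pushoutCocone hβ hP hi sq).ι.app j ≫ m = c.ι.app j ≫ g' ≫ m :=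
  ((Category.assoc ..).symm.trans (congrArg (· ≫ m) ((hP j).inr_desc ..))).trans
    (Category.assoc ..)

/-- Cobase change commutes with filtered colimits under `A`. -/
noncomputable def isColimitPushoutCocone [IsFiltered J] (hc : IsColimit c)
    (sq : IsPushout g i i' g') : IsColimit (pushoutCocone hβ hP hi sq.w) := by
  have key (s : Cocone P) (j l : J) : β j ≫ s.ι.app j = β l ≫ s.ι.app l := by
    have h (j l : J) (a : j ⟶ l) : β j ≫ s.ι.app j = β l ≫ s.ι.app l := by
      rw [← s.w a, reassoc_of% (hβ a)]
    rw [h _ _ (IsFiltered.leftToMax j l), h _ _ (IsFiltered.rightToMax j l)]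
  let t (s : Cocone P) : Cocone F := (Cocone.precompose γ).obj s
  let j₀ : J := IsFiltered.nonempty.some
  have w (s : Cocone P) : g ≫ β j₀ ≫ s.ι.app j₀ = i ≫ hc.desc (t s) := by
    rw [← hi j₀, Category.assoc, hc.fac, (hP j₀).w_assoc]
    rfl
  exact
    { desc s := sq.desc (β j₀ ≫ s.ι.app j₀) (hc.desc (t s)) (w s)
      fac s j := by
        refine (hP j).hom_ext ?_ ?_
        · exact (comp_pushoutCocone_ι₁ hβ hP hi sq.w j _).trans
            ((sq.inl_desc ..).trans (key s j₀ j))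
        · exact (comp_pushoutCocone_ι₂ hβ hP hi sq.w j _).trans
            ((congrArg _ (sq.inr_desc ..)).trans (hc.fac _ j))
      uniq s m hm := by
        refine sq.hom_ext ?_ (hc.hom_ext fun j ↦ ?_)
        · rw [sq.inl_desc, ← hm j₀]
          exact (comp_pushoutCocone_ι₁ hβ hP hi sq.w j₀ m).symm
        · rw [sq.inr_desc, hc.fac]
          exact (comp_pushoutCocone_ι₂ hβ hP hi sq.w j m).symm.trans (congrArg _ (hm j)) }

end TransfiniteComposition

/-- Flat morphisms under `A` are stable under filtered colimits, as quasi-isomorphisms are. -/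
lemma flatMorphisms_of_isColimit {J : Type u} [SmallCategory J] [IsFiltered J]
    {F : J ⥤ DGLieAlgebra k} {A : DGLieAlgebra k} {α : ∀ j, A ⟶ F.obj j}
    (hα : ∀ {j l} (a : j ⟶ l), α j ≫ F.map a = α l) {c : Cocone F}
    (hc : IsColimit c) {i : A ⟶ c.pt} (hi : ∀ j, α j ≫ c.ι.app j = i)
    (h : ∀ j, flatMorphisms k (α j)) : flatMorphisms k i := by
  intro A' B' X Y g i' g' f i'' h' sq sq' hf
  obtain ⟨P, β, γ, hβ, hP⟩ := exists_isPushout_functor g α hα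
  obtain ⟨Q, β', γ', hβ', hQ⟩ := exists_isPushout_functor f β hβ
  have hQ' (j : J) := (hP j).paste_horiz (hQ j)
  refine IsStableUnderColimitsOfShape.condition (W := quasiIsos k) _ _ _ _
    (isColimitPushoutCocone hβ hP hi hc sq)
    (isColimitPushoutCocone hβ' (γ := γ ≫ γ') hQ' hi hc (sq.paste_horiz sq')) γ'
    (fun j ↦ h j _ _ _ _ _ _ (hP j) (hQ j) hf) h' (fun j ↦ ?_)
  refine (hP j).hom_ext ?_ ?_
  · refine (comp_pushoutCocone_ι₁ hβ hP hi sq.w j h').trans ?_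
    rw [← sq'.w, ← (hQ j).w_assoc]
    exact congrArg (f ≫ ·) ((hQ' j).inl_desc ..).symm
  · refine (comp_pushoutCocone_ι₂ hβ hP hi sq.w j h').trans ?_
    exact ((hQ' j).inr_desc ..).symm.trans (Category.assoc ..)

open Order in
lemma flatMorphisms_of_transfiniteComposition {W : MorphismProperty (DGLieAlgebra k)}
    (hW : W ≤ flatMorphisms k) {J : Type u} [LinearOrder J] [SuccOrder J] [OrderBot J]
    [WellFoundedLT J] {A B : DGLieAlgebra k} {f : A ⟶ B}
    (hf : W.TransfiniteCompositionOfShape J f) : flatMorphisms k f := by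
  have h (j : J) : flatMorphisms k (hf.F.map (homOfLE bot_le : ⊥ ⟶ j)) := by
    induction j using SuccOrder.limitRecOn with
    | isMin j hj =>
      obtain rfl := hj.eq_bot
      simpa using id_mem (flatMorphisms k) _
    | succ j hj hj' =>
      rw [← homOfLE_comp bot_le (Order.le_succ j), hf.F.map_comp]
      exact comp_mem _ _ _ hj' (hW _ (hf.map_mem j hj))
    | isSuccLimit j hj hj' =>
      have : Nonempty (Set.Iio j) := ⟨⊥, Order.IsSuccLimit.bot_lt hj⟩
      exact flatMorphisms_of_isColimit (J := Set.Iio j)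
        (α := fun l ↦ hf.F.map (homOfLE bot_le : ⊥ ⟶ l.1))
        (fun a ↦ (hf.F.map_comp _ _).symm) (hf.F.isColimitOfIsWellOrderContinuous j hj)
        (fun l ↦ (hf.F.map_comp _ _).symm) (fun l ↦ hj' l.1 l.2)
  rw [← hf.fac]
  exact comp_mem _ _ _ (flatMorphisms_of_isIso _)
    (flatMorphisms_of_isColimit (α := fun j ↦ hf.F.map (homOfLE bot_le : ⊥ ⟶ j))
      (fun a ↦ (hf.F.map_comp _ _).symm) hf.isColimit
      (fun j ↦ (hf.incl.naturality _).trans (Category.comp_id _)) h)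

variable (k) in
lemma cofibrations_le_flatMorphisms [CharZero k] :
    cofibrations (DGLieAlgebra k) ≤ flatMorphisms k := by
  rw [cofibrations_eq, llp_rlp_of_hasSmallObjectArgument.{u}, retracts_le_iff]
  intro A B i hi
  rw [transfiniteCompositions_iff] at hi
  obtain ⟨J, _, _, _, _, ⟨hi⟩⟩ := hi
  exact flatMorphisms_of_transfiniteComposition
    ((pushouts_coproducts_generatingCofibrations_le k).trans cellAttachments_le_flatMorphisms) hi

end LeftProper

end DGLieAlgebra

theorem proposition3p1p6 (k : Type u) [Field k] [CharZero k] :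
    ∃ _ : ModelCategory (DGLieAlgebra k),
      weakEquivalences (DGLieAlgebra k) = DGLieAlgebra.quasiIsos k ∧
      fibrations (DGLieAlgebra k) = DGLieAlgebra.degreewiseSurjections k ∧
      IsGeneratedBy.{u} (cofibrations (DGLieAlgebra k)) (DGLieAlgebra.generatingCofibrations k) ∧
      IsCombinatorialModelCategory.{u} (DGLieAlgebra k) ∧
      IsLeftProperModelCategory (DGLieAlgebra k) := by
  let _ := DGLieAlgebra.modelCategory k
  have hI : IsGeneratedBy.{u} (cofibrations (DGLieAlgebra k))
      (DGLieAlgebra.generatingCofibrations k) :=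
    (DGLieAlgebra.cofibrations_eq k).trans (MorphismProperty.llp_rlp_of_hasSmallObjectArgument _)
  have hJ : IsGeneratedBy.{u} (trivialCofibrations (DGLieAlgebra k))
      (DGLieAlgebra.generatingTrivialCofibrations k) :=
    (DGLieAlgebra.trivialCofibrations_eq k).trans
      (MorphismProperty.llp_rlp_of_hasSmallObjectArgument _)
  refine ⟨DGLieAlgebra.modelCategory k, rfl, rfl, hI, ?_, ?_⟩
  · exact
      { isLocallyPresentable := inferInstance
        hasLimits := inferInstance
        hasColimits := inferInstance
        cofibrations_generated := ⟨_, inferInstance, hI⟩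
        trivialCofibrations_generated := ⟨_, inferInstance, hJ⟩ }
  · intro A B X Y f i j h sq hi hf
    exact ⟨DGLieAlgebra.cofibrations_le_flatMorphisms k i hi.mem (𝟙 A) i (𝟙 B) f j h
      (IsPushout.of_horiz_isIso ⟨by simp⟩) sq hf.mem⟩
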